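/- Let $\mathbb G=(\mathbb R^{m}\times\mathbb R^{n},\circ)$ be a homogeneous Lie group: $\circ$ is a smooth group law for which every dilation $\delta_r(x_1,x_2)=(r x_1,r^2x_2)$, $r>0$, is an automorphism. Let $\mathfrak g$ be its Lie algebra (left-invariant vector fields), with center $\mathfrak z$, and suppose that $\mathfrak g$ is of H-type with respect to a fixed inner product $\langle\cdot,\cdot\rangle$, i.e. $[\mathfrak z^\perp,\mathfrak z^\perp]=\mathfrak z$ and, for every $z\in\mathfrak z$ with $\langle z,z\rangle=1$, the map $J_z:\mathfrak z^\perp\to\mathfrak z^\perp$ defined by $\langle J_z v,w\rangle=\langle z,[v,w]\rangle$ for all $w\in\mathfrak z^\perp$ is orthogonal. (Then $\dim\mathfrak z^\perp=m$ and $\dim\mathfrak z=n$.) Put $Q=m+2n$ and $\|q\|^2=\langle q,q\rangle$. Write $x=\mathrm{Exp}(v(x)+z(x))$ with $v(x)\in\mathfrak z^\perp$, $z(x)\in\mathfrak z$, and let $$B_R(x_0)=x_0\circ\{x\in\mathbb G:\ \|v(x)\|^4+16\|z(x)\|^2<R^4\}.$$ Let $|\cdot|$ be the Lebesgue measure. Let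 $0<\lambda\le\Lambda$ and $0<\delta\le 2$. Then there are constants $\varepsilon\in(0,1)$ and $c>0$, depending only on $\lambda,\Lambda,\delta$ and $\mathbb G$ (with its inner product), such that the following holds. Let $X_1,\dots,X_m$ be an orthonormal basis of $\mathfrak z^\perp$, let $\Omega\subseteq\mathbb G$ be open, and let $A=(a_{ij})$ be a function from $\Omega$ to the symmetric real $m\times m$ matrices such that, for every $x\in\Omega$, $$\lambda\|\xi\|^2\le\langle A(x)\xi,\xi\rangle\le\Lambda\|\xi\|^2\qquad\text{for all }\xi\in\mathbb R^m,$$ and the $\delta$-Landis condition holds: $$\mathrm{Tr}(A(x))+(Q+2-m)\max_{\|\xi\|=1}\langle A(x)\xi,\xi\rangle\le(Q+4-\delta)\min_{\|\xi\|=1}\langle A(x)\xi,\xi\rangle .$$ Then the family of all functions $u\in C^2(V)$, $V\subseteq\Omega$ open, with $u\ge0$ and $\mathcal L_Au=\sum_{i,j=1}^m a_{ij}X_iX_ju\le0$ in $V$ has the critical density property with constants $\varepsilon$ and $c$: for every $x_0\in\mathbb G$ and $R>0$ with $B_{2R}(x_0)\subseteq\Omega$, and every $u$ in the family whose domain contains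 $B_{2R}(x_0)$, $$|\{x\in B_R(x_0):u(x)\ge1\}|\ge\varepsilon\,|B_R(x_0)|\quad\Longrightarrow\quad\inf_{B_{R/2}(x_0)}u\ge c .$$ -/

import Mathlib

open scoped Manifold ContDiff
open MeasureTheory

noncomputable section

/-! ### H-type Lie algebras -/

namespace HType

section LieAlg

variable {L : Type*} [LieRing L] [LieAlgebra ℝ L]

/-- The orthogonal complement `𝔷^⊥` of the center `𝔷` of a real Lie algebra, with respect to a
bilinear form. -/
def horizontal (B : LinearMap.BilinForm ℝ L) : Submodule ℝ L :=
  LinearMap.BilinForm.orthogonal B (LieAlgebra.center ℝ L).toSubmodule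

/-- `B` is an inner product which makes the real Lie algebra `L` an H-type algebra: the brackets of
elements of `𝔷^⊥` span the center `𝔷`, and for each `z ∈ 𝔷` with `⟨z, z⟩ = 1` the map
`J_z : 𝔷^⊥ → 𝔷^⊥` given by `⟨J_z v, w⟩ = ⟨z, [v, w]⟩` is orthogonal. -/
structure IsHTypeInner (B : LinearMap.BilinForm ℝ L) : Prop where
  symm : ∀ v w : L, B v w = B w v
  pos : ∀ v : L, v ≠ 0 → 0 < B v v
  span_bracket :
    Submodule.span ℝ {y : L | ∃ v ∈ horizontal B, ∃ w ∈ horizontal B, ⁅v, w⁆ = y} =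
      (LieAlgebra.center ℝ L).toSubmodule
  orthogonal_J : ∀ z ∈ LieAlgebra.center ℝ L, B z z = 1 →
    ∃ J : horizontal B →ₗ[ℝ] horizontal B,
      (∀ v w : horizontal B, B (J v : L) (w : L) = B z ⁅(v : L), (w : L)⁆) ∧
      ∀ v w : horizontal B, B (J v : L) (J w : L) = B (v : L) (w : L)

/-- `X_1, …, X_m` is an orthonormal basis of `𝔷^⊥`. -/
def IsHorizontalONB {m : ℕ} (B : LinearMap.BilinForm ℝ L) (X : Fin m → L) : Prop :=
  (∀ i j, B (X i) (X j) = if i = j then 1 else 0) ∧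
    Submodule.span ℝ (Set.range X) = horizontal B

end LieAlg

/-! ### Elliptic matrices and the Cordes–Landis condition -/

section Matrices

variable {m : ℕ}

/-- The symmetric `m × m` matrices with `lam ‖ξ‖² ≤ ⟨M ξ, ξ⟩ ≤ Lam ‖ξ‖²` for all `ξ`. -/
def IsElliptic (lam Lam : ℝ) (M : Matrix (Fin m) (Fin m) ℝ) : Prop :=
  M.IsSymm ∧ ∀ ξ : Fin m → ℝ,
    lam * (ξ ⬝ᵥ ξ) ≤ M.mulVec ξ ⬝ᵥ ξ ∧ M.mulVec ξ ⬝ᵥ ξ ≤ Lam * (ξ ⬝ᵥ ξ)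

/-- The values `⟨M ξ, ξ⟩` over the Euclidean unit sphere. -/
def sphereValues (M : Matrix (Fin m) (Fin m) ℝ) : Set ℝ :=
  (fun ξ : Fin m → ℝ => M.mulVec ξ ⬝ᵥ ξ) '' {ξ | ξ ⬝ᵥ ξ = 1}

/-- The `δ`-Landis condition at one point, where `Q = m + 2n`. The supremum and the infimum are
a maximum and a minimum, by compactness of the sphere. -/
def IsLandis (n : ℕ) (δ : ℝ) (M : Matrix (Fin m) (Fin m) ℝ) : Prop :=
  let Q : ℝ := m + 2 * n
  M.trace + (Q + 2 - m) * sSup (sphereValues M) ≤ (Q + 4 - δ) * sInf (sphereValues M)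

end Matrices

/-! ### The critical density property -/

/-- The critical density property with constants `ε` and `c`, for a family `K` of real functions
with domains in `Ω`. A member of the family is a pair of a domain `V` and a function `u`, of which
only the values on `V` are meant. The conclusion says that the infimum of `u` on `B_{R/2}(x₀)` is
at least `c`. -/
def CriticalDensity {G : Type*} [MeasurableSpace G] (μ : Measure G) (ball : G → ℝ → Set G)
    (Ω : Set G) (K : Set (Set G × (G → ℝ))) (ε c : ℝ) : Prop :=
  ∀ (x₀ : G) (R : ℝ), 0 < R → ball x₀ (2 * R) ⊆ Ω →
    ∀ (V : Set G) (u : G → ℝ), (V, u) ∈ K → ball x₀ (2 * R) ⊆ V →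
      ENNReal.ofReal ε * μ (ball x₀ R) ≤ μ {x ∈ ball x₀ R | 1 ≤ u x} →
        ∀ x ∈ ball x₀ (R / 2), c ≤ u x

/-! ### Smooth group laws on a normed space -/

/-- This lets Lean find the Lie algebra structure on the Lie algebra of a smooth real Lie group. -/
instance minSmoothness_leInfty : ENat.LEInfty (minSmoothness ℝ 3) :=
  ⟨by rw [minSmoothness_of_isRCLikeNormedField]; exact ENat.LEInfty.out⟩

section Groups

variable {m : ℕ} {E : Type*} [NormedAddCommGroup E] [NormedSpace ℝ E] [Group E]

variable (E) in
/-- The (multiplicative) group law on the vector space `E` makes it a smooth Lie group, for the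
standard manifold structure of `E`. -/
abbrev SmoothGroup : Prop := LieGroup 𝓘(ℝ, E) ∞ E

variable (E) in
/-- The Lie algebra of the group `E`: the tangent space at the identity, with the Lie bracket of
left-invariant vector fields. -/
abbrev LieAlg : Type _ := GroupLieAlgebra 𝓘(ℝ, E) E

/-- `x = Exp(w)`: `x` is the value at time `1` of the integral curve, starting from the identity, of
the left-invariant vector field given by `w`. -/
def IsExp (w : LieAlg E) (x : E) : Prop :=
  ∃ γ : ℝ → E, γ 0 = 1 ∧ (∀ t : ℝ, HasDerivAt γ (mulInvariantVectorField w (γ t)) t) ∧ γ 1 = x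

/-- The derivative of `f` along the left-invariant vector field given by `w`. -/
def lieDeriv (w : LieAlg E) (f : E → ℝ) (x : E) : ℝ :=
  fderiv ℝ f x (mulInvariantVectorField w x)

/-- The operator `L_A u = ∑ a_{ij} X_i X_j u`. -/
def nondivOp (X : Fin m → LieAlg E) (A : E → Matrix (Fin m) (Fin m) ℝ) (u : E → ℝ) (x : E) : ℝ :=
  ∑ i, ∑ j, A x i j * lieDeriv (X i) (lieDeriv (X j) u) x

/-- The family of the nonnegative `C²` functions `u` on open sets `V ⊆ Ω` with `L_A u ≤ 0`. -/
def supersolutions (X : Fin m → LieAlg E) (Ω : Set E) (A : E → Matrix (Fin m) (Fin m) ℝ) :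
    Set (Set E × (E → ℝ)) :=
  {p | IsOpen p.1 ∧ p.1 ⊆ Ω ∧ ContDiffOn ℝ 2 p.2 p.1 ∧ (∀ x ∈ p.1, 0 ≤ p.2 x) ∧
    ∀ x ∈ p.1, nondivOp X A p.2 x ≤ 0}

/-- The ball `B_R(x₀) = x₀ ∘ {x : ‖v(x)‖⁴ + 16 ‖z(x)‖² < R⁴}`, where `x = Exp(v(x) + z(x))` with
`v(x) ∈ 𝔷^⊥` and `z(x) ∈ 𝔷`, and `‖q‖² = ⟨q, q⟩ = B q q`. -/
def gaugeBall [CompleteSpace E] [SmoothGroup E] (B : LinearMap.BilinForm ℝ (LieAlg E)) (x₀ : E)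
    (R : ℝ) : Set E :=
  (fun x => x₀ * x) '' {x | ∃ v ∈ horizontal B, ∃ z ∈ LieAlgebra.center ℝ (LieAlg E),
    IsExp (v + z) x ∧ (B v v) ^ 2 + 16 * B z z < R ^ 4}

end Groups

/-! ### The space `ℝ^m × ℝ^n` and its dilations -/

/-- The space `ℝ^N = ℝ^m × ℝ^n`. -/
abbrev Space (m n : ℕ) : Type := EuclideanSpace ℝ (Fin m ⊕ Fin n)

/-- The dilation `(x₁, x₂) ↦ (r x₁, r² x₂)`. -/
def dilation {m n : ℕ} (r : ℝ) (x : Space m n) : Space m n :=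
  WithLp.toLp 2 (Sum.elim (fun i => r * x (Sum.inl i)) (fun k => r ^ 2 * x (Sum.inr k)))

end HType

end

/-! The proof rests on an explicit subsolution. Write N for `gauge`, which is homogeneous of degree
4, and put α = (Q - δ)/4. On an H-type group the horizontal gradient satisfies |∇N|² = 16|p|²N, and
the horizontal second derivatives of N, paired with A, give at most 4|p|²(Tr A + (2n+2) max). In
L_A(N^{-α}) the gradient term helps and the second-order term hurts; the Landis condition says that
the first one wins off the origin (`secondOp_gauge_rpow_nonneg`). The matrix enters only pointwise,
so no regularity of A is needed.

Since 4α = Q - δ < Q, the kernel N^{-α} is locally integrable. Hence the potentials w(y) = ∫_E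
N(e⁻¹∘y)^{-α} de of compact subsets E of the unit ball are bounded by a constant M and are
subsolutions off E (`potential_le`, `potential_subsolution`). If v ≥ 0 is a supersolution with v ≥ 1
on E and v(0) ≤ 1/2, the maximum principle on the part of the unit ball where v ≤ 1/2 gives v(0) ≥
(w(0) - b)/(2M), where b bounds w on the unit sphere (`potential_comparison`). When E lies in a
small ball of radius η around 0, the singularity makes w(0) exceed b by at least |E|, so a
supersolution that is at least 1 on half of that small ball is bounded below at the centre
(`exists_center_bound`). For a general point of the half ball, a dilated translate of this picture
is placed there; if ε is close enough to 1, the set where u < 1 is too small to fill half of any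
such small ball (`exists_criticalDensity`).

The constants must not depend on the orthonormal basis X, hence not on the structure constants.
These have absolute value at most 1, and compactness makes every smallness choice uniform
(`exists_gauge_ball_forall_lt`).

It remains to identify the given group with the model. A smooth product compatible with the
dilations is a polynomial x + y + β(x, y) (`exists_bilinear_group_law`), so the exponential map and
the bracket are explicit. The chart y ↦ x₀∘Exp(δ_R y) turns the model fields into R X_j, gauge balls
into gauge balls, and Lebesgue measure into a multiple of itself; the density hypothesis does not
see this multiple. -/

noncomputable section

namespace HType

/-! ### The model group in exponential coordinates -/

/-- The coordinate space `ℝ^m × ℝ^n` of an H-type algebra. -/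
abbrev Model (m n : ℕ) : Type := (Fin m → ℝ) × (Fin n → ℝ)

namespace Model

variable {m n : ℕ}

/-- The fourth power of the homogeneous norm: `|p|⁴ + 16 |q|²`. -/
def gauge (y : Model m n) : ℝ := (∑ i, y.1 i ^ 2) ^ 2 + 16 * ∑ k, y.2 k ^ 2

/-- The group law with structure constants `c`, in exponential coordinates. -/
def op (c : Fin n → Fin m → Fin m → ℝ) (x y : Model m n) : Model m n :=
  (x.1 + y.1, x.2 + y.2 + fun k => 1 / 2 * ∑ i, ∑ j, c k i j * x.1 i * y.1 j)

/-- The dilation `(p, q) ↦ (r p, r² q)`. -/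
def dil (r : ℝ) (y : Model m n) : Model m n := (r • y.1, r ^ 2 • y.2)

/-- The left-invariant vector field with value `(e_j, 0)` at the origin. -/
def field (c : Fin n → Fin m → Fin m → ℝ) (j : Fin m) (y : Model m n) : Model m n :=
  (Pi.single j 1, fun k => 1 / 2 * ∑ i, y.1 i * c k i j)

/-- The structure constants of an H-type algebra in orthonormal bases. -/
structure IsHType (c : Fin n → Fin m → Fin m → ℝ) : Prop where
  antisymm : ∀ k i j, c k i j = -c k j i
  norm_J : ∀ (q : Fin n → ℝ) (p : Fin m → ℝ),
    ∑ j, (∑ k, q k * ∑ i, p i * c k i j) ^ 2 = (∑ k, q k ^ 2) * ∑ i, p i ^ 2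

/-! ### The gauge and the dilations. -/

theorem gauge_nonneg (y : Model m n) : 0 ≤ gauge y := by
  unfold gauge; positivity

theorem gauge_zero : gauge (0 : Model m n) = 0 := by simp [gauge]

theorem gauge_neg (y : Model m n) : gauge (-y) = gauge y := by simp [gauge]

theorem gauge_eq_zero {y : Model m n} : gauge y = 0 ↔ y = 0 := by
  refine ⟨fun h => ?_, fun h => by rw [h, gauge_zero]⟩
  have h1 : 0 ≤ (∑ i, y.1 i ^ 2) := by positivity
  have h2 : 0 ≤ ∑ k, y.2 k ^ 2 := by positivity
  unfold gauge at h
  have h3 : (∑ i, y.1 i ^ 2) = 0 := by nlinarith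
  have h4 : ∑ k, y.2 k ^ 2 = 0 := by nlinarith
  rw [Finset.sum_eq_zero_iff_of_nonneg (fun _ _ => sq_nonneg _)] at h3 h4
  ext i
  · simpa using h3 i (Finset.mem_univ _)
  · simpa using h4 i (Finset.mem_univ _)

theorem gauge_pos {y : Model m n} (h : y ≠ 0) : 0 < gauge y :=
  (gauge_nonneg y).lt_of_ne fun h' => h (gauge_eq_zero.1 h'.symm)

theorem gauge_dil (r : ℝ) (y : Model m n) : gauge (dil r y) = r ^ 4 * gauge y := by
  simp only [gauge, dil, Pi.smul_apply, smul_eq_mul, mul_pow, ← Finset.mul_sum]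
  ring

theorem contDiff_gauge {k : WithTop ℕ∞} : ContDiff ℝ k (gauge : Model m n → ℝ) := by
  unfold gauge; fun_prop

theorem continuous_gauge : Continuous (gauge : Model m n → ℝ) :=
  (contDiff_gauge (k := 0)).continuous

theorem dil_dil (r s : ℝ) (y : Model m n) : dil r (dil s y) = dil (r * s) y := by
  simp [dil, smul_smul, mul_pow]

theorem dil_one (y : Model m n) : dil 1 y = y := by simp [dil]

theorem continuous_dil (r : ℝ) : Continuous (dil r : Model m n → Model m n) := by
  unfold dil; fun_prop

theorem norm_le_of_gauge_le {r : ℝ} (hr : 0 ≤ r) (hr1 : r ≤ 1) {y : Model m n}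
    (h : gauge y ≤ r ^ 4) : ‖y‖ ≤ r := by
  have h1 : 0 ≤ ∑ i, y.1 i ^ 2 := by positivity
  have h2 : 0 ≤ ∑ k, y.2 k ^ 2 := by positivity
  unfold gauge at h
  have h3 : ∑ i, y.1 i ^ 2 ≤ r ^ 2 := by
    apply le_of_sq_le_sq _ (by positivity)
    nlinarith
  have h4 : ∑ k, y.2 k ^ 2 ≤ r ^ 2 := by
    have : r ^ 4 ≤ r ^ 2 := pow_le_pow_of_le_one hr hr1 (by norm_num)
    nlinarith
  rw [Prod.norm_def, max_le_iff, pi_norm_le_iff_of_nonneg hr, pi_norm_le_iff_of_nonneg hr]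
  constructor
  · intro i
    have := (Finset.single_le_sum (f := fun i => y.1 i ^ 2) (fun _ _ => sq_nonneg _)
      (Finset.mem_univ i)).trans h3
    exact abs_le_of_sq_le_sq this hr
  · intro i
    have := (Finset.single_le_sum (f := fun i => y.2 i ^ 2) (fun _ _ => sq_nonneg _)
      (Finset.mem_univ i)).trans h4
    exact abs_le_of_sq_le_sq this hr

theorem isCompact_gauge_le {r : ℝ} (hr : 0 ≤ r) (hr1 : r ≤ 1) :
    IsCompact {y : Model m n | gauge y ≤ r ^ 4} := by
  refine Metric.isCompact_of_isClosed_isBounded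
    (isClosed_le continuous_gauge continuous_const) ?_
  refine (Metric.isBounded_closedBall (x := (0 : Model m n)) (r := r)).subset fun y hy => ?_
  simpa using norm_le_of_gauge_le hr hr1 hy

/-! ### The model group law, with inverse `-x`. -/

theorem continuous_op :
    Continuous fun t : (Fin n → Fin m → Fin m → ℝ) × Model m n × Model m n =>
      op t.1 t.2.1 t.2.2 := by
  unfold op; fun_prop

theorem contDiff_op (c : Fin n → Fin m → Fin m → ℝ) {k : WithTop ℕ∞} :
    ContDiff ℝ k fun t : Model m n × Model m n => op c t.1 t.2 := by
  unfold op; fun_prop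

theorem op_zero (c : Fin n → Fin m → Fin m → ℝ) (x : Model m n) : op c x 0 = x := by
  ext k <;> simp [op]

theorem zero_op (c : Fin n → Fin m → Fin m → ℝ) (x : Model m n) : op c 0 x = x := by
  ext k <;> simp [op]

theorem op_assoc (c : Fin n → Fin m → Fin m → ℝ) (x y z : Model m n) :
    op c (op c x y) z = op c x (op c y z) := by
  ext k
  · simp [op, add_assoc]
  · simp only [op, Pi.add_apply, mul_add, add_mul, Finset.sum_add_distrib]
    ring

theorem sum_antisymm {c : Fin m → Fin m → ℝ} (hc : ∀ i j, c i j = -c j i) (x y : Fin m → ℝ) :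
    ∑ i, ∑ j, c i j * x i * y j = -∑ i, ∑ j, c i j * y i * x j := by
  rw [Finset.sum_comm, ← Finset.sum_neg_distrib]
  refine Finset.sum_congr rfl fun i _ => ?_
  rw [← Finset.sum_neg_distrib]
  refine Finset.sum_congr rfl fun j _ => ?_
  rw [hc j i]; ring

theorem neg_op_self {c : Fin n → Fin m → Fin m → ℝ} (hc : IsHType c) (x : Model m n) :
    op c (-x) x = 0 := by
  ext k
  · simp [op]
  · have := sum_antisymm (hc.antisymm k) x.1 x.1
    simp only [op, Prod.fst_neg, Prod.snd_neg, Pi.add_apply, Pi.neg_apply, mul_neg, neg_mul,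
      Finset.sum_neg_distrib, Prod.snd_zero, Pi.zero_apply]
    linarith

theorem op_neg_self {c : Fin n → Fin m → Fin m → ℝ} (hc : IsHType c) (x : Model m n) :
    op c x (-x) = 0 := by
  simpa using neg_op_self hc (-x)

/-- This is (x⁻¹y)⁻¹ = y⁻¹x. With the evenness of the gauge it makes the kernel symmetric in pole
and variable. -/
theorem neg_op_rev {c : Fin n → Fin m → Fin m → ℝ} (hc : IsHType c) (x y : Model m n) :
    -op c (-x) y = op c (-y) x := by
  ext k
  · simp [op]
  · have := sum_antisymm (hc.antisymm k) x.1 y.1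
    simp only [op, Prod.fst_neg, Prod.snd_neg, Pi.add_apply, Pi.neg_apply, mul_neg, neg_mul,
      Finset.sum_neg_distrib]
    linarith

theorem gauge_neg_op_comm {c : Fin n → Fin m → Fin m → ℝ} (hc : IsHType c) (x y : Model m n) :
    gauge (op c (-x) y) = gauge (op c (-y) x) := by
  rw [← neg_op_rev hc, gauge_neg]

theorem gauge_neg_op_pos {c : Fin n → Fin m → Fin m → ℝ} (hc : IsHType c) {x y : Model m n}
    (h : y ≠ x) : 0 < gauge (op c (-x) y) := by
  refine gauge_pos fun h0 => h ?_
  have := congrArg (op c x) h0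
  rwa [← op_assoc, op_neg_self hc, zero_op, op_zero] at this

/-- On basis vectors, `norm_J` says that each row of each matrix `c k` is a unit vector. The bound
confines all admissible structure constants to one compact cube, which is what makes later choices
independent of the basis. -/
theorem IsHType.abs_le_one {c : Fin n → Fin m → Fin m → ℝ} (hc : IsHType c) (k : Fin n)
    (i j : Fin m) : |c k i j| ≤ 1 := by
  have h := hc.norm_J (Pi.single k 1) (Pi.single i 1)
  have e1 : ∑ l, (Pi.single k (1 : ℝ) : Fin n → ℝ) l ^ 2 = 1 := by
    simp [Pi.single_apply, ite_pow]
  have e2 : ∑ l, (Pi.single i (1 : ℝ) : Fin m → ℝ) l ^ 2 = 1 := by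
    simp [Pi.single_apply, ite_pow]
  rw [e1, e2] at h
  simp only [Pi.single_apply, ite_mul, one_mul, zero_mul, Finset.sum_ite_eq',
    Finset.mem_univ, if_true] at h
  have := Finset.single_le_sum (f := fun j => c k i j ^ 2) (fun _ _ => sq_nonneg _)
      (Finset.mem_univ j)
  rw [h] at this
  exact abs_le_one_iff_mul_self_le_one.2 (by nlinarith)

/-- A uniform form of continuity at the origin: the neighbourhood of the origin does not depend on
the H-type structure constants. -/
theorem exists_gauge_ball_forall_lt {F : (Fin n → Fin m → Fin m → ℝ) × Model m n × Model m n → ℝ}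
    (hF : Continuous F) {K : Set (Model m n)} (hK : IsCompact K) {a : ℝ}
    (h0 : ∀ c, ∀ x ∈ K, F (c, x, 0) < a) :
    ∃ r : ℝ, 0 < r ∧ r ≤ 1 ∧ ∀ c : Fin n → Fin m → Fin m → ℝ, IsHType c → ∀ x ∈ K,
      ∀ y, gauge y ≤ r ^ 4 → F (c, x, y) < a := by
  have hC : IsCompact {c : Fin n → Fin m → Fin m → ℝ | ∀ k i j, c k i j ∈ Set.Icc (-1 : ℝ) 1} := by
    have := isCompact_univ_pi fun k : Fin n => isCompact_univ_pi fun i : Fin m =>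
      isCompact_univ_pi fun j : Fin m => (isCompact_Icc : IsCompact (Set.Icc (-1 : ℝ) 1))
    convert this using 1
    ext c; simp only [Set.mem_pi, Set.mem_ofPred_eq, Set.mem_univ, true_imp_iff]
  have hev : ∀ᶠ y in nhds (0 : Model m n), ∀ t ∈
      {c : Fin n → Fin m → Fin m → ℝ | ∀ k i j, c k i j ∈ Set.Icc (-1 : ℝ) 1} ×ˢ K,
      F (t.1, t.2, y) < a := by
    apply (hC.prod hK).eventually_forall_of_forall_eventually
    rintro ⟨c, x⟩ ⟨-, hx⟩
    have hcont : Continuous fun z : Model m n × ((Fin n → Fin m → Fin m → ℝ) × Model m n) =>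
      F (z.2.1, z.2.2, z.1) := by fun_prop
    exact hcont.continuousAt.eventually_lt_const (h0 c x hx)
  obtain ⟨r, hr, hball⟩ := Metric.eventually_nhds_iff.1 hev
  refine ⟨min (r / 2) 1, by positivity, min_le_right _ _, fun c hc x hx y hy => ?_⟩
  refine hball (y := y) ?_ (c, x) ⟨fun k i j => abs_le.1 (hc.abs_le_one k i j), hx⟩
  have := norm_le_of_gauge_le (by positivity) (min_le_right _ _) hy
  rw [dist_zero_right]
  exact this.trans_lt ((min_le_left _ _).trans_lt (by linarith))

/-! ### Lebesgue measure on the model -/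

/-- Translations followed by a vertical shear preserve Lebesgue measure. -/
theorem measurePreserving_shear (a : Fin m → ℝ) {g : (Fin m → ℝ) → Fin n → ℝ} (hg : Continuous g) :
    MeasurePreserving (fun y : Model m n => ((a + y.1, g y.1 + y.2) : Model m n)) :=
  (measurePreserving_add_left volume a).skew_product (g := fun p q => g p + q)
    (by fun_prop) (ae_of_all _ fun p => (measurePreserving_add_left volume (g p)).map_eq)

theorem measurePreserving_op_left (c : Fin n → Fin m → Fin m → ℝ) (x : Model m n) :
    MeasurePreserving (op c x) := by
  have := measurePreserving_shear (n := n) x.1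
    (g := fun p => x.2 + fun k => 1 / 2 * ∑ i, ∑ j, c k i j * x.1 i * p j) (by fun_prop)
  convert this using 1
  ext y k
  · simp [op]
  · simp [op]; ring

theorem map_dil {r : ℝ} (hr : 0 < r) :
    Measure.map (dil r) (volume : Measure (Model m n)) =
      ENNReal.ofReal ((r ^ (m + 2 * n))⁻¹) • volume := by
  have h1 := Measure.map_addHaar_smul (volume : Measure (Fin m → ℝ)) hr.ne'
  have h2 := Measure.map_addHaar_smul (volume : Measure (Fin n → ℝ)) (pow_pos hr 2).ne'
  have h3 : (dil r : Model m n → Model m n) = Prod.map (fun p => r • p) fun q => r ^ 2 • q := rfl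
  rw [h3, Measure.volume_eq_prod, ← Measure.map_prod_map _ _ (by fun_prop) (by fun_prop), h1, h2]
  rw [Measure.prod_smul_left, Measure.prod_smul_right, smul_smul]
  congr 1
  rw [← ENNReal.ofReal_mul (by positivity)]
  simp only [Module.finrank_fin_fun]
  rw [abs_of_pos (by positivity), abs_of_pos (by positivity), pow_add, ← pow_mul, mul_inv]

end Model

end HType

end

noncomputable section

namespace HType

open Filter Topology

/-! ### Derivatives along vector fields -/

section FieldDeriv

variable {M N P : Type*} [NormedAddCommGroup M] [NormedSpace ℝ M] [NormedAddCommGroup N]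
  [NormedSpace ℝ N] [NormedAddCommGroup P] [NormedSpace ℝ P]

/-- The derivative of `f` along the vector field `X`. -/
def fieldDeriv (X : M → M) (f : M → ℝ) (x : M) : ℝ := fderiv ℝ f x (X x)

theorem fieldDeriv_congr {X : M → M} {f g : M → ℝ} {x : M} (h : f =ᶠ[𝓝 x] g) :
    fieldDeriv X f x = fieldDeriv X g x := by
  unfold fieldDeriv; rw [h.fderiv_eq]

theorem contDiffOn_fieldDeriv {X : M → M} {f : M → ℝ} {V : Set M} (hV : IsOpen V)
    {j k : WithTop ℕ∞} (hjk : j + 1 ≤ k) (hX : ContDiff ℝ j X) (hf : ContDiffOn ℝ k f V) :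
    ContDiffOn ℝ j (fieldDeriv X f) V :=
  (hf.fderiv_of_isOpen hV hjk).clm_apply hX.contDiffOn

/-- Derivatives along fields related by `T`, up to the factor `ρ`. -/
theorem fieldDeriv_comp {T : N → M} {X : M → M} {Y : N → N} {f : M → ℝ} {y : N} {ρ : ℝ}
    (hT : DifferentiableAt ℝ T y) (hf : DifferentiableAt ℝ f (T y))
    (h : fderiv ℝ T y (Y y) = ρ • X (T y)) :
    fieldDeriv Y (fun z => f (T z)) y = ρ * fieldDeriv X f (T y) := by
  have : fderiv ℝ (fun z => f (T z)) y = (fderiv ℝ f (T y)).comp (fderiv ℝ T y) :=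
    fderiv_comp y hf hT
  simp [fieldDeriv, this, h]

theorem fieldDeriv_const_mul (X : M → M) (ρ : ℝ) (f : M → ℝ) (x : M) :
    fieldDeriv X (fun z => ρ * f z) x = ρ * fieldDeriv X f x := by
  have : (fun z => ρ * f z) = ρ • f := rfl
  rw [fieldDeriv, this, fderiv_const_smul_field]
  rfl

/-- Used for left translations (ρ = 1), for dilated translations inside the model (ρ = θ) and for
the exponential chart (ρ = R). -/
theorem fieldDeriv_fieldDeriv_comp {T : N → M} {X₁ X₂ : M → M} {Y₁ Y₂ : N → N} {f : M → ℝ}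
    {V : Set M} (hV : IsOpen V) (hf : ContDiffOn ℝ 2 f V) (hX₂ : ContDiff ℝ 1 X₂)
    (hT : ContDiff ℝ 1 T) {ρ : ℝ} (h₁ : ∀ y, fderiv ℝ T y (Y₁ y) = ρ • X₁ (T y))
    (h₂ : ∀ y, fderiv ℝ T y (Y₂ y) = ρ • X₂ (T y)) {y : N} (hy : T y ∈ V) :
    fieldDeriv Y₁ (fieldDeriv Y₂ fun z => f (T z)) y =
      ρ ^ 2 * fieldDeriv X₁ (fieldDeriv X₂ f) (T y) := by
  have hTd : Differentiable ℝ T := hT.differentiable (by norm_num)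
  have hev : (fieldDeriv Y₂ fun z => f (T z)) =ᶠ[𝓝 y] fun z => ρ * fieldDeriv X₂ f (T z) := by
    filter_upwards [(hV.preimage hT.continuous).mem_nhds hy] with z hz
    exact fieldDeriv_comp (hTd z)
      ((hf.differentiableOn (by norm_num)).differentiableAt (hV.mem_nhds hz)) (h₂ z)
  have hd : DifferentiableAt ℝ (fieldDeriv X₂ f) (T y) :=
    ((contDiffOn_fieldDeriv hV (by norm_num) hX₂ hf).differentiableOn
      (by norm_num)).differentiableAt (hV.mem_nhds hy)
  rw [fieldDeriv_congr hev, fieldDeriv_const_mul, fieldDeriv_comp (hTd y) hd (h₁ y)]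
  ring

/-- The derivative along `X` as the derivative on a line. -/
theorem fieldDeriv_eq_of_hasDerivAt {X : M → M} {f : M → ℝ} {x : M} {a : ℝ}
    (hf : DifferentiableAt ℝ f x) (h : HasDerivAt (fun t : ℝ => f (x + t • X x)) a 0) :
    fieldDeriv X f x = a := by
  have h1 : HasLineDerivAt ℝ f (fderiv ℝ f x (X x)) x (X x) := hf.hasFDerivAt.hasLineDerivAt _
  exact HasDerivAt.unique h1 h

end FieldDeriv

/-! ### Second order operators and the maximum principle -/

section SecondOrder

variable {M : Type*} [NormedAddCommGroup M] [NormedSpace ℝ M] {m : ℕ}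

/-- The operator `∑ a_{ij} Y_i Y_j`. -/
def secondOp (Y : Fin m → M → M) (a : Matrix (Fin m) (Fin m) ℝ) (g : M → ℝ) (y : M) : ℝ :=
  ∑ i, ∑ j, a i j * fieldDeriv (Y i) (fieldDeriv (Y j) g) y

/-- Enough regularity of `g` at `y` for `Y_i Y_j g (y)` to make sense. -/
def TwiceDiffAt (Y : Fin m → M → M) (g : M → ℝ) (y : M) : Prop :=
  (∀ᶠ z in 𝓝 y, DifferentiableAt ℝ g z) ∧ ∀ j, DifferentiableAt ℝ (fieldDeriv (Y j) g) y

theorem twiceDiffAt_of_contDiffOn {Y : Fin m → M → M} (hY : ∀ j, ContDiff ℝ 1 (Y j)) {g : M → ℝ}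
    {V : Set M} (hV : IsOpen V) (hg : ContDiffOn ℝ 2 g V) {y : M} (hy : y ∈ V) :
    TwiceDiffAt Y g y := by
  refine ⟨?_, fun j => ?_⟩
  · filter_upwards [hV.mem_nhds hy] with z hz
    exact (hg.differentiableOn (by norm_num)).differentiableAt (hV.mem_nhds hz)
  · exact ((contDiffOn_fieldDeriv hV (by norm_num) (hY j) hg).differentiableOn
      (by norm_num)).differentiableAt (hV.mem_nhds hy)

theorem TwiceDiffAt.fieldDeriv_add {Y : Fin m → M → M} {f g : M → ℝ} {y : M}
    (hf : TwiceDiffAt Y f y) (hg : TwiceDiffAt Y g y) (j : Fin m) :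
    fieldDeriv (Y j) (fun z => f z + g z) =ᶠ[𝓝 y]
      fun z => fieldDeriv (Y j) f z + fieldDeriv (Y j) g z := by
  filter_upwards [hf.1, hg.1] with z h1 h2
  simp [fieldDeriv, fderiv_fun_add h1 h2]

theorem TwiceDiffAt.add {Y : Fin m → M → M} {f g : M → ℝ} {y : M}
    (hf : TwiceDiffAt Y f y) (hg : TwiceDiffAt Y g y) :
    TwiceDiffAt Y (fun z => f z + g z) y := by
  refine ⟨?_, fun j => ?_⟩
  · filter_upwards [hf.1, hg.1] with z h1 h2 using h1.add h2
  · exact ((hf.2 j).add (hg.2 j)).congr_of_eventuallyEq (hf.fieldDeriv_add hg j)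

theorem TwiceDiffAt.secondOp_add {Y : Fin m → M → M} {f g : M → ℝ} {y : M}
    (hf : TwiceDiffAt Y f y) (hg : TwiceDiffAt Y g y) (a : Matrix (Fin m) (Fin m) ℝ) :
    secondOp Y a (fun z => f z + g z) y = secondOp Y a f y + secondOp Y a g y := by
  simp only [secondOp, ← Finset.sum_add_distrib, ← mul_add]
  refine Finset.sum_congr rfl fun i _ => Finset.sum_congr rfl fun j _ => ?_
  rw [fieldDeriv_congr (hf.fieldDeriv_add hg j)]
  rw [fieldDeriv, fderiv_fun_add (hf.2 j) (hg.2 j)]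
  rfl

theorem TwiceDiffAt.const_mul {Y : Fin m → M → M} {f : M → ℝ} {y : M}
    (hf : TwiceDiffAt Y f y) (ρ : ℝ) : TwiceDiffAt Y (fun z => ρ * f z) y := by
  refine ⟨?_, fun j => ?_⟩
  · filter_upwards [hf.1] with z h1 using h1.const_mul ρ
  · have : fieldDeriv (Y j) (fun z => ρ * f z) = fun z => ρ * fieldDeriv (Y j) f z :=
      funext fun z => fieldDeriv_const_mul _ _ _ _
    rw [this]
    exact (hf.2 j).const_mul ρ

theorem secondOp_const_mul (Y : Fin m → M → M) (a : Matrix (Fin m) (Fin m) ℝ) (ρ : ℝ) (f : M → ℝ)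
    (y : M) : secondOp Y a (fun z => ρ * f z) y = ρ * secondOp Y a f y := by
  have (j : Fin m) : fieldDeriv (Y j) (fun z => ρ * f z) = fun z => ρ * fieldDeriv (Y j) f z :=
    funext fun z => fieldDeriv_const_mul _ _ _ _
  simp only [secondOp, this, fieldDeriv_const_mul, Finset.mul_sum]
  refine Finset.sum_congr rfl fun i _ => Finset.sum_congr rfl fun j _ => by ring

theorem twiceDiffAt_const (Y : Fin m → M → M) (b : ℝ) (y : M) :
    TwiceDiffAt Y (fun _ => b) y := by
  refine ⟨by simp, fun j => ?_⟩
  have : fieldDeriv (Y j) (fun _ => b) = fun _ => 0 := by ext; simp [fieldDeriv]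
  rw [this]; simp

theorem secondOp_const (Y : Fin m → M → M) (a : Matrix (Fin m) (Fin m) ℝ) (b : ℝ) (y : M) :
    secondOp Y a (fun _ => b) y = 0 := by
  have (j : Fin m) : fieldDeriv (Y j) (fun _ => b) = fun _ => 0 := by ext; simp [fieldDeriv]
  simp only [secondOp, this]
  simp [fieldDeriv]

/-- The second derivative at a local maximum is not positive. -/
theorem deriv_deriv_nonpos_of_isLocalMax {φ ψ : ℝ → ℝ} {a : ℝ} (hmax : IsLocalMax φ 0)
    (hφ : ∀ᶠ t in 𝓝 0, HasDerivAt φ (ψ t) t) (hψ : HasDerivAt ψ a 0) : a ≤ 0 := by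
  by_contra! ha
  have hev : deriv φ =ᶠ[𝓝 0] ψ := hφ.mono fun t ht => ht.deriv
  have hd : deriv (deriv φ) 0 = a := by rw [hev.deriv_eq, hψ.deriv]
  -- A positive second derivative would make 0 a local minimum too, so φ would be locally constant
  -- and its second derivative zero.
  have hmin : IsLocalMin φ 0 := isLocalMin_of_deriv_deriv_pos (by rw [hd]; exact ha)
    hmax.deriv_eq_zero hφ.self_of_nhds.continuousAt
  have hconst : φ =ᶠ[𝓝 0] fun _ => φ 0 := by
    filter_upwards [hmax, hmin] with t h1 h2 using le_antisymm h1 h2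
  have h1 : deriv φ =ᶠ[𝓝 0] fun _ => 0 := by
    filter_upwards [hconst.eventuallyEq_nhds] with t ht
    rw [ht.deriv_eq]; simp
  rw [h1.deriv_eq] at hd
  simp at hd
  linarith

open scoped MatrixOrder in
/-- The operator is not positive at a local maximum, for fields each combination of which is
constant along its own lines. -/
theorem secondOp_nonpos_of_isLocalMax {Y : Fin m → M → M}
    (hline : ∀ (ξ : Fin m → ℝ) (y : M) (t : ℝ),
      ∑ i, ξ i • Y i (y + t • ∑ j, ξ j • Y j y) = ∑ i, ξ i • Y i y)
    {a : Matrix (Fin m) (Fin m) ℝ} (ha : a.PosSemidef) {g : M → ℝ} {y : M}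
    (hg : TwiceDiffAt Y g y) (hmax : IsLocalMax g y) : secondOp Y a g y ≤ 0 := by
  have key (ξ : Fin m → ℝ) :
      ∑ i, ∑ j, ξ i * ξ j * fieldDeriv (Y i) (fieldDeriv (Y j) g) y ≤ 0 := by
    set Z := ∑ j, ξ j • Y j y with hZ
    have hl (s : ℝ) : HasDerivAt (fun t : ℝ => y + t • Z) Z s := by
      simpa using ((hasDerivAt_id s).smul_const Z).const_add y
    have hcont : ContinuousAt (fun t : ℝ => y + t • Z) 0 := (hl 0).continuousAt
    have h0 : y + (0 : ℝ) • Z = y := by simp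
    refine deriv_deriv_nonpos_of_isLocalMax (φ := fun t : ℝ => g (y + t • Z))
      (ψ := fun t : ℝ => ∑ j, ξ j * fieldDeriv (Y j) g (y + t • Z)) ?_ ?_ ?_
    · have : Tendsto (fun t : ℝ => y + t • Z) (𝓝 0) (𝓝 y) := by
        simpa [ContinuousAt] using hcont
      have h2 := this.eventually hmax
      filter_upwards [h2] with t ht
      simpa using ht
    · have : Tendsto (fun t : ℝ => y + t • Z) (𝓝 0) (𝓝 y) := by
        simpa [ContinuousAt] using hcont
      filter_upwards [this.eventually hg.1] with t ht
      have h3 := ht.hasFDerivAt.comp_hasDerivAt t (hl t)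
      have h4 : fderiv ℝ g (y + t • Z) Z = ∑ j, ξ j * fieldDeriv (Y j) g (y + t • Z) := by
        -- By `hline`, Z is the value of the same combination of fields all along its line, so the
        -- iterated field derivative is an ordinary second derivative in t.
        have h5 : Z = ∑ j, ξ j • Y j (y + t • Z) := (hline ξ y t).symm
        calc fderiv ℝ g (y + t • Z) Z = fderiv ℝ g (y + t • Z) (∑ j, ξ j • Y j (y + t • Z)) :=
              congrArg _ h5
          _ = _ := by simp [fieldDeriv]
      exact h4 ▸ h3
    · have h3 (j : Fin m) : HasDerivAt (fun t : ℝ => fieldDeriv (Y j) g (y + t • Z))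
          (fderiv ℝ (fieldDeriv (Y j) g) y Z) 0 := by
        have h4 : HasFDerivAt (fieldDeriv (Y j) g) (fderiv ℝ (fieldDeriv (Y j) g) y)
          (y + (0 : ℝ) • Z) := by rw [h0]; exact (hg.2 j).hasFDerivAt
        exact h4.comp_hasDerivAt (0 : ℝ) (hl 0)
      have h5 := HasDerivAt.fun_sum (u := Finset.univ) fun j _ => (h3 j).const_mul (ξ j)
      refine h5.congr_deriv ?_
      rw [Finset.sum_comm]
      refine Finset.sum_congr rfl fun j _ => ?_
      rw [hZ, map_sum, Finset.mul_sum]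
      refine Finset.sum_congr rfl fun i _ => ?_
      rw [map_smul, smul_eq_mul, fieldDeriv]; ring
  -- A factorization a = bᵀb turns the operator into a sum of squares of the fields ∑ᵢ b_{li} Yᵢ,
  -- and `key` applies to each.
  obtain ⟨b, rfl⟩ : ∃ b : Matrix (Fin m) (Fin m) ℝ, a = b.conjTranspose * b := by
    obtain ⟨b, hb⟩ := CStarAlgebra.nonneg_iff_eq_star_mul_self.1 ha.nonneg
    exact ⟨b, hb⟩
  have : secondOp Y (b.conjTranspose * b) g y =
      ∑ l, ∑ i, ∑ j, b l i * b l j * fieldDeriv (Y i) (fieldDeriv (Y j) g) y := by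
    simp only [secondOp, Matrix.mul_apply, Matrix.conjTranspose_apply, star_trivial,
      Finset.sum_mul]
    symm
    rw [Finset.sum_comm]
    refine Finset.sum_congr rfl fun i _ => ?_
    rw [Finset.sum_comm]
  rw [this]
  exact Finset.sum_nonpos fun l _ => key (b l)

end SecondOrder

/-! ### Integrals depending on a parameter -/

section Parametric

variable {M N : Type*} [NormedAddCommGroup M] [NormedSpace ℝ M] 
  [NormedAddCommGroup N] [NormedSpace ℝ N]

theorem hasFDerivAt_of_contDiffOn_prod {F : M → N → ℝ} {O : Set (M × N)} (hO : IsOpen O)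
    (hF : ContDiffOn ℝ ∞ (fun t : M × N => F t.1 t.2) O) {x : M} {e : N} (h : (x, e) ∈ O) :
    HasFDerivAt (fun z => F z e)
      ((fderiv ℝ (fun t : M × N => F t.1 t.2) (x, e)).comp (ContinuousLinearMap.inl ℝ M N)) x := by
  have h1 := ((hF.differentiableOn (by simp)).differentiableAt (hO.mem_nhds h)).hasFDerivAt
  exact HasFDerivAt.comp (f := fun z : M => (z, e)) x h1 (hasFDerivAt_prodMk_left x e)

theorem contDiffOn_fieldDeriv_prod {F : M → N → ℝ} {O : Set (M × N)} (hO : IsOpen O)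
    (hF : ContDiffOn ℝ ∞ (fun t : M × N => F t.1 t.2) O) {X : M → M} (hX : ContDiff ℝ ∞ X) :
    ContDiffOn ℝ ∞ (fun t : M × N => fieldDeriv X (fun z => F z t.2) t.1) O := by
  have h1 : ContDiffOn ℝ ∞ (fun t : M × N => fderiv ℝ (fun t : M × N => F t.1 t.2) t
      (ContinuousLinearMap.inl ℝ M N (X t.1))) O :=
    (hF.fderiv_of_isOpen hO (by simp)).clm_apply (by fun_prop)
  refine h1.congr ?_
  rintro ⟨x, e⟩ h
  simp [fieldDeriv, (hasFDerivAt_of_contDiffOn_prod hO hF h).fderiv]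

variable [ProperSpace M] [MeasurableSpace N] [BorelSpace N]

theorem hasFDerivAt_setIntegral_of_contDiffOn {F : M → N → ℝ} {O : Set (M × N)} (hO : IsOpen O)
    (hF : ContDiffOn ℝ ∞ (fun t : M × N => F t.1 t.2) O) {μ : Measure N}
    [IsFiniteMeasureOnCompacts μ] {K : Set N} (hK : IsCompact K) {x : M}
    (hx : ∀ e ∈ K, (x, e) ∈ O) :
    HasFDerivAt (fun z => ∫ e in K, F z e ∂μ)
      (∫ e in K, (fderiv ℝ (fun t : M × N => F t.1 t.2) (x, e)).comp
        (ContinuousLinearMap.inl ℝ M N) ∂μ) x ∧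
    Integrable (fun e => (fderiv ℝ (fun t : M × N => F t.1 t.2) (x, e)).comp
        (ContinuousLinearMap.inl ℝ M N)) (μ.restrict K) := by
  set F' : M → N → M →L[ℝ] ℝ := fun z e => (fderiv ℝ (fun t : M × N => F t.1 t.2) (z, e)).comp
    (ContinuousLinearMap.inl ℝ M N) with hF'
  have hcont : ContinuousOn (fun t : M × N => F' t.1 t.2) O := by
    have : ContinuousOn (fderiv ℝ (fun t : M × N => F t.1 t.2)) O :=
      (hF.fderiv_of_isOpen (m := ∞) hO (by simp)).continuousOn
    exact this.clm_comp continuousOn_const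
  -- Tube lemma: a compact neighbourhood of {x} × K lies in O, and the derivative of the integrand
  -- is bounded there, which gives the constant dominating function.
  obtain ⟨r, hr, hrO⟩ : ∃ r > 0, Metric.closedBall x r ×ˢ K ⊆ O := by
    have hev : ∀ᶠ z in 𝓝 x, ∀ e ∈ K, (z, e) ∈ O :=
      hK.eventually_forall_of_forall_eventually fun e he => hO.mem_nhds (hx e he)
    obtain ⟨r, hr, h⟩ := Metric.nhds_basis_closedBall.eventually_iff.1 hev
    exact ⟨r, hr, fun t ht => h ht.1 t.2 ht.2⟩
  have hcomp : IsCompact (Metric.closedBall x r ×ˢ K) := (isCompact_closedBall x r).prod hK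
  obtain ⟨C, hC⟩ := hcomp.exists_bound_of_continuousOn (hcont.mono hrO)
  have hsl {z : M} (hz : z ∈ Metric.closedBall x r) : ContinuousOn (fun e => F z e) K :=
    hF.continuousOn.comp (f := fun e => (z, e)) (by fun_prop) fun e he => hrO ⟨hz, he⟩
  have hxr : x ∈ Metric.closedBall x r := Metric.mem_closedBall_self hr.le
  have hint : Integrable (F' x) (μ.restrict K) :=
    ContinuousOn.integrableOn_compact hK
      (hcont.comp (f := fun e => (x, e)) (by fun_prop) hx)
  refine ⟨?_, hint⟩
  refine hasFDerivAt_integral_of_dominated_of_fderiv_le (F' := F') (bound := fun _ => C)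
    (Metric.closedBall_mem_nhds x hr) ?_ ?_ hint.aestronglyMeasurable ?_ ?_ ?_
  · filter_upwards [Metric.closedBall_mem_nhds x hr] with z hz
    exact (hsl hz).aestronglyMeasurable hK.measurableSet
  · exact (hsl hxr).integrableOn_compact hK
  · filter_upwards [ae_restrict_mem hK.measurableSet] with e he z hz
    exact hC (z, e) ⟨hz, he⟩
  · exact integrableOn_const hK.measure_lt_top.ne
  · filter_upwards [ae_restrict_mem hK.measurableSet] with e he z hz
    exact hasFDerivAt_of_contDiffOn_prod hO hF (hrO ⟨hz, he⟩)

theorem fieldDeriv_setIntegral {F : M → N → ℝ} {O : Set (M × N)} (hO : IsOpen O)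
    (hF : ContDiffOn ℝ ∞ (fun t : M × N => F t.1 t.2) O) {μ : Measure N}
    [IsFiniteMeasureOnCompacts μ] {K : Set N} (hK : IsCompact K) (X : M → M) {x : M}
    (hx : ∀ e ∈ K, (x, e) ∈ O) :
    fieldDeriv X (fun z => ∫ e in K, F z e ∂μ) x =
      ∫ e in K, fieldDeriv X (fun z => F z e) x ∂μ := by
  obtain ⟨h1, h2⟩ := hasFDerivAt_setIntegral_of_contDiffOn hO hF (μ := μ) hK hx
  rw [fieldDeriv, h1.fderiv, ContinuousLinearMap.integral_apply h2]
  refine setIntegral_congr_fun hK.measurableSet fun e he => ?_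
  simp [fieldDeriv, (hasFDerivAt_of_contDiffOn_prod hO hF (hx e he)).fderiv]

/-- A superposition of smooth functions with nonnegative image under the operator. -/
theorem secondOp_setIntegral_nonneg {m : ℕ} {Y : Fin m → M → M} (hY : ∀ j, ContDiff ℝ ∞ (Y j))
    {F : M → N → ℝ} {O : Set (M × N)} (hO : IsOpen O)
    (hF : ContDiffOn ℝ ∞ (fun t : M × N => F t.1 t.2) O) {μ : Measure N}
    [IsFiniteMeasureOnCompacts μ] {K : Set N} (hK : IsCompact K) {x : M}
    (hx : ∀ e ∈ K, (x, e) ∈ O) (a : Matrix (Fin m) (Fin m) ℝ)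
    (h : ∀ e ∈ K, 0 ≤ secondOp Y a (fun z => F z e) x) :
    TwiceDiffAt Y (fun z => ∫ e in K, F z e ∂μ) x ∧
      0 ≤ secondOp Y a (fun z => ∫ e in K, F z e ∂μ) x := by
  have hev : ∀ᶠ z in 𝓝 x, ∀ e ∈ K, (z, e) ∈ O :=
    hK.eventually_forall_of_forall_eventually fun e he => hO.mem_nhds (hx e he)
  have hG (j : Fin m) := contDiffOn_fieldDeriv_prod hO hF (hY j)
  have hj (j : Fin m) : fieldDeriv (Y j) (fun z => ∫ e in K, F z e ∂μ) =ᶠ[𝓝 x]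
      fun z => ∫ e in K, fieldDeriv (Y j) (fun z => F z e) z ∂μ := by
    filter_upwards [hev] with z hz
    exact fieldDeriv_setIntegral hO hF hK (Y j) hz
  refine ⟨⟨?_, fun j => ?_⟩, ?_⟩
  · filter_upwards [hev] with z hz
    exact (hasFDerivAt_setIntegral_of_contDiffOn hO hF hK hz).1.differentiableAt
  · exact (hasFDerivAt_setIntegral_of_contDiffOn hO (hG j)
      hK hx).1.differentiableAt.congr_of_eventuallyEq (hj j)
  · have hint (i j : Fin m) : Integrable (fun e =>
        fieldDeriv (Y i) (fieldDeriv (Y j) fun z => F z e) x) (μ.restrict K) := by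
      have := (contDiffOn_fieldDeriv_prod hO
        (F := fun z e => fieldDeriv (Y j) (fun z => F z e) z) (hG j) (hY i)).continuousOn
      exact ContinuousOn.integrableOn_compact hK
        (this.comp (f := fun e => (x, e)) (by fun_prop) hx)
    have : secondOp Y a (fun z => ∫ e in K, F z e ∂μ) x =
        ∫ e in K, secondOp Y a (fun z => F z e) x ∂μ := by
      simp only [secondOp]
      rw [integral_finsetSum _ fun i _ => integrable_finsetSum _ fun j _ =>
        (hint i j).const_mul (a i j)]
      refine Finset.sum_congr rfl fun i _ => ?_
      rw [integral_finsetSum _ fun j _ => (hint i j).const_mul (a i j)]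
      refine Finset.sum_congr rfl fun j _ => ?_
      rw [integral_const_mul, fieldDeriv_congr (hj j),
        fieldDeriv_setIntegral hO (hG j) hK (Y i) hx]
    rw [this]
    exact setIntegral_nonneg hK.measurableSet h

end Parametric

end HType

end

noncomputable section

namespace HType

open Filter Topology

/-! ### The barrier -/

namespace Model

variable {m n : ℕ}

theorem contDiff_field (c : Fin n → Fin m → Fin m → ℝ) (j : Fin m) {k : WithTop ℕ∞} :
    ContDiff ℝ k (field c j : Model m n → Model m n) := by
  unfold field; fun_prop

theorem sum_smul_field (c : Fin n → Fin m → Fin m → ℝ) (ξ : Fin m → ℝ) (y : Model m n) :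
    ∑ j, ξ j • field c j y = (ξ, fun k => 1 / 2 * ∑ i, ∑ j, c k i j * y.1 i * ξ j) := by
  ext l
  · simp [field, Prod.fst_sum, Finset.sum_apply, Pi.single_apply]
  · simp only [field, Prod.snd_sum, Finset.sum_apply, Prod.smul_mk, Pi.smul_apply, smul_eq_mul,
      Finset.mul_sum]
    rw [Finset.sum_comm]
    refine Finset.sum_congr rfl fun i _ => Finset.sum_congr rfl fun j _ => by ring

/-- The vertical coefficients are linear in the position; moving along ξ changes them by a multiple
of c(ξ, ξ), which vanishes by antisymmetry. This is the hypothesis `hline` of the maximum principle.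
-/
theorem field_constant_on_lines {c : Fin n → Fin m → Fin m → ℝ} (hc : IsHType c) (ξ : Fin m → ℝ)
    (y : Model m n) (t : ℝ) :
    ∑ i, ξ i • field c i (y + t • ∑ j, ξ j • field c j y) = ∑ i, ξ i • field c i y := by
  simp only [sum_smul_field]
  ext k
  · rfl
  · have := sum_antisymm (hc.antisymm k) ξ ξ
    have h2 : ∑ i, ∑ j, c k i j * (y.1 i + t * ξ i) * ξ j =
        ∑ i, ∑ j, c k i j * y.1 i * ξ j + t * ∑ i, ∑ j, c k i j * ξ i * ξ j := by
      simp only [Finset.mul_sum, ← Finset.sum_add_distrib]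
      refine Finset.sum_congr rfl fun i _ => Finset.sum_congr rfl fun j _ => by ring
    simp only [Prod.fst_add, Prod.smul_fst, Pi.add_apply, Pi.smul_apply, smul_eq_mul, h2]
    have h3 : ∑ i, ∑ j, c k i j * ξ i * ξ j = 0 := by linarith
    rw [h3]; ring

/-! ### Horizontal derivatives of the gauge and of its powers. -/

/-- The component of index `j` of the horizontal gradient of the gauge. -/
def gaugeGrad (c : Fin n → Fin m → Fin m → ℝ) (j : Fin m) (y : Model m n) : ℝ :=
  4 * (∑ i, y.1 i ^ 2) * y.1 j + 16 * ∑ k, y.2 k * ∑ i, y.1 i * c k i j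

theorem contDiff_gaugeGrad (c : Fin n → Fin m → Fin m → ℝ) (j : Fin m) {k : WithTop ℕ∞} :
    ContDiff ℝ k (gaugeGrad c j : Model m n → ℝ) := by
  unfold gaugeGrad; fun_prop

theorem hasDerivAt_affine (a b : ℝ) : HasDerivAt (fun t : ℝ => a + t * b) b 0 := by
  simpa using ((hasDerivAt_id (0 : ℝ)).mul_const b).const_add a

theorem hasDerivAt_sum_sq (p s : Fin m → ℝ) :
    HasDerivAt (fun t : ℝ => ∑ i, (p i + t * s i) ^ 2) (2 * ∑ i, p i * s i) 0 := by
  have h := HasDerivAt.fun_sum (u := Finset.univ)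
    fun i _ => (hasDerivAt_affine (p i) (s i)).fun_pow 2
  refine h.congr_deriv ?_
  rw [Finset.mul_sum]
  refine Finset.sum_congr rfl fun i _ => ?_
  simp; ring

theorem hasDerivAt_sum_mul (p s d : Fin m → ℝ) :
    HasDerivAt (fun t : ℝ => ∑ i, (p i + t * s i) * d i) (∑ i, s i * d i) 0 :=
  HasDerivAt.fun_sum (u := Finset.univ)
    fun i _ => (hasDerivAt_affine (p i) (s i)).mul_const (d i)

theorem fieldDeriv_gauge {c : Fin n → Fin m → Fin m → ℝ} (j : Fin m) (y : Model m n) :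
    fieldDeriv (field c j) gauge y = gaugeGrad c j y := by
  refine fieldDeriv_eq_of_hasDerivAt (contDiff_gauge.differentiable one_ne_zero y) ?_
  have h := ((hasDerivAt_sum_sq y.1 (Pi.single j 1)).fun_pow 2).add
    ((hasDerivAt_sum_sq y.2 (fun k => 1 / 2 * ∑ i, y.1 i * c k i j)).const_mul 16)
  refine h.congr_deriv ?_
  have e1 : ∑ i, y.1 i * (Pi.single j (1 : ℝ) : Fin m → ℝ) i = y.1 j := by simp [Pi.single_apply]
  have e2 : ∑ k, y.2 k * (1 / 2 * ∑ i, y.1 i * c k i j) =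
      1 / 2 * ∑ k, y.2 k * ∑ i, y.1 i * c k i j := by
    rw [Finset.mul_sum]; exact Finset.sum_congr rfl fun k _ => by ring
  rw [e1, e2]
  simp [gaugeGrad]; ring

theorem fieldDeriv_gaugeGrad {c : Fin n → Fin m → Fin m → ℝ} (i j : Fin m) (y : Model m n) :
    fieldDeriv (field c i) (gaugeGrad c j) y =
      8 * (y.1 i * y.1 j) + 4 * (∑ l, y.1 l ^ 2) * (if i = j then 1 else 0) +
        8 * ∑ k, (∑ l, y.1 l * c k l i) * (∑ l, y.1 l * c k l j) +
        16 * ∑ k, y.2 k * c k i j := by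
  refine fieldDeriv_eq_of_hasDerivAt ((contDiff_gaugeGrad c j).differentiable one_ne_zero y) ?_
  have h := (((hasDerivAt_sum_sq y.1 (Pi.single i 1)).const_mul 4).mul
    (hasDerivAt_affine (y.1 j) ((Pi.single i 1 : Fin m → ℝ) j))).add
    ((HasDerivAt.fun_sum (u := Finset.univ) fun k _ =>
      (hasDerivAt_affine (y.2 k) (1 / 2 * ∑ l, y.1 l * c k l i)).mul
      (hasDerivAt_sum_mul y.1 (Pi.single i 1) fun l => c k l j)).const_mul 16)
  refine h.congr_deriv ?_
  have e1 : ∑ l, y.1 l * (Pi.single i (1 : ℝ) : Fin m → ℝ) l = y.1 i := by simp [Pi.single_apply]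
  have e2 (k : Fin n) : ∑ l, (Pi.single i (1 : ℝ) : Fin m → ℝ) l * c k l j = c k i j := by
    simp [Pi.single_apply]
  have e3 : (Pi.single i (1 : ℝ) : Fin m → ℝ) j = if i = j then 1 else 0 := by
    simp [Pi.single_apply, eq_comm]
  simp only [e1, e2, e3, zero_mul, add_zero, Finset.sum_add_distrib]
  have e4 : ∑ k, 1 / 2 * (∑ l, y.1 l * c k l i) * (∑ l, y.1 l * c k l j) =
      1 / 2 * ∑ k, (∑ l, y.1 l * c k l i) * (∑ l, y.1 l * c k l j) := by
    rw [Finset.mul_sum]; exact Finset.sum_congr rfl fun k _ => by ring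
  rw [e4]; ring

theorem sum_sq_row {c : Fin n → Fin m → Fin m → ℝ} (hc : IsHType c) (k : Fin n) (p : Fin m → ℝ) :
    ∑ j, (∑ i, p i * c k i j) ^ 2 = ∑ i, p i ^ 2 := by
  have h := hc.norm_J (Pi.single k 1) p
  simpa [Pi.single_apply, ite_pow] using h

/-- The gradient is 4|p|²p + 16 J_q p. The two summands are orthogonal because J_q is antisymmetric,
and |J_q p|² = |q|²|p|², so the sum of squares is 16|p|²(|p|⁴ + 16|q|²). -/
theorem sum_sq_gaugeGrad {c : Fin n → Fin m → Fin m → ℝ} (hc : IsHType c) (y : Model m n) :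
    ∑ j, gaugeGrad c j y ^ 2 = 16 * (∑ i, y.1 i ^ 2) * gauge y := by
  set g : Fin m → ℝ := fun j => ∑ k, y.2 k * ∑ i, y.1 i * c k i j with hg
  have h1 : ∑ j, g j ^ 2 = (∑ k, y.2 k ^ 2) * ∑ i, y.1 i ^ 2 := hc.norm_J y.2 y.1
  have h2 : ∑ j, y.1 j * g j = 0 := by
    have (k : Fin n) : ∑ j, ∑ i, c k i j * y.1 i * y.1 j = 0 := by
      rw [Finset.sum_comm]
      have := sum_antisymm (hc.antisymm k) y.1 y.1
      linarith
    calc ∑ j, y.1 j * g j = ∑ k, y.2 k * ∑ j, ∑ i, c k i j * y.1 i * y.1 j := by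
          simp only [hg, Finset.mul_sum]
          rw [Finset.sum_comm]
          refine Finset.sum_congr rfl fun k _ => Finset.sum_congr rfl fun j _ =>
            Finset.sum_congr rfl fun i _ => by ring
      _ = 0 := by simp [this]
  have h3 : ∑ j, gaugeGrad c j y ^ 2 = 16 * (∑ i, y.1 i ^ 2) ^ 2 * ∑ j, y.1 j ^ 2 +
      128 * (∑ i, y.1 i ^ 2) * ∑ j, y.1 j * g j + 256 * ∑ j, g j ^ 2 := by
    have e (j : Fin m) : gaugeGrad c j y = 4 * (∑ i, y.1 i ^ 2) * y.1 j + 16 * g j := rfl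
    have e' (S : ℝ) : ∑ j, (4 * S * y.1 j + 16 * g j) ^ 2 =
        16 * S ^ 2 * ∑ j, y.1 j ^ 2 + 128 * S * ∑ j, y.1 j * g j + 256 * ∑ j, g j ^ 2 := by
      rw [Finset.mul_sum, Finset.mul_sum, ← Finset.sum_add_distrib, Finset.mul_sum,
        ← Finset.sum_add_distrib]
      exact Finset.sum_congr rfl fun j _ => by ring
    simp only [e]
    exact e' _
  rw [h3, h2, h1, gauge]
  ring

/-- The second derivatives form 4|p|² Id + 8 p pᵀ + 8 ∑ₖ (Jₖp)(Jₖp)ᵀ plus an antisymmetric matrix,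
which the symmetric `a` annihilates. The n + 1 rank-one terms each contribute at most 8 `hi` |p|²,
since |Jₖp| = |p|. -/
theorem sum_sum_gaugeHess_le {c : Fin n → Fin m → Fin m → ℝ} (hc : IsHType c)
    {a : Matrix (Fin m) (Fin m) ℝ} (hsymm : a.IsSymm) {hi : ℝ}
    (hhi : ∀ ξ : Fin m → ℝ, ∑ i, ∑ j, a i j * (ξ i * ξ j) ≤ hi * ∑ i, ξ i ^ 2) (y : Model m n) :
    ∑ i, ∑ j, a i j * fieldDeriv (field c i) (gaugeGrad c j) y ≤
      4 * (∑ i, y.1 i ^ 2) * (a.trace + (2 * n + 2) * hi) := by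
  have h0 (k : Fin n) : ∑ i, ∑ j, a i j * c k i j = 0 := by
    have : ∑ i, ∑ j, a i j * c k i j = -∑ i, ∑ j, a i j * c k i j := by
      conv_lhs => rw [Finset.sum_comm]
      rw [← Finset.sum_neg_distrib]
      refine Finset.sum_congr rfl fun i _ => ?_
      rw [← Finset.sum_neg_distrib]
      refine Finset.sum_congr rfl fun j _ => ?_
      rw [hc.antisymm k j i, hsymm.apply]; ring
    linarith
  have h1 : ∑ i, ∑ j, a i j * fieldDeriv (field c i) (gaugeGrad c j) y =
      8 * (∑ i, ∑ j, a i j * (y.1 i * y.1 j)) + 4 * (∑ l, y.1 l ^ 2) * a.trace +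
        8 * ∑ k, ∑ i, ∑ j, a i j * ((∑ l, y.1 l * c k l i) * ∑ l, y.1 l * c k l j) +
        16 * ∑ k, y.2 k * ∑ i, ∑ j, a i j * c k i j := by
    have e1 : a.trace = ∑ i, ∑ j, a i j * (if i = j then 1 else 0) := by simp [Matrix.trace]
    have e2 : ∑ k, ∑ i, ∑ j, a i j * ((∑ l, y.1 l * c k l i) * ∑ l, y.1 l * c k l j) =
        ∑ i, ∑ j, a i j * ∑ k, (∑ l, y.1 l * c k l i) * ∑ l, y.1 l * c k l j := by
      rw [Finset.sum_comm]
      refine Finset.sum_congr rfl fun i _ => ?_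
      rw [Finset.sum_comm]
      refine Finset.sum_congr rfl fun j _ => ?_
      rw [Finset.mul_sum]
    have e3 : ∑ k, y.2 k * ∑ i, ∑ j, a i j * c k i j =
        ∑ i, ∑ j, a i j * ∑ k, y.2 k * c k i j := by
      simp only [Finset.mul_sum]
      rw [Finset.sum_comm]
      refine Finset.sum_congr rfl fun i _ => ?_
      rw [Finset.sum_comm]
      refine Finset.sum_congr rfl fun j _ => Finset.sum_congr rfl fun k _ => by ring
    rw [e1, e2, e3]
    simp only [fieldDeriv_gaugeGrad, Finset.mul_sum (s := Finset.univ) (a := (8 : ℝ)),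
      Finset.mul_sum (s := Finset.univ) (a := (16 : ℝ)),
      Finset.mul_sum (s := Finset.univ) (a := 4 * ∑ l, y.1 l ^ 2), ← Finset.sum_add_distrib]
    refine Finset.sum_congr rfl fun i _ => Finset.sum_congr rfl fun j _ => ?_
    simp only [← Finset.mul_sum]
    ring
  have h2 : ∑ k, ∑ i, ∑ j, a i j * ((∑ l, y.1 l * c k l i) * ∑ l, y.1 l * c k l j) ≤
      n * (hi * ∑ i, y.1 i ^ 2) := by
    calc _ ≤ ∑ _k : Fin n, hi * ∑ i, y.1 i ^ 2 :=
          Finset.sum_le_sum fun k _ => (hhi _).trans_eq (by rw [sum_sq_row hc])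
      _ = _ := by simp
  have h3 := hhi y.1
  rw [h1]
  simp only [h0, mul_zero, Finset.sum_const_zero]
  linarith

theorem contDiffAt_gauge_rpow (s : ℝ) {y : Model m n} (hy : y ≠ 0) {k : WithTop ℕ∞} :
    ContDiffAt ℝ k (fun z : Model m n => gauge z ^ s) y :=
  contDiff_gauge.contDiffAt.rpow_const_of_ne (gauge_pos hy).ne'

theorem fieldDeriv_gauge_rpow {c : Fin n → Fin m → Fin m → ℝ} (s : ℝ) (j : Fin m) {y : Model m n}
    (hy : y ≠ 0) :
    fieldDeriv (field c j) (fun z => gauge z ^ s) y = s * gauge y ^ (s - 1) * gaugeGrad c j y := by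
  have h := (contDiff_gauge.differentiable one_ne_zero y).hasFDerivAt.rpow_const (p := s)
    (Or.inl (gauge_pos hy).ne')
  rw [fieldDeriv, h.fderiv, ← fieldDeriv_gauge, fieldDeriv]
  rfl

/-- Negative powers of the gauge are subsolutions away from the origin. -/
theorem secondOp_gauge_rpow_nonneg {c : Fin n → Fin m → Fin m → ℝ} (hc : IsHType c)
    {a : Matrix (Fin m) (Fin m) ℝ} (hsymm : a.IsSymm) {lo hi α : ℝ} (hα : 0 < α)
    (hlo : ∀ ξ : Fin m → ℝ, lo * ∑ i, ξ i ^ 2 ≤ ∑ i, ∑ j, a i j * (ξ i * ξ j))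
    (hhi : ∀ ξ : Fin m → ℝ, ∑ i, ∑ j, a i j * (ξ i * ξ j) ≤ hi * ∑ i, ξ i ^ 2)
    (hL : a.trace + (2 * n + 2) * hi ≤ (4 * α + 4) * lo) {y : Model m n} (hy : y ≠ 0) :
    0 ≤ secondOp (field c) a (fun z => gauge z ^ (-α)) y := by
  have hpos := gauge_pos hy
  have hfirst (j : Fin m) : fieldDeriv (field c j) (fun z => gauge z ^ (-α)) =ᶠ[𝓝 y]
      fun z => (-α) * (gauge z ^ (-α - 1) * gaugeGrad c j z) := by
    filter_upwards [isOpen_ne.mem_nhds hy] with z hz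
    rw [fieldDeriv_gauge_rpow _ _ hz]; ring
  have hsecond (i j : Fin m) :
      fieldDeriv (field c i) (fieldDeriv (field c j) (fun z => gauge z ^ (-α))) y =
        α * gauge y ^ (-α - 2) * ((α + 1) * (gaugeGrad c i y * gaugeGrad c j y) -
          gauge y * fieldDeriv (field c i) (gaugeGrad c j) y) := by
    rw [fieldDeriv_congr (hfirst j), fieldDeriv_const_mul]
    have hd1 : DifferentiableAt ℝ (fun z : Model m n => gauge z ^ (-α - 1)) y :=
      (contDiffAt_gauge_rpow _ hy).differentiableAt one_ne_zero
    have hd2 : DifferentiableAt ℝ (gaugeGrad c j) y :=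
      (contDiff_gaugeGrad c j).differentiable one_ne_zero y
    have hmul : fieldDeriv (field c i) (fun z => gauge z ^ (-α - 1) * gaugeGrad c j z) y =
        gauge y ^ (-α - 1) * fieldDeriv (field c i) (gaugeGrad c j) y +
          gaugeGrad c j y * fieldDeriv (field c i) (fun z => gauge z ^ (-α - 1)) y := by
      rw [fieldDeriv, fderiv_fun_mul hd1 hd2]; rfl
    rw [hmul, fieldDeriv_gauge_rpow _ _ hy]
    have e : gauge y ^ (-α - 1) = gauge y ^ (-α - 2) * gauge y := by
      rw [← Real.rpow_add_one hpos.ne']; ring_nf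
    have e' : gauge y ^ (-α - 1 - 1) = gauge y ^ (-α - 2) := by ring_nf
    rw [e, e']; ring
  have hsum : secondOp (field c) a (fun z => gauge z ^ (-α)) y =
      α * gauge y ^ (-α - 2) *
        ((α + 1) * ∑ i, ∑ j, a i j * (gaugeGrad c i y * gaugeGrad c j y) -
          gauge y * ∑ i, ∑ j, a i j * fieldDeriv (field c i) (gaugeGrad c j) y) := by
    simp only [secondOp, hsecond]
    rw [Finset.mul_sum, Finset.mul_sum, ← Finset.sum_sub_distrib, Finset.mul_sum]
    refine Finset.sum_congr rfl fun i _ => ?_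
    rw [Finset.mul_sum, Finset.mul_sum, ← Finset.sum_sub_distrib, Finset.mul_sum]
    refine Finset.sum_congr rfl fun j _ => by ring
  rw [hsum]
  refine mul_nonneg (by positivity) ?_
  -- Lower bound for the gradient term, upper bound for the second-order term: the bracket is at
  -- least 4|p|²N((4α+4)`lo` - Tr a - (2n+2)`hi`).
  have h1 := hlo fun j => gaugeGrad c j y
  rw [sum_sq_gaugeGrad hc] at h1
  have h2 := mul_le_mul_of_nonneg_left (sum_sum_gaugeHess_le hc hsymm hhi y) hpos.le
  have h3 := mul_le_mul_of_nonneg_left h1 (by linarith : 0 ≤ α + 1)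
  have h4 : 0 ≤ 4 * (∑ i, y.1 i ^ 2) * gauge y := by positivity
  have h5 := mul_le_mul_of_nonneg_left hL h4
  linarith

/-- The squared horizontal norm. -/
theorem secondOp_sum_sq (c : Fin n → Fin m → Fin m → ℝ) (a : Matrix (Fin m) (Fin m) ℝ)
    (y : Model m n) : secondOp (field c) a (fun z => ∑ i, z.1 i ^ 2) y = 2 * a.trace := by
  have h1 (j : Fin m) : fieldDeriv (field c j) (fun z : Model m n => ∑ i, z.1 i ^ 2) =
      fun z => 2 * z.1 j := by
    ext z
    refine fieldDeriv_eq_of_hasDerivAt (by fun_prop) ?_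
    refine (hasDerivAt_sum_sq z.1 (Pi.single j 1)).congr_deriv ?_
    simp [Pi.single_apply]
  have h2 (i j : Fin m) : fieldDeriv (field c i) (fun z : Model m n => 2 * z.1 j) y =
      2 * if i = j then 1 else 0 := by
    refine fieldDeriv_eq_of_hasDerivAt (by fun_prop) ?_
    refine ((hasDerivAt_affine (y.1 j) ((Pi.single i 1 : Fin m → ℝ) j)).const_mul 2).congr_deriv ?_
    simp [Pi.single_apply, eq_comm]
  simp only [secondOp, h1, h2]
  simp [Matrix.trace, Finset.mul_sum]
  exact Finset.sum_congr rfl fun i _ => by ring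

/-! ### Left invariance and homogeneity of the model fields. -/

theorem fderiv_op_left_field (c : Fin n → Fin m → Fin m → ℝ) (x : Model m n) (j : Fin m)
    (y : Model m n) : fderiv ℝ (op c x) y (field c j y) = (1 : ℝ) • field c j (op c x y) := by
  have hd : DifferentiableAt ℝ (op c x) y := by
    have : ContDiff ℝ 1 (op c x) := (contDiff_op c).comp (by fun_prop : ContDiff ℝ 1 fun z => (x, z))
    exact this.differentiable one_ne_zero y
  have h1 := hd.hasFDerivAt.hasLineDerivAt (field c j y)
  have h2 : HasLineDerivAt ℝ (op c x) (field c j (op c x y)) y (field c j y) := by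
    have hl : (fun t : ℝ => op c x (y + t • field c j y)) =
        fun t : ℝ => op c x y + t • field c j (op c x y) := by
      ext t k
      · simp [op, field]; ring
      · simp only [op, field, Prod.fst_add, Prod.smul_fst, Pi.add_apply, Prod.snd_add, Prod.smul_snd,
          Pi.smul_apply, smul_eq_mul, mul_add, add_mul, Finset.sum_add_distrib]
        have : ∑ i, ∑ l, c k i l * x.1 i * (t * (Pi.single j (1 : ℝ) : Fin m → ℝ) l) =
            t * ∑ i, x.1 i * c k i j := by
          rw [Finset.mul_sum]
          exact Finset.sum_congr rfl fun i _ => by simp [Pi.single_apply]; ring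
        rw [this]; ring
    unfold HasLineDerivAt
    rw [hl]
    simpa using ((hasDerivAt_id (0 : ℝ)).smul_const (field c j (op c x y))).const_add (op c x y)
  rw [one_smul]
  exact HasDerivAt.unique h1 h2

theorem fderiv_dil_field (c : Fin n → Fin m → Fin m → ℝ) (r : ℝ) (j : Fin m)
    (y : Model m n) : fderiv ℝ (dil r) y (field c j y) = r • field c j (dil r y) := by
  have hl : (dil r : Model m n → Model m n) =
      ((r • ContinuousLinearMap.id ℝ (Fin m → ℝ)).prodMap
        (r ^ 2 • ContinuousLinearMap.id ℝ (Fin n → ℝ)) : Model m n →L[ℝ] Model m n) := rfl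
  rw [hl, ContinuousLinearMap.fderiv]
  ext k
  · simp [field]
  · simp [field, Finset.mul_sum]
    exact Finset.sum_congr rfl fun i _ => by ring

end Model

end HType

end

noncomputable section

namespace HType

open Filter Topology

namespace Model

variable {m n : ℕ}

/-! ### Potentials of negative powers of the gauge -/

/-! ### Volumes of gauge balls and integrability of the kernel. -/

theorem measure_dil_preimage {r : ℝ} (hr : 0 < r) {S : Set (Model m n)} (hS : MeasurableSet S) :
    volume (dil r ⁻¹' S) = ENNReal.ofReal ((r ^ (m + 2 * n))⁻¹) * volume S := by
  rw [← Measure.map_apply (continuous_dil r).measurable hS, map_dil hr]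
  rfl

theorem measurableSet_gauge_le (a : ℝ) : MeasurableSet {y : Model m n | gauge y ≤ a} :=
  (isClosed_le continuous_gauge continuous_const).measurableSet

theorem measure_gauge_le {r : ℝ} (hr : 0 < r) :
    volume {y : Model m n | gauge y ≤ r ^ 4} =
      ENNReal.ofReal (r ^ (m + 2 * n)) * volume {y : Model m n | gauge y ≤ 1} := by
  have h : {y : Model m n | gauge y ≤ r ^ 4} = dil r⁻¹ ⁻¹' {y : Model m n | gauge y ≤ 1} := by
    ext y
    simp only [Set.mem_preimage, Set.mem_ofPred_eq, gauge_dil, inv_pow]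
    rw [inv_mul_le_iff₀ (by positivity), mul_one]
  rw [h, measure_dil_preimage (inv_pos.2 hr) (measurableSet_gauge_le 1)]
  simp

theorem measure_gauge_le_one_lt_top : volume {y : Model m n | gauge y ≤ 1} < ⊤ := by
  have := isCompact_gauge_le (m := m) (n := n) zero_le_one le_rfl
  rw [one_pow] at this
  exact this.measure_lt_top

theorem gauge_lt_subset_gauge_le (a : ℝ) :
    {y : Model m n | gauge y < a} ⊆ {y : Model m n | gauge y ≤ a} :=
  fun _ hy => le_of_lt (Set.mem_ofPred_eq.mp hy)

theorem measure_gauge_le_one_pos : 0 < volume {y : Model m n | gauge y ≤ 1} := by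
  refine lt_of_lt_of_le ?_ (measure_mono (gauge_lt_subset_gauge_le 1))
  exact (isOpen_lt continuous_gauge continuous_const).measure_pos _ ⟨0, by simp [gauge_zero]⟩

/-- The power `-α` of the gauge is integrable near the origin if `4 α` is less than the
homogeneous dimension. -/
theorem lintegral_gauge_rpow_lt_top {α : ℝ} (hα : 0 < α) (hαQ : 4 * α < m + 2 * n) :
    ∫⁻ y in {y : Model m n | gauge y ≤ 1}, ENNReal.ofReal (gauge y ^ (-α)) < ⊤ := by
  -- Dyadic shells: radius 2^{-k} means gauge 16^{-k}. On the k-th shell the kernel is at most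
  -- 16^{α(k+1)} and the volume at most 2^{-kQ}β, so the integrals are dominated by a geometric
  -- series of ratio 2^{4α-Q} < 1.
  set S : ℕ → Set (Model m n) := fun k => {y | (1 / 16 : ℝ) ^ (k + 1) < gauge y ∧
    gauge y ≤ (1 / 16) ^ k} with hS
  set β := volume {y : Model m n | gauge y ≤ 1} with hβ
  have hcover : {y : Model m n | gauge y ≤ 1} ⊆ {0} ∪ ⋃ k, S k := by
    intro y hy
    by_cases h0 : y = 0
    · exact Or.inl h0
    · obtain ⟨k, hk1, hk2⟩ := exists_nat_pow_near_of_lt_one (gauge_pos h0) hy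
        (by norm_num : (0 : ℝ) < 1 / 16) (by norm_num)
      exact Or.inr (Set.mem_iUnion.2 ⟨k, hk1, hk2⟩)
  have h16 : (0 : ℝ) < 16 ^ α := by positivity
  set q : ℝ := 16 ^ α * (1 / 2) ^ (m + 2 * n) with hq
  have hq1 : q < 1 := by
    have e1 : (16 : ℝ) ^ α = 2 ^ (4 * α) := by
      rw [Real.rpow_mul (by norm_num)]; norm_num
    have e2 : (1 / 2 : ℝ) ^ (m + 2 * n) = 2 ^ (-((m : ℝ) + 2 * n)) := by
      rw [Real.rpow_neg (by norm_num), one_div, inv_pow]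
      congr 1
      rw [← Real.rpow_natCast]; push_cast; rfl
    rw [hq, e1, e2, ← Real.rpow_add (by norm_num)]
    exact Real.rpow_lt_one_of_one_lt_of_neg (by norm_num) (by linarith)
  have hterm (k : ℕ) : ∫⁻ y in S k, ENNReal.ofReal (gauge y ^ (-α)) ≤
      ENNReal.ofReal (16 ^ α) * β * ENNReal.ofReal q ^ k := by
    have hmeas : MeasurableSet (S k) := by
      refine MeasurableSet.inter ?_ (measurableSet_gauge_le _)
      exact (isOpen_lt continuous_const continuous_gauge).measurableSet
    have hvol : volume (S k) ≤ ENNReal.ofReal (((1 / 2) ^ k) ^ (m + 2 * n)) * β := by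
      rw [hβ, ← measure_gauge_le (by positivity)]
      refine measure_mono fun y hy => ?_
      have e : ((1 / 2 : ℝ) ^ k) ^ 4 = (1 / 16) ^ k := by
        rw [← pow_mul, mul_comm, pow_mul]; norm_num
      exact hy.2.trans_eq e.symm
    calc ∫⁻ y in S k, ENNReal.ofReal (gauge y ^ (-α))
        ≤ ∫⁻ _ in S k, ENNReal.ofReal ((16 ^ α) ^ (k + 1)) := by
          refine setLIntegral_mono' hmeas fun y hy => ENNReal.ofReal_le_ofReal ?_
          have h1 := Real.rpow_le_rpow_of_nonpos (by positivity) hy.1.le (by linarith : -α ≤ 0)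
          refine h1.trans_eq ?_
          rw [Real.rpow_neg (by positivity), ← Real.rpow_natCast, ← Real.rpow_natCast,
            ← Real.rpow_mul (by norm_num), ← Real.rpow_mul (by norm_num), mul_comm α,
            one_div, Real.inv_rpow (by norm_num), inv_inv]
      _ = ENNReal.ofReal ((16 ^ α) ^ (k + 1)) * volume (S k) := by simp
      _ ≤ ENNReal.ofReal ((16 ^ α) ^ (k + 1)) *
          (ENNReal.ofReal (((1 / 2) ^ k) ^ (m + 2 * n)) * β) := by gcongr
      _ = ENNReal.ofReal (16 ^ α) * β * ENNReal.ofReal q ^ k := by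
          rw [← ENNReal.ofReal_pow (by positivity), ← mul_assoc,
            ← ENNReal.ofReal_mul (by positivity), mul_right_comm,
            ← ENNReal.ofReal_mul (by positivity)]
          congr 2
          rw [hq, mul_pow, pow_succ, ← pow_mul, ← pow_mul, mul_comm k]
          ring
  -- At the pole the real power takes its default value 0, because -α ≠ 0.
  have hzero : ∫⁻ y in {(0 : Model m n)}, ENNReal.ofReal (gauge y ^ (-α)) = 0 := by
    rw [setLIntegral_congr_fun (g := fun _ => 0) (measurableSet_singleton _)]
    · simp
    · intro y hy
      rw [Set.mem_singleton_iff.1 hy]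
      simp [gauge_zero, Real.zero_rpow (by linarith : -α ≠ 0)]
  calc ∫⁻ y in {y : Model m n | gauge y ≤ 1}, ENNReal.ofReal (gauge y ^ (-α))
      ≤ ∫⁻ y in {0} ∪ ⋃ k, S k, ENNReal.ofReal (gauge y ^ (-α)) := lintegral_mono_set hcover
    _ ≤ 0 + ∑' k, ENNReal.ofReal (16 ^ α) * β * ENNReal.ofReal q ^ k := by
        refine (lintegral_union_le _ _ _).trans (add_le_add hzero.le ?_)
        exact (lintegral_iUnion_le _ _).trans (ENNReal.tsum_le_tsum hterm)
    _ < ⊤ := by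
        rw [zero_add, ENNReal.tsum_mul_left]
        refine ENNReal.mul_lt_top (ENNReal.mul_lt_top ENNReal.ofReal_lt_top
          measure_gauge_le_one_lt_top) ?_
        rw [tsum_geometric_lt_top]
        exact ENNReal.ofReal_lt_one.2 hq1

/-- A bound for the potentials of subsets of the unit ball. -/
def potentialBound (m n : ℕ) (α : ℝ) : ℝ :=
  ((∫⁻ y in {y : Model m n | gauge y ≤ 1}, ENNReal.ofReal (gauge y ^ (-α))) +
    volume {y : Model m n | gauge y ≤ 1}).toReal

theorem measureReal_le_potentialBound {α : ℝ} (hα : 0 < α) (hαQ : 4 * α < m + 2 * n) :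
    volume.real {y : Model m n | gauge y ≤ 1} ≤ potentialBound m n α :=
  ENNReal.toReal_mono (ENNReal.add_lt_top.2
    ⟨lintegral_gauge_rpow_lt_top hα hαQ, measure_gauge_le_one_lt_top⟩).ne le_add_self

theorem potentialBound_pos {α : ℝ} (hα : 0 < α) (hαQ : 4 * α < m + 2 * n) :
    0 < potentialBound m n α :=
  (ENNReal.toReal_pos measure_gauge_le_one_pos.ne' measure_gauge_le_one_lt_top.ne).trans_le
    (measureReal_le_potentialBound hα hαQ)

/-- After exchanging pole and variable, the kernel is at most 1 outside the unit ball around `y`;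
inside it, left invariance of the measure reduces to the integral around the origin. The two pieces
are the two terms of `potentialBound`. -/
theorem potential_le {c : Fin n → Fin m → Fin m → ℝ} (hc : IsHType c) {α : ℝ} (hα : 0 < α)
    (hαQ : 4 * α < m + 2 * n) {E : Set (Model m n)} (hE : E ⊆ {y | gauge y ≤ 1})
    (y : Model m n) : ∫ e in E, gauge (op c (-e) y) ^ (-α) ≤ potentialBound m n α := by
  have hmeas : Measurable fun y : Model m n => gauge y ^ (-α) :=
    continuous_gauge.measurable.pow_const _
  have hcont : Continuous fun e : Model m n => op c (-e) y :=
    (contDiff_op c (k := 0)).continuous.comp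
      (by fun_prop : Continuous fun e : Model m n => (-e, y))
  rw [integral_eq_lintegral_of_nonneg_ae
    (Eventually.of_forall fun e => Real.rpow_nonneg (gauge_nonneg _) _)
    (hmeas.comp hcont.measurable).aestronglyMeasurable]
  refine ENNReal.toReal_mono (ENNReal.add_lt_top.2
    ⟨lintegral_gauge_rpow_lt_top hα hαQ, measure_gauge_le_one_lt_top⟩).ne ?_
  set φ : Model m n → ENNReal := {y : Model m n | gauge y ≤ 1}.indicator
    fun y => ENNReal.ofReal (gauge y ^ (-α)) with hφ
  have hφm : Measurable φ := hmeas.ennreal_ofReal.indicator (measurableSet_gauge_le 1)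
  have hpt (e : Model m n) : ENNReal.ofReal (gauge (op c (-e) y) ^ (-α)) ≤
      φ (op c (-y) e) + 1 := by
    rw [gauge_neg_op_comm hc]
    by_cases h : gauge (op c (-y) e) ≤ 1
    · rw [hφ, Set.indicator_of_mem (by exact h)]
      exact le_self_add
    · refine le_add_left (ENNReal.ofReal_le_one.2 ?_)
      exact Real.rpow_le_one_of_one_le_of_nonpos (not_le.1 h).le (by linarith)
  calc ∫⁻ e in E, ENNReal.ofReal (gauge (op c (-e) y) ^ (-α))
      ≤ ∫⁻ e in E, (φ (op c (-y) e) + 1) := lintegral_mono hpt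
    _ = (∫⁻ e in E, φ (op c (-y) e)) + volume E := by
        rw [lintegral_add_right _ measurable_const]; simp
    _ ≤ (∫⁻ e, φ (op c (-y) e)) + volume {y : Model m n | gauge y ≤ 1} :=
        add_le_add (setLIntegral_le_lintegral _ _) (measure_mono hE)
    _ = _ := by
        rw [(measurePreserving_op_left c (-y)).lintegral_comp hφm, hφ,
          lintegral_indicator (measurableSet_gauge_le 1)]

/-! ### Comparison with potentials -/

/-- The conditions on a matrix under which the power `-α` of the gauge is a strict barrier. -/
structure IsBarrierMatrix (n : ℕ) (α : ℝ) (a : Matrix (Fin m) (Fin m) ℝ) : Prop where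
  symm : a.IsSymm
  posSemidef : a.PosSemidef
  trace_pos : 0 < a.trace
  exists_bounds : ∃ lo hi : ℝ,
    (∀ ξ : Fin m → ℝ, lo * ∑ i, ξ i ^ 2 ≤ ∑ i, ∑ j, a i j * (ξ i * ξ j)) ∧
    (∀ ξ : Fin m → ℝ, ∑ i, ∑ j, a i j * (ξ i * ξ j) ≤ hi * ∑ i, ξ i ^ 2) ∧
    a.trace + (2 * n + 2) * hi ≤ (4 * α + 4) * lo

theorem contDiff_op_left (c : Fin n → Fin m → Fin m → ℝ) (x : Model m n) {k : WithTop ℕ∞} :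
    ContDiff ℝ k (op c x) :=
  (contDiff_op c).comp (by fun_prop : ContDiff ℝ k fun z => (x, z))

/-- The frozen-coefficient operator is left invariant, so the barrier may have its pole anywhere. -/
theorem secondOp_gauge_rpow_translate_nonneg {c : Fin n → Fin m → Fin m → ℝ} (hc : IsHType c)
    {α : ℝ} (hα : 0 < α) {a : Matrix (Fin m) (Fin m) ℝ} (ha : IsBarrierMatrix n α a)
    {e y : Model m n} (hy : y ≠ e) :
    0 ≤ secondOp (field c) a (fun z => gauge (op c (-e) z) ^ (-α)) y := by
  have hne : op c (-e) y ≠ 0 := fun h => (gauge_neg_op_pos hc hy).ne' (by rw [h, gauge_zero])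
  obtain ⟨lo, hi, h1, h2, h3⟩ := ha.exists_bounds
  have h := secondOp_gauge_rpow_nonneg hc ha.symm hα h1 h2 h3 hne
  have e : secondOp (field c) a (fun z => gauge (op c (-e) z) ^ (-α)) y =
      secondOp (field c) a (fun z => gauge z ^ (-α)) (op c (-e) y) := by
    unfold secondOp
    refine Finset.sum_congr rfl fun i _ => Finset.sum_congr rfl fun j _ => ?_
    rw [fieldDeriv_fieldDeriv_comp (T := op c (-e)) (f := fun z : Model m n => gauge z ^ (-α))
      (X₁ := field c i) (X₂ := field c j) isOpen_ne
      (fun z hz => (contDiffAt_gauge_rpow (-α) hz).contDiffWithinAt) (contDiff_field c j)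
      (contDiff_op_left c _) (fderiv_op_left_field c (-e) i) (fderiv_op_left_field c (-e) j) hne]
    ring
  rwa [e]

/-- The kernel is jointly smooth off the diagonal, an open set containing {y} × E when `y` is not in
the compact set `E`. Hence differentiation under the integral preserves the sign. -/
theorem potential_subsolution {c : Fin n → Fin m → Fin m → ℝ} (hc : IsHType c)
    {α : ℝ} (hα : 0 < α) {a : Matrix (Fin m) (Fin m) ℝ} (ha : IsBarrierMatrix n α a)
    {E : Set (Model m n)} (hE : IsCompact E) {y : Model m n} (hy : y ∉ E) :
    TwiceDiffAt (field c) (fun z => ∫ e in E, gauge (op c (-e) z) ^ (-α)) y ∧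
      0 ≤ secondOp (field c) a (fun z => ∫ e in E, gauge (op c (-e) z) ^ (-α)) y := by
  have hop : ContDiff ℝ ∞ fun t : Model m n × Model m n => op c (-t.2) t.1 :=
    (contDiff_op c).comp (by fun_prop : ContDiff ℝ ∞ fun t : Model m n × Model m n => (-t.2, t.1))
  have hO : IsOpen {t : Model m n × Model m n | op c (-t.2) t.1 ≠ 0} :=
    isOpen_ne.preimage hop.continuous
  refine secondOp_setIntegral_nonneg (fun j => contDiff_field c j) hO
    (F := fun z e => gauge (op c (-e) z) ^ (-α)) ?_ hE ?_ a ?_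
  · intro t ht
    exact ((contDiffAt_gauge_rpow (-α) ht).comp t hop.contDiffAt).contDiffWithinAt
  · intro e he h
    have hye : y ≠ e := fun h => hy (h ▸ he)
    exact (gauge_neg_op_pos hc hye).ne' (by rw [h, gauge_zero])
  · intro e he
    exact secondOp_gauge_rpow_translate_nonneg hc hα ha fun h => hy (h ▸ he)

/-- A nonnegative supersolution is bounded below by the normalized potential of a set on which it
is at least one. -/
theorem potential_comparison {c : Fin n → Fin m → Fin m → ℝ} (hc : IsHType c)
    {α : ℝ} (hα : 0 < α) (hαQ : 4 * α < m + 2 * n) {U : Set (Model m n)} (hU : IsOpen U)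
    (hsub : {y | gauge y ≤ 1} ⊆ U) {v : Model m n → ℝ} (hv : ContDiffOn ℝ 2 v U)
    (hv0 : ∀ y ∈ U, 0 ≤ v y) {a : Model m n → Matrix (Fin m) (Fin m) ℝ}
    (ha : ∀ y ∈ U, IsBarrierMatrix n α (a y))
    (hLv : ∀ y ∈ U, secondOp (field c) (a y) v y ≤ 0) {E : Set (Model m n)} (hE : IsCompact E)
    (hE1 : E ⊆ {y | gauge y ≤ 1}) (hvE : ∀ y ∈ E, 1 ≤ v y) {b : ℝ} (hb : 0 ≤ b)
    (hbound : ∀ y, gauge y = 1 → ∫ e in E, gauge (op c (-e) y) ^ (-α) ≤ b)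
    (h0 : v 0 ≤ 1 / 2) :
    ((∫ e in E, gauge (op c (-e) 0) ^ (-α)) - b) / (2 * potentialBound m n α) ≤ v 0 := by
  set w : Model m n → ℝ := fun y => ∫ e in E, gauge (op c (-e) y) ^ (-α) with hw
  set M := potentialBound m n α with hM
  have hMpos : 0 < M := potentialBound_pos hα hαQ
  have hwM (y : Model m n) : w y ≤ M := potential_le hc hα hαQ hE1 y
  -- The perturbation τ(|p|² - 1) makes the comparison function a strict subsolution, since |p|² has
  -- image 2 Tr a > 0; it is nonpositive on the unit ball and τ tends to 0 at the end.
  refine le_of_forall_pos_le_add fun τ hτ => ?_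
  set G : Model m n → ℝ := fun z =>
    1 / (2 * M) * w z + ((-1) * v z + (τ * (∑ i, z.1 i ^ 2) + (-(b / (2 * M)) - τ))) with hG
  have hhalf {z : Model m n} : 1 / (2 * M) * w z ≤ 1 / 2 := by
    have := mul_le_mul_of_nonneg_left (hwM z) (by positivity : 0 ≤ 1 / (2 * M))
    refine this.trans_eq ?_
    field_simp
  have hp {z : Model m n} (hz : gauge z ≤ 1) : ∑ i, z.1 i ^ 2 ≤ 1 := by
    have h1 : 0 ≤ ∑ i, z.1 i ^ 2 := by positivity
    have h2 : 0 ≤ ∑ k, z.2 k ^ 2 := by positivity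
    unfold gauge at hz
    nlinarith
  have hb' : 0 ≤ b / (2 * M) := by positivity
  -- The comparison domain. It misses E, where v ≥ 1, so w is twice differentiable there. On the
  -- unit sphere w ≤ b, and where v ≥ 1/2 the normalized potential is at most 1/2: either way G ≤ 0.
  set K : Set (Model m n) := {y | gauge y ≤ 1 ∧ v y ≤ 1 / 2} with hK
  have hunit : IsCompact {y : Model m n | gauge y ≤ 1} := by
    simpa using isCompact_gauge_le (m := m) (n := n) zero_le_one le_rfl
  have hKc : IsCompact K := by
    have : IsClosed ({y : Model m n | gauge y ≤ 1} ∩ v ⁻¹' Set.Iic (1 / 2)) :=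
      (hv.continuousOn.mono hsub).preimage_isClosed_of_isClosed hunit.isClosed isClosed_Iic
    exact hunit.of_isClosed_subset this fun y hy => hy.1
  have hKE {y : Model m n} (hy : y ∈ K) : y ∉ E := fun h => by
    have := hvE y h
    have := hy.2
    linarith
  have hGt {y : Model m n} (hy : y ∈ K) : TwiceDiffAt (field c) G y ∧
      2 * τ * (a y).trace ≤ secondOp (field c) (a y) G y := by
    have hyU := hsub hy.1
    obtain ⟨t1, s1⟩ := potential_subsolution hc hα (ha y hyU) hE (hKE hy)
    have t2 := twiceDiffAt_of_contDiffOn (fun j => contDiff_field c j) hU hv hyU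
    have t3 : TwiceDiffAt (field c) (fun z : Model m n => ∑ i, z.1 i ^ 2) y :=
      twiceDiffAt_of_contDiffOn (fun j => contDiff_field c j) isOpen_univ
        (ContDiff.contDiffOn (by fun_prop)) (Set.mem_univ y)
    have t4 := (t3.const_mul τ).add (twiceDiffAt_const (field c) (-(b / (2 * M)) - τ) y)
    have t5 := (t2.const_mul (-1)).add t4
    refine ⟨(t1.const_mul (1 / (2 * M))).add t5, ?_⟩
    rw [hG, (t1.const_mul (1 / (2 * M))).secondOp_add t5, (t2.const_mul (-1)).secondOp_add t4,
      (t3.const_mul τ).secondOp_add (twiceDiffAt_const _ _ _), secondOp_const, secondOp_const_mul,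
      secondOp_const_mul, secondOp_const_mul, secondOp_sum_sq]
    have s2 := hLv y hyU
    have s3 : 0 ≤ 1 / (2 * M) * secondOp (field c) (a y) w y := mul_nonneg (by positivity) s1
    linarith
  obtain ⟨y, hy, hmax⟩ := hKc.exists_isMaxOn
    ⟨0, by rw [hK]; exact ⟨by rw [gauge_zero]; exact zero_le_one, h0⟩⟩
    (f := G) fun z hz => (hGt hz).1.1.self_of_nhds.continuousAt.continuousWithinAt
  have hGy : G y ≤ 0 := by
    by_contra! hpos
    have hy1 : gauge y < 1 := by
      refine lt_of_le_of_ne hy.1 fun h => ?_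
      have h1 : 1 / (2 * M) * w y ≤ b / (2 * M) := by
        rw [one_div_mul_eq_div]
        gcongr
        exact hbound y h
      have h2 := hv0 y (hsub hy.1)
      have h3 := mul_le_mul_of_nonneg_left (hp hy.1) hτ.le
      simp only [hG] at hpos
      linarith
    -- The maximum over K is a local maximum in the full space: nearby points outside K have v >
    -- 1/2, hence G ≤ 0 < G y.
    have hloc : IsLocalMax G y := by
      filter_upwards [(isOpen_lt continuous_gauge continuous_const).mem_nhds hy1] with z hz
      have hz' : gauge z ≤ 1 := le_of_lt hz
      by_cases hvz : v z ≤ 1 / 2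
      · exact hmax ⟨hz', hvz⟩
      · have h3 := mul_le_mul_of_nonneg_left (hp hz') hτ.le
        have h4 := hhalf (z := z)
        refine le_trans ?_ hpos.le
        simp only [hG]
        linarith
    obtain ⟨t, s⟩ := hGt hy
    have h5 := secondOp_nonpos_of_isLocalMax (field_constant_on_lines hc)
      (ha y (hsub hy.1)).posSemidef t hloc
    have h6 := (ha y (hsub hy.1)).trace_pos
    have : 0 < 2 * τ * (a y).trace := by positivity
    linarith
  have hG0 : G 0 ≤ 0 :=
    (hmax (show (0 : Model m n) ∈ K from ⟨by rw [gauge_zero]; exact zero_le_one, h0⟩)).trans hGy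
  have : G 0 = (w 0 - b) / (2 * M) - v 0 - τ := by
    simp [hG]; ring
  linarith

/-! ### Critical density on the unit ball of the model. -/

/-- The critical density property at the centre of the unit ball. -/
theorem exists_center_bound (m n : ℕ) {α : ℝ} (hα : 0 < α) (hαQ : 4 * α < m + 2 * n) :
    ∃ η κ : ℝ, 0 < η ∧ η ≤ 1 ∧ 0 < κ ∧ ∀ c : Fin n → Fin m → Fin m → ℝ, IsHType c →
      ∀ U : Set (Model m n), IsOpen U → {y | gauge y ≤ 1} ⊆ U →
      ∀ v : Model m n → ℝ, ContDiffOn ℝ 2 v U → (∀ y ∈ U, 0 ≤ v y) →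
      ∀ a : Model m n → Matrix (Fin m) (Fin m) ℝ, (∀ y ∈ U, IsBarrierMatrix n α (a y)) →
      (∀ y ∈ U, secondOp (field c) (a y) v y ≤ 0) →
      volume.real {y : Model m n | gauge y ≤ η ^ 4} / 2 ≤
        volume.real {y : Model m n | gauge y ≤ η ^ 4 ∧ 1 ≤ v y} → κ ≤ v 0 := by
  have hunit : IsCompact {y : Model m n | gauge y ≤ 1} := by
    simpa using isCompact_gauge_le (m := m) (n := n) zero_le_one le_rfl
  -- For poles of gauge at most r⁴, the points of the unit sphere stay at gauge more than 1/2 from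
  -- the pole, uniformly in the structure constants. So the kernel is at most 2^α there.
  obtain ⟨r, hr, hr1, hrF⟩ := exists_gauge_ball_forall_lt (m := m) (n := n)
    (F := fun t => -gauge (op t.1 (-t.2.2) t.2.1)) (a := -(1 / 2))
    (continuous_gauge.comp (continuous_op.comp
      (by fun_prop : Continuous fun t : (Fin n → Fin m → Fin m → ℝ) × Model m n × Model m n =>
        (t.1, -t.2.2, t.2.1)))).neg
    (K := {y | gauge y = 1})
    (hunit.of_isClosed_subset (isClosed_eq continuous_gauge continuous_const) fun y hy => le_of_eq hy)
    (fun c y hy => by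
      rw [Set.mem_ofPred_eq] at hy
      simp only [neg_zero, zero_op, hy]; norm_num)
  -- One more than the bound 2^α on the sphere. The radius η is then so small that the kernel is at
  -- least L at the centre, and the gain w(0) - b is at least the volume of E, hence at least β/2.
  set L : ℝ := 2 ^ α + 1 with hL
  have hLpos : 0 < L := by positivity
  set η : ℝ := min r (L ^ (-(1 / (4 * α)))) with hη
  have hηpos : 0 < η := by positivity
  have hη1 : η ≤ 1 := (min_le_left _ _).trans hr1
  have hηL : L ≤ (η ^ 4) ^ (-α) := by
    have h1 : (η ^ 4) ^ (-α) = η ^ (-(4 * α)) := by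
      rw [← Real.rpow_natCast, ← Real.rpow_mul hηpos.le]; norm_num
    have h2 := Real.rpow_le_rpow_of_nonpos hηpos (min_le_right _ _ : η ≤ L ^ (-(1 / (4 * α))))
      (by linarith : -(4 * α) ≤ 0)
    rw [← Real.rpow_mul hLpos.le] at h2
    rw [h1]
    refine le_trans (le_of_eq ?_) h2
    have : -(1 / (4 * α)) * -(4 * α) = 1 := by field_simp
    rw [this, Real.rpow_one]
  set M := potentialBound m n α with hM
  have hMpos : 0 < M := potentialBound_pos hα hαQ
  set β := volume.real {y : Model m n | gauge y ≤ η ^ 4} with hβ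
  have hβpos : 0 < β := by
    rw [hβ, Measure.real, measure_gauge_le hηpos, ENNReal.toReal_mul]
    refine mul_pos (by rw [ENNReal.toReal_ofReal (by positivity)]; positivity)
      (ENNReal.toReal_pos measure_gauge_le_one_pos.ne' measure_gauge_le_one_lt_top.ne)
  refine ⟨η, min (1 / 2) (β / 2 / (2 * M)), hηpos, hη1, by positivity, ?_⟩
  intro c hc U hU hsub v hv hv0 a ha hLv hdens
  rcases le_or_gt (v 0) (1 / 2) with h0 | h0
  swap
  · exact (min_le_left _ _).trans h0.le
  refine (min_le_right _ _).trans ?_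
  have hηle : {y : Model m n | gauge y ≤ η ^ 4} ⊆ {y | gauge y ≤ 1} := fun y hy =>
    le_trans hy (pow_le_one₀ hηpos.le hη1)
  set E : Set (Model m n) := {y | gauge y ≤ η ^ 4 ∧ 1 ≤ v y} with hEdef
  have hEη : E ⊆ {y | gauge y ≤ η ^ 4} := fun y hy => hy.1
  have hE : IsCompact E := by
    have hc' := isCompact_gauge_le (m := m) (n := n) hηpos.le hη1
    have : IsClosed ({y : Model m n | gauge y ≤ η ^ 4} ∩ v ⁻¹' Set.Ici 1) :=
      (hv.continuousOn.mono (hηle.trans hsub)).preimage_isClosed_of_isClosed hc'.isClosed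
        isClosed_Ici
    exact hc'.of_isClosed_subset this hEη
  have hcomp := potential_comparison hc hα hαQ hU hsub hv hv0 ha hLv hE (hEη.trans hηle)
    (fun y hy => hy.2) (b := volume.real E * 2 ^ α) (by positivity) ?_ h0
  · refine le_trans ?_ hcomp
    gcongr
    -- The pole avoids the origin because v 0 ≤ 1/2 < 1, so the kernel is continuous on the compact
    -- set E.
    have hne {e : Model m n} (he : e ∈ E) : e ≠ 0 := fun h => by
      have := he.2
      rw [h] at this
      linarith
    have heq (e : Model m n) : gauge (op c (-e) 0) = gauge e := by rw [op_zero, gauge_neg]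
    have hint : IntegrableOn (fun e : Model m n => gauge e ^ (-α)) E :=
      ContinuousOn.integrableOn_compact hE fun e he =>
        (contDiffAt_gauge_rpow (k := 0) (-α) (hne he)).continuousAt.continuousWithinAt
    have hlow : volume.real E * L ≤ ∫ e in E, gauge (op c (-e) 0) ^ (-α) := by
      simp only [heq]
      have h1 : ∫ _ in E, L ≤ ∫ e in E, gauge e ^ (-α) := by
        refine setIntegral_mono_on (integrableOn_const hE.measure_lt_top.ne) hint
          hE.measurableSet fun e he => hηL.trans ?_
        exact Real.rpow_le_rpow_of_nonpos (gauge_pos (hne he)) he.1 (by linarith)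
      simpa using h1
    rw [hL] at hlow
    linarith
  · intro y hy
    have hle (e : Model m n) (he : e ∈ E) : ‖gauge (op c (-e) y) ^ (-α)‖ ≤ 2 ^ α := by
      have h1 := hrF c hc y hy e (he.1.trans (pow_le_pow_left₀ hηpos.le (min_le_left _ _) 4))
      have h2 : (1 / 2 : ℝ) ≤ gauge (op c (-e) y) := by
        simp only at h1
        linarith
      rw [Real.norm_of_nonneg (Real.rpow_nonneg (gauge_nonneg _) _)]
      refine (Real.rpow_le_rpow_of_nonpos (by norm_num) h2 (by linarith)).trans_eq ?_
      rw [Real.rpow_neg (by norm_num), one_div, Real.inv_rpow (by norm_num), inv_inv]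
    have h3 := norm_setIntegral_le_of_norm_le_const (μ := volume) hE.measure_lt_top hle
    rw [mul_comm]
    exact (le_abs_self _).trans h3

/-- The critical density property for the unit ball of the model. -/
theorem exists_criticalDensity (m n : ℕ) {α : ℝ} (hα : 0 < α) (hαQ : 4 * α < m + 2 * n) :
    ∃ ε κ : ℝ, 0 < ε ∧ ε < 1 ∧ 0 < κ ∧ ∀ c : Fin n → Fin m → Fin m → ℝ, IsHType c →
      ∀ U : Set (Model m n), IsOpen U → {y | gauge y < 1} ⊆ U →
      ∀ u : Model m n → ℝ, ContDiffOn ℝ 2 u U → (∀ y ∈ U, 0 ≤ u y) →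
      ∀ a : Model m n → Matrix (Fin m) (Fin m) ℝ, (∀ y ∈ U, IsBarrierMatrix n α (a y)) →
      (∀ y ∈ U, secondOp (field c) (a y) u y ≤ 0) →
      ENNReal.ofReal ε * volume {y : Model m n | gauge y < 1} ≤
        volume {y : Model m n | gauge y < 1 ∧ 1 ≤ u y} →
      ∀ h, gauge h < (1 / 2) ^ 4 → κ ≤ u h := by
  obtain ⟨η, κ, hη, hη1, hκ, H⟩ := exists_center_bound m n hα hαQ
  -- Instead of a triangle inequality for the gauge: the θ-ball around any point of the closed half
  -- ball stays in the open unit ball, uniformly in the structure constants.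
  obtain ⟨θ, hθ, hθ1, hθF⟩ := exists_gauge_ball_forall_lt (m := m) (n := n)
    (F := fun t => gauge (op t.1 t.2.1 t.2.2)) (a := 1)
    (continuous_gauge.comp continuous_op)
    (isCompact_gauge_le (by norm_num : (0 : ℝ) ≤ 1 / 2) (by norm_num))
    (fun c y hy => by
      simp only [op_zero]
      exact lt_of_le_of_lt hy (by norm_num))
  set Q := m + 2 * n with hQ
  have hpow1 : (η * θ) ^ Q ≤ 1 := pow_le_one₀ (by positivity) (mul_le_one₀ hη1 hθ.le hθ1)
  have hpow0 : 0 < (η * θ) ^ Q := by positivity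
  -- A ball of radius ηθ has the fraction (ηθ)^Q of the unit volume. With this density the set {u <
  -- 1} has at most half of that volume, so u ≥ 1 on at least half of every such ball inside the
  -- unit ball.
  refine ⟨1 - (η * θ) ^ Q / 2, κ, by linarith, by linarith, hκ, ?_⟩
  intro c hc U hU hsub u hu hu0 a ha hLu hdens h hh
  set T : Model m n → Model m n := fun y => op c h (dil θ y) with hT
  have hdilC : ContDiff ℝ 1 (dil θ : Model m n → Model m n) := by unfold dil; fun_prop
  have hdilC2 : ContDiff ℝ 2 (dil θ : Model m n → Model m n) := by unfold dil; fun_prop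
  have hTC : ContDiff ℝ 1 T := (contDiff_op_left c h).comp hdilC
  have hTC2 : ContDiff ℝ 2 T := (contDiff_op_left c h).comp hdilC2
  have hTin {y : Model m n} (hy : gauge y ≤ 1) : gauge (T y) < 1 := by
    refine hθF c hc h (le_of_lt hh) (dil θ y) ?_
    rw [gauge_dil]
    exact mul_le_of_le_one_right (by positivity) hy
  have hTf (j : Fin m) (y : Model m n) :
      fderiv ℝ T y (field c j y) = θ • field c j (T y) := by
    have h1 : DifferentiableAt ℝ (dil θ) y := hdilC.differentiable one_ne_zero y
    have h2 : DifferentiableAt ℝ (op c h) (dil θ y) :=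
      (contDiff_op_left c h (k := 1)).differentiable one_ne_zero _
    have h3 : fderiv ℝ T y = (fderiv ℝ (op c h) (dil θ y)).comp (fderiv ℝ (dil θ) y) :=
      fderiv_comp y h2 h1
    rw [h3, ContinuousLinearMap.comp_apply, fderiv_dil_field, map_smul, fderiv_op_left_field,
      one_smul]
  have hT0 : T 0 = h := by simp [hT, dil, op_zero, ← Prod.zero_eq_mk]
  have hkey := H c hc (T ⁻¹' U) (hU.preimage hTC.continuous)
    (fun y hy => hsub (hTin hy)) (fun y => u (T y)) (hu.comp hTC2.contDiffOn fun y hy => hy)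
    (fun y hy => hu0 _ hy) (fun y => a (T y)) (fun y hy => ha _ hy) ?_ ?_
  · rwa [hT0] at hkey
  · intro y hy
    have : secondOp (field c) (a (T y)) (fun y => u (T y)) y =
        θ ^ 2 * secondOp (field c) (a (T y)) u (T y) := by
      simp only [secondOp, Finset.mul_sum]
      refine Finset.sum_congr rfl fun i _ => Finset.sum_congr rfl fun j _ => ?_
      rw [fieldDeriv_fieldDeriv_comp hU hu (contDiff_field c j) hTC (hTf i) (hTf j) hy]
      ring
    rw [this]
    exact mul_nonpos_of_nonneg_of_nonpos (by positivity) (hLu _ hy)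
  · have hBo : IsOpen {y : Model m n | gauge y < 1} := isOpen_lt continuous_gauge continuous_const
    have hBfin : volume {y : Model m n | gauge y < 1} < ⊤ :=
      (measure_mono (gauge_lt_subset_gauge_le 1)).trans_lt measure_gauge_le_one_lt_top
    set F : Set (Model m n) := {y | gauge y < 1} ∩ u ⁻¹' Set.Iio 1 with hF
    have hFo : IsOpen F := (hu.continuousOn.mono hsub).isOpen_inter_preimage hBo isOpen_Iio
    have hsplit : volume.real {y : Model m n | gauge y < 1} =
        volume.real {y : Model m n | gauge y < 1 ∧ 1 ≤ u y} + volume.real F := by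
      have h1 : {y : Model m n | gauge y < 1} \ F = {y : Model m n | gauge y < 1 ∧ 1 ≤ u y} := by
        ext y
        simp only [hF, Set.mem_sdiff, Set.mem_inter_iff, Set.mem_preimage, Set.mem_Iio,
          Set.mem_ofPred_eq, not_and, not_lt]
        exact ⟨fun h => ⟨h.1, h.2 h.1⟩, fun h => ⟨h.1, fun _ => h.2⟩⟩
      rw [← h1, add_comm, ← measureReal_inter_add_sdiff hFo.measurableSet (h := hBfin.ne)]
      congr 2
      exact (Set.inter_eq_right.2 fun y hy => hy.1)
    have hd : (1 - (η * θ) ^ Q / 2) * volume.real {y : Model m n | gauge y < 1} ≤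
        volume.real {y : Model m n | gauge y < 1 ∧ 1 ≤ u y} := by
      have := ENNReal.toReal_mono
        ((measure_mono fun y hy => hy.1).trans_lt hBfin).ne hdens
      rwa [ENNReal.toReal_mul, ENNReal.toReal_ofReal (by linarith)] at this
    have hβ : volume.real {y : Model m n | gauge y < 1} ≤
        volume.real {y : Model m n | gauge y ≤ 1} :=
      measureReal_mono (gauge_lt_subset_gauge_le 1) measure_gauge_le_one_lt_top.ne
    have hFvol : volume.real F ≤ (η * θ) ^ Q / 2 * volume.real {y : Model m n | gauge y ≤ 1} := by
      have := mul_le_mul_of_nonneg_left hβ (by positivity : 0 ≤ (η * θ) ^ Q / 2)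
      linarith
    have hTF : volume.real (T ⁻¹' F) = (θ ^ Q)⁻¹ * volume.real F := by
      have h1 : T ⁻¹' F = dil θ ⁻¹' (op c h ⁻¹' F) := rfl
      have h2 : MeasurableSet (op c h ⁻¹' F) :=
        (hFo.preimage (contDiff_op_left c h (k := 0)).continuous).measurableSet
      rw [Measure.real, h1, measure_dil_preimage hθ h2,
        (measurePreserving_op_left c h).measure_preimage hFo.measurableSet.nullMeasurableSet,
        ENNReal.toReal_mul, ENNReal.toReal_ofReal (by positivity)]
      rfl
    have hηvol : volume.real {y : Model m n | gauge y ≤ η ^ 4} =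
        η ^ Q * volume.real {y : Model m n | gauge y ≤ 1} := by
      rw [Measure.real, measure_gauge_le hη, ENNReal.toReal_mul,
        ENNReal.toReal_ofReal (by positivity)]
      rfl
    have hcov : volume.real {y : Model m n | gauge y ≤ η ^ 4} ≤
        volume.real {y : Model m n | gauge y ≤ η ^ 4 ∧ 1 ≤ u (T y)} + volume.real (T ⁻¹' F) := by
      have hfin : volume {y : Model m n | gauge y ≤ η ^ 4} < ⊤ :=
        (isCompact_gauge_le hη.le hη1).measure_lt_top
      refine (measureReal_mono (fun y hy => ?_) ?_).trans (measureReal_union_le _ _)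
      · by_cases h1 : 1 ≤ u (T y)
        · exact Or.inl ⟨hy, h1⟩
        · exact Or.inr ⟨hTin (le_trans hy (pow_le_one₀ hη.le hη1)), not_le.1 h1⟩
      · refine (measure_union_lt_top ((measure_mono fun y hy => hy.1).trans_lt hfin) ?_).ne
        have h1 : T ⁻¹' F = dil θ ⁻¹' (op c h ⁻¹' F) := rfl
        have h2 : MeasurableSet (op c h ⁻¹' F) :=
          (hFo.preimage (contDiff_op_left c h (k := 0)).continuous).measurableSet
        rw [h1, measure_dil_preimage hθ h2,
          (measurePreserving_op_left c h).measure_preimage hFo.measurableSet.nullMeasurableSet]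
        exact ENNReal.mul_lt_top ENNReal.ofReal_lt_top
          ((measure_mono fun y hy => hy.1).trans_lt hBfin)
    have hfinal : volume.real (T ⁻¹' F) ≤ volume.real {y : Model m n | gauge y ≤ η ^ 4} / 2 := by
      rw [hTF, hηvol]
      calc (θ ^ Q)⁻¹ * volume.real F
          ≤ (θ ^ Q)⁻¹ * ((η * θ) ^ Q / 2 * volume.real {y : Model m n | gauge y ≤ 1}) := by gcongr
        _ = _ := by rw [mul_pow]; field_simp
    linarith

end Model

end HType

end

noncomputable section

namespace HType

open Filter Topology

/-! ### Matrices under the Landis condition -/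

theorem mulVec_dotProduct_self {m : ℕ} (a : Matrix (Fin m) (Fin m) ℝ) (ξ : Fin m → ℝ) :
    a.mulVec ξ ⬝ᵥ ξ = ∑ i, ∑ j, a i j * (ξ i * ξ j) := by
  simp only [dotProduct, Matrix.mulVec, Finset.sum_mul]
  exact Finset.sum_congr rfl fun i _ => Finset.sum_congr rfl fun j _ => by ring

theorem dotProduct_self_eq_sum_sq {m : ℕ} (ξ : Fin m → ℝ) : ξ ⬝ᵥ ξ = ∑ i, ξ i ^ 2 := by
  simp [dotProduct, sq]

/-- The exponent is chosen so that 4α + 4 = Q + 4 - δ. As Q + 2 - m = 2n + 2, the Landis inequality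
is the required bound, with the extreme values on the sphere as `lo` and `hi`. -/
theorem isBarrierMatrix_of_landis {m n : ℕ} (hm : 0 < m) {lam Lam δ : ℝ} (hlam : 0 < lam)
    {a : Matrix (Fin m) (Fin m) ℝ} (he : IsElliptic lam Lam a) (hl : IsLandis n δ a) :
    Model.IsBarrierMatrix n ((m + 2 * n - δ) / 4) a := by
  have hself (ξ : Fin m → ℝ) : 0 ≤ ξ ⬝ᵥ ξ := by rw [dotProduct_self_eq_sum_sq]; positivity
  have hbelow : BddBelow (sphereValues a) := by
    refine ⟨lam, ?_⟩
    rintro _ ⟨ξ, hξ, rfl⟩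
    have := (he.2 ξ).1
    rwa [Set.mem_ofPred_eq.mp hξ, mul_one] at this
  have habove : BddAbove (sphereValues a) := by
    refine ⟨Lam, ?_⟩
    rintro _ ⟨ξ, hξ, rfl⟩
    have := (he.2 ξ).2
    rwa [Set.mem_ofPred_eq.mp hξ, mul_one] at this
  have hscale (ξ : Fin m → ℝ) (h : ξ ⬝ᵥ ξ ≠ 0) :
      (a.mulVec ξ ⬝ᵥ ξ) / (ξ ⬝ᵥ ξ) ∈ sphereValues a := by
    have hpos : 0 < ξ ⬝ᵥ ξ := (hself ξ).lt_of_ne' h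
    refine ⟨(Real.sqrt (ξ ⬝ᵥ ξ))⁻¹ • ξ, ?_, ?_⟩
    · simp only [Set.mem_ofPred_eq, smul_dotProduct, dotProduct_smul, smul_eq_mul, ← mul_assoc]
      rw [← mul_inv, Real.mul_self_sqrt hpos.le, inv_mul_cancel₀ h]
    · simp only [Matrix.mulVec_smul, smul_dotProduct, dotProduct_smul, smul_eq_mul, ← mul_assoc]
      rw [← mul_inv, Real.mul_self_sqrt hpos.le, inv_mul_eq_div]
  have hlo (ξ : Fin m → ℝ) : sInf (sphereValues a) * (ξ ⬝ᵥ ξ) ≤ a.mulVec ξ ⬝ᵥ ξ := by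
    by_cases h : ξ ⬝ᵥ ξ = 0
    · have := (he.2 ξ).1
      rw [h] at this ⊢
      linarith
    · exact (le_div_iff₀ ((hself ξ).lt_of_ne' h)).1 (csInf_le hbelow (hscale ξ h))
  have hhi (ξ : Fin m → ℝ) : a.mulVec ξ ⬝ᵥ ξ ≤ sSup (sphereValues a) * (ξ ⬝ᵥ ξ) := by
    by_cases h : ξ ⬝ᵥ ξ = 0
    · have := (he.2 ξ).2
      rw [h] at this ⊢
      linarith
    · exact (div_le_iff₀ ((hself ξ).lt_of_ne' h)).1 (le_csSup habove (hscale ξ h))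
  refine ⟨he.1, ?_, ?_, sInf (sphereValues a), sSup (sphereValues a), fun ξ => ?_, fun ξ => ?_, ?_⟩
  · refine Matrix.PosSemidef.of_dotProduct_mulVec_nonneg ?_ fun ξ => ?_
    · rw [Matrix.IsHermitian, Matrix.conjTranspose_eq_transpose_of_trivial]
      exact he.1
    · rw [star_trivial, dotProduct_comm]
      exact (mul_nonneg hlam.le (hself ξ)).trans (he.2 ξ).1
  · have : Nonempty (Fin m) := ⟨⟨0, hm⟩⟩
    refine Finset.sum_pos (fun i _ => ?_) Finset.univ_nonempty
    have := (he.2 (Pi.single i 1)).1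
    simp at this
    exact hlam.trans_le this
  · simpa only [mulVec_dotProduct_self, dotProduct_self_eq_sum_sq] using hlo ξ
  · simpa only [mulVec_dotProduct_self, dotProduct_self_eq_sum_sq] using hhi ξ
  · unfold IsLandis at hl
    simp only at hl
    convert hl using 2 <;> ring

/-! ### The group law of a homogeneous group -/

section Homogeneous

variable {M N : Type*} [NormedAddCommGroup M] [NormedSpace ℝ M] [NormedAddCommGroup N]
  [NormedSpace ℝ N]

/-- A smooth map which is equivariant under two-step dilations is a quadratic polynomial. -/
theorem eq_quadratic_of_homogeneous {P : N → M} (hP : ContDiff ℝ 2 P) {hN : N →L[ℝ] N}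
    {hM : M →L[ℝ] M} (hhom : ∀ r : ℝ, 0 < r → ∀ z,
      P (r • hN z + r ^ 2 • (z - hN z)) = r • hM (P z) + r ^ 2 • (P z - hM (P z))) (z : N) :
    hM (P z) = fderiv ℝ P 0 (hN z) ∧
      P z = fderiv ℝ P 0 z + (1 / 2 : ℝ) • fderiv ℝ (fderiv ℝ P) 0 (hN z) (hN z) := by
  set a := hN z with ha
  set b := z - hN z with hb
  set A := hM (P z) with hA
  set B := P z - hM (P z) with hB
  -- The dilation orbit of z. For r > 0 homogeneity gives P (k r) = rA + r²B; the first and second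
  -- derivatives at r = 0 identify A and B.
  set k : ℝ → N := fun r => r • a + r ^ 2 • b with hk
  have hkd (r : ℝ) : HasDerivAt k (a + (2 * r) • b) r := by
    have h1 : HasDerivAt (fun r : ℝ => r • a) a r := by simpa using (hasDerivAt_id r).smul_const a
    have h2 : HasDerivAt (fun r : ℝ => r ^ 2 • b) ((2 * r) • b) r := by
      simpa using (hasDerivAt_pow 2 r).smul_const b
    exact h1.add h2
  have hPd : Differentiable ℝ P := hP.differentiable (by norm_num)
  set g₁ : ℝ → M := fun r => fderiv ℝ P (k r) (a + (2 * r) • b) with hg₁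
  have hg (r : ℝ) : HasDerivAt (fun r => P (k r)) (g₁ r) r :=
    (hPd (k r)).hasFDerivAt.comp_hasDerivAt r (hkd r)
  have hpoly {r : ℝ} (hr : 0 < r) : g₁ r = A + (2 * r) • B := by
    have h1 : HasDerivAt (fun r : ℝ => r • A) A r := by simpa using (hasDerivAt_id r).smul_const A
    have h2 : HasDerivAt (fun r : ℝ => r ^ 2 • B) ((2 * r) • B) r := by
      simpa using (hasDerivAt_pow 2 r).smul_const B
    refine (hg r).unique ((h1.add h2).congr_of_eventuallyEq ?_)
    filter_upwards [lt_mem_nhds hr] with s hs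
    exact hhom s hs z
  have hk0 : k 0 = 0 := by simp [hk]
  have hD2 : DifferentiableAt ℝ (fderiv ℝ P) (k 0) :=
    (hP.fderiv_right (m := 1) (by norm_num)).differentiable one_ne_zero _
  have hg₁d : HasDerivAt g₁ (fderiv ℝ (fderiv ℝ P) 0 a a + fderiv ℝ P 0 ((2 : ℝ) • b)) 0 := by
    have h1 : HasDerivAt (fun r => fderiv ℝ P (k r)) (fderiv ℝ (fderiv ℝ P) (k 0) a) 0 := by
      have h3 : HasDerivAt k a 0 := by simpa using hkd 0
      exact hD2.hasFDerivAt.comp_hasDerivAt (0 : ℝ) h3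
    have h2 : HasDerivAt (fun r : ℝ => a + (2 * r) • b) ((2 : ℝ) • b) 0 := by
      have := (((hasDerivAt_id (0 : ℝ)).const_mul 2).smul_const b).const_add a
      simpa using this
    refine (h1.clm_apply h2).congr_deriv ?_
    simp [hk0]
  have hg₁0 : g₁ 0 = A := by
    have t1 : Tendsto g₁ (𝓝[>] 0) (𝓝 (g₁ 0)) := hg₁d.continuousAt.continuousWithinAt
    have t2 : Tendsto (fun r : ℝ => A + (2 * r) • B) (𝓝[>] 0) (𝓝 A) := by
      have : Continuous fun r : ℝ => A + (2 * r) • B := by fun_prop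
      simpa using (this.tendsto 0).mono_left nhdsWithin_le_nhds
    refine tendsto_nhds_unique t1 (t2.congr' ?_)
    filter_upwards [self_mem_nhdsWithin] with r hr using (hpoly hr).symm
  have hlin : fderiv ℝ P 0 a = A := by
    rw [← hg₁0]; simp [hg₁, hk0]
  refine ⟨hlin.symm, ?_⟩
  have h2B : (2 : ℝ) • B = fderiv ℝ (fderiv ℝ P) 0 a a + fderiv ℝ P 0 ((2 : ℝ) • b) := by
    have h1 : HasDerivWithinAt (fun r : ℝ => A + (2 * r) • B) ((2 : ℝ) • B) (Set.Ici 0) 0 := by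
      have := (((hasDerivAt_id (0 : ℝ)).const_mul 2).smul_const B).const_add A
      simpa using this.hasDerivWithinAt
    -- Homogeneity is known only for r > 0, so the derivative of g₁ at 0 is computed from the right.
    have h2 : HasDerivWithinAt g₁ ((2 : ℝ) • B) (Set.Ici 0) 0 := by
      refine h1.congr (fun r hr => ?_) (by simpa using hg₁0)
      rcases (Set.mem_Ici.1 hr).eq_or_lt with h | h
      · rw [← h]; simpa using hg₁0
      · exact hpoly h
    exact (uniqueDiffOn_Ici (0 : ℝ) 0 Set.self_mem_Ici).eq_deriv _ h2 hg₁d.hasDerivWithinAt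
  have hBe : B = (1 / 2 : ℝ) • fderiv ℝ (fderiv ℝ P) 0 a a + fderiv ℝ P 0 b := by
    have := congrArg (fun x => (1 / 2 : ℝ) • x) h2B
    simp only [smul_add, map_smul, smul_smul] at this
    norm_num at this
    simpa using this
  calc P z = A + B := by simp [hA, hB]
    _ = fderiv ℝ P 0 (a + b) + (1 / 2 : ℝ) • fderiv ℝ (fderiv ℝ P) 0 a a := by
        rw [hBe, ← hlin, map_add]; abel
    _ = _ := by simp [ha, hb]

end Homogeneous

section GroupLaw

variable {m n : ℕ}

/-- The projection `(x₁, x₂) ↦ (x₁, 0)`. -/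
def firstProj (m n : ℕ) : Space m n →L[ℝ] Space m n :=
  LinearMap.toContinuousLinearMap
    { toFun := fun x => WithLp.toLp 2 (Sum.elim (fun i => x (Sum.inl i)) 0)
      map_add' := fun x y => by ext (i | i) <;> simp
      map_smul' := fun r x => by ext (i | i) <;> simp }

theorem firstProj_inl (x : Space m n) (i : Fin m) : firstProj m n x (Sum.inl i) = x (Sum.inl i) :=
  rfl

theorem firstProj_inr (x : Space m n) (k : Fin n) : firstProj m n x (Sum.inr k) = 0 := rfl

theorem dilation_eq (r : ℝ) (x : Space m n) :
    dilation r x = r • firstProj m n x + r ^ 2 • (x - firstProj m n x) := by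
  ext (i | i) <;> simp [dilation, firstProj_inl, firstProj_inr]

variable [Group (Space m n)]

/-- The dilation by 2 maps the identity to an idempotent, hence to itself, and its only fixed point
is 0. -/
theorem one_eq_zero_of_dilation (hdil : ∀ r : ℝ, 0 < r → ∀ x y : Space m n,
    dilation r (x * y) = dilation r x * dilation r y) : (1 : Space m n) = 0 := by
  have h1 : dilation 2 (1 : Space m n) = 1 := by
    have := hdil 2 (by norm_num) 1 1
    rw [mul_one] at this
    exact left_eq_mul.1 this
  ext (i | i)
  · have := congrArg (fun x : Space m n => x (Sum.inl i)) h1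
    simp [dilation] at this
    simp; linarith
  · have := congrArg (fun x : Space m n => x (Sum.inr i)) h1
    simp [dilation] at this
    simp; linarith

variable [SmoothGroup (Space m n)]

theorem contDiff_group_mul :
    ContDiff ℝ ∞ fun t : Space m n × Space m n => t.1 * t.2 := by
  have h := contMDiff_mul 𝓘(ℝ, Space m n) ∞ (G := Space m n)
  rw [← modelWithCornersSelf_prod, chartedSpaceSelf_prod] at h
  exact contMDiff_iff_contDiff.1 h

/-- The group law of a homogeneous group of step two. -/
theorem exists_bilinear_group_law (hdil : ∀ r : ℝ, 0 < r → ∀ x y : Space m n,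
    dilation r (x * y) = dilation r x * dilation r y) :
    ∃ β : Space m n →L[ℝ] Space m n →L[ℝ] Space m n,
      (∀ x y : Space m n, x * y = x + y + β x y) ∧
      (∀ x y, firstProj m n x = 0 → β x y = 0) ∧ (∀ x y, firstProj m n y = 0 → β x y = 0) ∧
      ∀ x y, firstProj m n (β x y) = 0 := by
  have hone := one_eq_zero_of_dilation hdil
  set h := firstProj m n
  set P : Space m n × Space m n → Space m n := fun t => t.1 * t.2 with hP
  have hPC : ContDiff ℝ 2 P := contDiff_group_mul.of_le (by norm_cast)
  have hmain := eq_quadratic_of_homogeneous hPC (hN := h.prodMap h) (hM := h) (by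
    intro r hr z
    have := hdil r hr z.1 z.2
    simp only [dilation_eq] at this
    exact this.symm)
  set D := fderiv ℝ P 0 with hD
  set S := fderiv ℝ (fderiv ℝ P) 0 with hS
  have hx0 (x : Space m n) : P (x, 0) = x := by simp [hP, ← hone]
  have h0x (x : Space m n) : P (0, x) = x := by simp [hP, ← hone]
  have hPd : HasFDerivAt P D 0 := (hPC.differentiable (by norm_num) 0).hasFDerivAt
  have hDl (x : Space m n) : D (x, 0) = x := by
    have h1 : HasFDerivAt (fun x : Space m n => P (x, 0))
        (D.comp (ContinuousLinearMap.inl ℝ (Space m n) (Space m n))) 0 :=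
      HasFDerivAt.comp (g := P) (f := fun x : Space m n => (x, (0 : Space m n))) 0 hPd
        (hasFDerivAt_prodMk_left 0 0)
    simp only [hx0] at h1
    have := congrArg (fun L => L x) (h1.unique (hasFDerivAt_id 0))
    simpa using this
  have hDr (x : Space m n) : D (0, x) = x := by
    have h1 : HasFDerivAt (fun x : Space m n => P (0, x))
        (D.comp (ContinuousLinearMap.inr ℝ (Space m n) (Space m n))) 0 :=
      HasFDerivAt.comp (g := P) (f := fun x : Space m n => ((0 : Space m n), x)) 0 hPd
        (hasFDerivAt_prodMk_right 0 0)
    simp only [h0x] at h1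
    have := congrArg (fun L => L x) (h1.unique (hasFDerivAt_id 0))
    simpa using this
  have hDxy (x y : Space m n) : D (x, y) = x + y := by
    have : (x, y) = (x, (0 : Space m n)) + (0, y) := by simp
    rw [this, map_add, hDl, hDr]
  set il := ContinuousLinearMap.inl ℝ (Space m n) (Space m n)
  set ir := ContinuousLinearMap.inr ℝ (Space m n) (Space m n)
  -- Half the mixed part of the second derivative. The pure parts vanish because x∘0 = x and 0∘x =
  -- x; taking both mixed terms avoids appealing to symmetry of S.
  set β : Space m n →L[ℝ] Space m n →L[ℝ] Space m n := (1 / 2 : ℝ) •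
    (S.bilinearComp (il.comp h) (ir.comp h) + (S.bilinearComp (ir.comp h) (il.comp h)).flip) with hβ
  have hβa (x y : Space m n) :
      β x y = (1 / 2 : ℝ) • (S (h x, 0) (0, h y) + S (0, h y) (h x, 0)) := rfl
  have hq1 (x : Space m n) : S (h x, 0) (h x, 0) = 0 := by
    have h2 := (hmain (x, 0)).2
    rw [hx0, hDl] at h2
    simpa using h2
  have hq2 (x : Space m n) : S (0, h x) (0, h x) = 0 := by
    have h2 := (hmain (0, x)).2
    rw [h0x, hDr] at h2
    simpa using h2
  have hlaw (x y : Space m n) : x * y = x + y + β x y := by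
    have h2 := (hmain (x, y)).2
    rw [hDxy] at h2
    have h3 : (h.prodMap h) (x, y) = (h x, 0) + (0, h y) := by simp
    rw [h3, map_add S, add_apply, map_add (S (h x, 0)), map_add (S (0, h y)), hq1, hq2, zero_add,
      add_zero] at h2
    rw [hβa]
    exact h2
  refine ⟨β, hlaw, fun x y hx => ?_, fun x y hy => ?_, fun x y => ?_⟩
  · simp [hβa, hx, ← Prod.zero_eq_mk]
  · simp [hβa, hy, ← Prod.zero_eq_mk]
  · have h1 := (hmain (x, y)).1
    have h3 : (h.prodMap h) (x, y) = (h x, h y) := by simp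
    rw [h3, hDxy] at h1
    have h4 : h (x * y) = h x + h y := h1
    rw [hlaw, map_add, map_add] at h4
    simpa using h4

end GroupLaw

end HType

end

noncomputable section

namespace HType

open Filter Topology

/-! ### Orthonormal coordinates of an H-type algebra -/

section LieCoordinates

variable {L : Type*} [LieRing L] [LieAlgebra ℝ L] {m n : ℕ}

theorem lie_eq_zero_of_mem_center {z : L} (hz : z ∈ LieAlgebra.center ℝ L) (w : L) : ⁅w, z⁆ = 0 :=
  (LieModule.mem_maxTrivSubmodule ℝ L L z).1 hz w

theorem lie_eq_zero_of_mem_center_left {z : L} (hz : z ∈ LieAlgebra.center ℝ L) (w : L) :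
    ⁅z, w⁆ = 0 := by
  rw [← lie_skew, lie_eq_zero_of_mem_center hz, neg_zero]

theorem mem_horizontal_iff {B : LinearMap.BilinForm ℝ L} {v : L} :
    v ∈ horizontal B ↔ ∀ z ∈ LieAlgebra.center ℝ L, B z v = 0 := Iff.rfl

/-- The pair `X`, `Z` consists of orthonormal bases of the horizontal space and of the center. -/
structure IsAdaptedONB (B : LinearMap.BilinForm ℝ L) (X : Fin m → L) (Z : Fin n → L) : Prop where
  mem_horizontal : ∀ i, X i ∈ horizontal B
  mem_center : ∀ k, Z k ∈ LieAlgebra.center ℝ L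
  inner_X : ∀ i j, B (X i) (X j) = if i = j then 1 else 0
  inner_Z : ∀ k l, B (Z k) (Z l) = if k = l then 1 else 0
  inner_ZX : ∀ k i, B (Z k) (X i) = 0
  inner_XZ : ∀ i k, B (X i) (Z k) = 0
  eq_sum_X : ∀ v ∈ horizontal B, ∑ i, B (X i) v • X i = v
  eq_sum_Z : ∀ z ∈ LieAlgebra.center ℝ L, ∑ k, B (Z k) z • Z k = z
  eq_sum : ∀ w, ∑ i, B (X i) w • X i + ∑ k, B (Z k) w • Z k = w

theorem IsHorizontalONB.eq_sum {B : LinearMap.BilinForm ℝ L} {X : Fin m → L}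
    (hX : IsHorizontalONB B X) {v : L} (hv : v ∈ horizontal B) : ∑ i, B (X i) v • X i = v := by
  rw [← hX.2] at hv
  induction hv using Submodule.span_induction with
  | mem x hx =>
    obtain ⟨j, rfl⟩ := hx
    simp [hX.1]
  | zero => simp
  | add x y _ _ hx hy => simp only [map_add, add_smul, Finset.sum_add_distrib, hx, hy]
  | smul r x _ hx => simp only [map_smul, smul_eq_mul, mul_smul, ← Finset.smul_sum, hx]

/-- Positivity makes the form nondegenerate on the center, so the algebra splits as center plus
horizontal space. The latter has dimension m because of X, which leaves n for the center; an
orthogonal basis of the center is then normalized. -/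
theorem exists_isAdaptedONB [FiniteDimensional ℝ L] (hdim : Module.finrank ℝ L = m + n)
    {B : LinearMap.BilinForm ℝ L} (hB : IsHTypeInner B) {X : Fin m → L}
    (hX : IsHorizontalONB B X) :
    Module.finrank ℝ (LieAlgebra.center ℝ L).toSubmodule = n ∧
      ∃ Z : Fin n → L, IsAdaptedONB B X Z := by
  set C := (LieAlgebra.center ℝ L).toSubmodule with hC
  have hsymm : B.IsSymm := ⟨fun v w => by simpa using hB.symm v w⟩
  have hXmem (i : Fin m) : X i ∈ horizontal B := hX.2 ▸ Submodule.subset_span ⟨i, rfl⟩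
  have hXlin : LinearIndependent ℝ X := by
    rw [Fintype.linearIndependent_iff]
    intro g hg j
    have := congrArg (B (X j)) hg
    simpa [hX.1] using this
  have hnondeg : (B.restrict C).Nondegenerate := by
    refine (LinearMap.IsRefl.nondegenerate_iff_separatingLeft ?_).2 ?_
    · exact fun v w h => by
        rw [LinearMap.BilinForm.restrict_apply] at h ⊢
        simpa [hB.symm] using h
    · intro v hv
      by_contra hne
      have h1 : (v : L) ≠ 0 := fun h => hne (Subtype.ext h)
      exact (hB.pos v h1).ne' (hv v)
  have hcompl : IsCompl C (horizontal B) :=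
    LinearMap.BilinForm.isCompl_orthogonal_of_restrict_nondegenerate hsymm.isRefl hnondeg
  have hrank : Module.finrank ℝ C = n := by
    have h1 := Submodule.finrank_add_eq_of_isCompl hcompl
    have h2 : Module.finrank ℝ (horizontal B) = m := by
      rw [← hX.2, finrank_span_eq_card hXlin, Fintype.card_fin]
    omega
  refine ⟨hrank, ?_⟩
  obtain ⟨b, hb⟩ := LinearMap.BilinForm.exists_orthogonal_basis
    (B := B.restrict C) ⟨fun v w => by simpa using hB.symm v w⟩
  set b' := b.reindex (finCongr hrank) with hb'
  have hb'o (k l : Fin n) (h : k ≠ l) : B (b' k : L) (b' l : L) = 0 := by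
    have := hb (i := (finCongr hrank).symm k) (j := (finCongr hrank).symm l)
      (by simpa using h)
    simpa [hb'] using this
  have hpos (k : Fin n) : 0 < B (b' k : L) (b' k : L) :=
    hB.pos _ fun h => b'.ne_zero k (Subtype.ext h)
  set Z : Fin n → L := fun k => (Real.sqrt (B (b' k : L) (b' k : L)))⁻¹ • (b' k : L) with hZ
  have hZmem (k : Fin n) : Z k ∈ LieAlgebra.center ℝ L :=
    C.smul_mem _ (b' k).2
  have hZZ (k l : Fin n) : B (Z k) (Z l) = if k = l then 1 else 0 := by
    by_cases h : k = l
    · subst h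
      simp only [hZ, map_smul, LinearMap.smul_apply, smul_eq_mul, if_true]
      rw [← mul_assoc, ← mul_inv, Real.mul_self_sqrt (hpos k).le, inv_mul_cancel₀ (hpos k).ne']
    · simp [hZ, hb'o k l h, h]
  have hsumZ (z : L) (hz : z ∈ LieAlgebra.center ℝ L) : ∑ k, B (Z k) z • Z k = z := by
    have h1 : z = ∑ k, b'.repr ⟨z, hz⟩ k • (b' k : L) := by
      have h3 := congrArg C.subtype (b'.sum_repr ⟨z, hz⟩)
      rw [map_sum] at h3
      exact h3.symm
    have h2 (k : Fin n) : B (Z k) z • Z k = b'.repr ⟨z, hz⟩ k • (b' k : L) := by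
      have h3 : B (Z k) z = (Real.sqrt (B (b' k : L) (b' k : L)))⁻¹ *
          (b'.repr ⟨z, hz⟩ k * B (b' k : L) (b' k : L)) := by
        conv_lhs => rw [h1]
        simp only [hZ, map_smul, LinearMap.smul_apply, smul_eq_mul, map_sum]
        rw [Finset.sum_eq_single k (fun l _ h => by rw [hb'o k l h.symm]; simp) (by simp)]
        ring
      rw [h3, hZ, smul_smul]
      congr 1
      have h4 := Real.mul_self_sqrt (hpos k).le
      have h5 : Real.sqrt (B (b' k : L) (b' k : L)) ≠ 0 := (Real.sqrt_pos.2 (hpos k)).ne'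
      field_simp
      rw [sq, h4, mul_comm]
    simp only [h2, ← h1]
  have hZX (k : Fin n) (i : Fin m) : B (Z k) (X i) = 0 :=
    mem_horizontal_iff.1 (hXmem i) _ (hZmem k)
  refine ⟨Z, hXmem, hZmem, hX.1, hZZ, hZX, fun i k => by rw [hB.symm, hZX],
    fun v hv => hX.eq_sum hv, hsumZ, fun w => ?_⟩
  obtain ⟨z, hz, v, hv, rfl⟩ : ∃ z ∈ C, ∃ v ∈ horizontal B, z + v = w :=
    Submodule.mem_sup.1 (hcompl.sup_eq_top ▸ Submodule.mem_top)
  have e1 (k : Fin n) : B (Z k) v = 0 := mem_horizontal_iff.1 hv _ (hZmem k)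
  have e2 (i : Fin m) : B (X i) z = 0 := by
    rw [hB.symm]; exact mem_horizontal_iff.1 (hXmem i) _ hz
  simp only [map_add, e1, e2, add_zero, zero_add, hX.eq_sum hv, hsumZ z hz]
  abel

/-- The structure constants in adapted orthonormal bases. -/
def structureConstants (B : LinearMap.BilinForm ℝ L) (X : Fin m → L) (Z : Fin n → L) :
    Fin n → Fin m → Fin m → ℝ := fun k i j => B (Z k) ⁅X i, X j⁆

/-- For s = |z|, the numbers ⟨z, [v, X_j]⟩ are s times the coordinates of J_{z/s} v in the basis X.
Orthogonality of J and Parseval give the identity. -/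
theorem isHType_structureConstants {B : LinearMap.BilinForm ℝ L} (hB : IsHTypeInner B)
    {X : Fin m → L} {Z : Fin n → L} (h : IsAdaptedONB B X Z) :
    Model.IsHType (structureConstants B X Z) := by
  refine ⟨fun k i j => ?_, fun q p => ?_⟩
  · simp only [structureConstants]
    rw [← lie_skew, map_neg]
  · set z : L := ∑ k, q k • Z k with hz
    set v : L := ∑ i, p i • X i with hv
    have hzmem : z ∈ LieAlgebra.center ℝ L :=
      (LieAlgebra.center ℝ L).toSubmodule.sum_mem fun k _ =>
        (LieAlgebra.center ℝ L).toSubmodule.smul_mem _ (h.mem_center k)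
    have hvmem : v ∈ horizontal B :=
      (horizontal B).sum_mem fun i _ => (horizontal B).smul_mem _ (h.mem_horizontal i)
    have hzz : B z z = ∑ k, q k ^ 2 := by
      simp [hz, h.inner_Z, LinearMap.sum_apply, sq]
    have hvv : B v v = ∑ i, p i ^ 2 := by
      simp [hv, h.inner_X, LinearMap.sum_apply, sq]
    have hbr (j : Fin m) : ∑ k, q k * ∑ i, p i * structureConstants B X Z k i j =
        B z ⁅v, X j⁆ := by
      simp only [hz, hv, structureConstants, sum_lie, smul_lie, map_sum, map_smul,
        LinearMap.sum_apply, LinearMap.smul_apply, smul_eq_mul, Finset.mul_sum]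
      rw [Finset.sum_comm]
      refine Finset.sum_congr rfl fun i _ => Finset.sum_congr rfl fun k _ => by ring
    simp only [hbr]
    rw [← hzz, ← hvv]
    by_cases hz0 : z = 0
    · simp [hz0]
    have hpos := hB.pos z hz0
    set s := Real.sqrt (B z z) with hs
    have hspos : 0 < s := Real.sqrt_pos.2 hpos
    have hss : s * s = B z z := Real.mul_self_sqrt hpos.le
    obtain ⟨J, hJ, hJo⟩ := hB.orthogonal_J (s⁻¹ • z)
      ((LieAlgebra.center ℝ L).toSubmodule.smul_mem _ hzmem) (by
        simp only [map_smul, LinearMap.smul_apply, smul_eq_mul]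
        rw [← mul_assoc, ← mul_inv, hss, inv_mul_cancel₀ hpos.ne'])
    set V : horizontal B := ⟨v, hvmem⟩
    have hJj (j : Fin m) : B z ⁅v, X j⁆ = s * B (X j) (J V : L) := by
      have h1 := hJ V ⟨X j, h.mem_horizontal j⟩
      rw [hB.symm] at h1
      simp only [map_smul, LinearMap.smul_apply, smul_eq_mul] at h1
      rw [h1, ← mul_assoc, mul_inv_cancel₀ hspos.ne', one_mul]
    have hnorm : ∑ j, B (X j) (J V : L) ^ 2 = B v v := by
      have h2 : B (J V : L) (J V : L) = B v v := hJo V V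
      rw [← h2]
      have h3 := congrArg (B (J V : L)) (h.eq_sum_X _ (J V).2)
      rw [← h3, map_sum]
      refine Finset.sum_congr rfl fun j _ => ?_
      rw [map_smul, smul_eq_mul, hB.symm (J V : L), sq]
    calc ∑ j, B z ⁅v, X j⁆ ^ 2 = s * s * ∑ j, B (X j) (J V : L) ^ 2 := by
          rw [Finset.mul_sum]
          exact Finset.sum_congr rfl fun j _ => by rw [hJj]; ring
      _ = B z z * B v v := by rw [hss, hnorm]

/-! ### Degenerate dimensions. -/

theorem dim_center_pos_of_dim_horizontal_pos {B : LinearMap.BilinForm ℝ L}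
    (hB : IsHTypeInner B) {X : Fin m → L} {Z : Fin n → L} (h : IsAdaptedONB B X Z)
    (hm : 0 < m) : 0 < n := by
  by_contra! hn
  obtain rfl : n = 0 := by omega
  have hc (z : L) (hz : z ∈ LieAlgebra.center ℝ L) : z = 0 := by simpa using (h.eq_sum_Z z hz).symm
  have hhor (w : L) : w ∈ horizontal B := mem_horizontal_iff.2 fun z hz => by simp [hc z hz]
  have hlie (v w : L) : ⁅v, w⁆ = 0 := by
    refine hc _ ?_
    have : ⁅v, w⁆ ∈ (LieAlgebra.center ℝ L).toSubmodule :=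
      hB.span_bracket ▸ Submodule.subset_span ⟨v, hhor v, w, hhor w, rfl⟩
    exact this
  -- With a trivial center every vector is horizontal and every bracket vanishes; the algebra is
  -- abelian, so X₀ is central, hence zero.
  have h1 : X ⟨0, hm⟩ = 0 := hc _ ((LieModule.mem_maxTrivSubmodule ℝ L L _).2 fun w => hlie w _)
  have h2 := h.inner_X ⟨0, hm⟩ ⟨0, hm⟩
  simp [h1] at h2

theorem dim_center_eq_zero_of_dim_horizontal_eq_zero {B : LinearMap.BilinForm ℝ L}
    (hB : IsHTypeInner B) {X : Fin m → L} {Z : Fin n → L} (h : IsAdaptedONB B X Z)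
    (hm : m = 0) : n = 0 := by
  subst hm
  by_contra hn
  have k : Fin n := ⟨0, Nat.pos_of_ne_zero hn⟩
  have hk : Z k ∈ Submodule.span ℝ
      {y : L | ∃ v ∈ horizontal B, ∃ w ∈ horizontal B, ⁅v, w⁆ = y} := by
    rw [hB.span_bracket]; exact h.mem_center k
  have h0 : {y : L | ∃ v ∈ horizontal B, ∃ w ∈ horizontal B, ⁅v, w⁆ = y} ⊆ {0} := by
    rintro _ ⟨v, hv, w, -, rfl⟩
    have : v = 0 := by simpa using (h.eq_sum_X v hv).symm
    simp [this]
  have h1 : Z k = 0 := by simpa using Submodule.span_mono h0 hk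
  have h2 := h.inner_Z k k
  simp [h1] at h2

end LieCoordinates

end HType

end

noncomputable section

namespace HType

open Filter Topology

/-! ### Left-invariant fields, brackets and the exponential map -/

section LeftInvariant

variable {m n : ℕ} [Group (Space m n)]

/-- The identification of the Lie algebra with the vector space which carries the group. -/
def toSpace : LieAlg (Space m n) → Space m n := fun w => w

/-- The left-invariant field given by `w`, as a map of the vector space. -/
def invariantField (w : LieAlg (Space m n)) : Space m n → Space m n :=
  fun x => mulInvariantVectorField w x

/-- The group law is `x + y + β x y`, where the bilinear map `β` takes values in `{x₁ = 0}` and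
depends only on the first components. -/
structure IsStepTwoLaw (β : Space m n →L[ℝ] Space m n →L[ℝ] Space m n) : Prop where
  one_eq : (1 : Space m n) = 0
  mul_eq : ∀ x y : Space m n, x * y = x + y + β x y
  left : ∀ x y, firstProj m n x = 0 → β x y = 0
  right : ∀ x y, firstProj m n y = 0 → β x y = 0
  proj : ∀ x y, firstProj m n (β x y) = 0

variable {β : Space m n →L[ℝ] Space m n →L[ℝ] Space m n}

theorem IsStepTwoLaw.left_left (h : IsStepTwoLaw β) (x y z : Space m n) : β (β x y) z = 0 :=
  h.left _ _ (h.proj _ _)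

theorem IsStepTwoLaw.right_right (h : IsStepTwoLaw β) (x y z : Space m n) : β z (β x y) = 0 :=
  h.right _ _ (h.proj _ _)

theorem IsStepTwoLaw.invariantField_eq (h : IsStepTwoLaw β) (w : LieAlg (Space m n))
    (x : Space m n) : invariantField w x = toSpace w + β x (toSpace w) := by
  have h1 : (fun y : Space m n => x * y) = fun y => x + y + β x y := funext fun y => h.mul_eq x y
  have h2 : HasFDerivAt (fun y : Space m n => x + y + β x y)
      (ContinuousLinearMap.id ℝ (Space m n) + β x) 1 :=
    ((hasFDerivAt_id _).const_add x).add (β x).hasFDerivAt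
  have h3 : mfderiv 𝓘(ℝ, Space m n) 𝓘(ℝ, Space m n) (fun y : Space m n => x * y) 1 =
      ContinuousLinearMap.id ℝ (Space m n) + β x := by
    rw [h1]
    exact mfderiv_eq_fderiv.trans h2.fderiv
  exact congrArg (fun L : Space m n →L[ℝ] Space m n => L (toSpace w)) h3

theorem toSpace_add (v w : LieAlg (Space m n)) : toSpace (v + w) = toSpace v + toSpace w := rfl

theorem toSpace_smul (r : ℝ) (w : LieAlg (Space m n)) : toSpace (r • w) = r • toSpace w := rfl

/-- The identification as a linear equivalence. -/
def toSpaceEquiv : LieAlg (Space m n) ≃ₗ[ℝ] Space m n where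
  toFun := toSpace
  invFun := fun w => w
  map_add' := toSpace_add
  map_smul' := toSpace_smul
  left_inv := fun _ => rfl
  right_inv := fun _ => rfl

/-- The curve solves γ' = a + β(γ, a). Its first component is ta, and β sees nothing else, so γ' = a
+ tβ(a, a), which integrates at once and has only one solution from the identity. -/
theorem IsStepTwoLaw.isExp_iff (h : IsStepTwoLaw β) (w : LieAlg (Space m n)) (x : Space m n) :
    IsExp w x ↔ x = toSpace w + (1 / 2 : ℝ) • β (toSpace w) (toSpace w) := by
  set a := toSpace w with ha
  set k : ℝ → Space m n := fun t => t • a + (t ^ 2 / 2) • β a a with hk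
  have hkd (t : ℝ) : HasDerivAt k (a + t • β a a) t := by
    have h1 : HasDerivAt (fun t : ℝ => t • a) a t := by simpa using (hasDerivAt_id t).smul_const a
    have h2 : HasDerivAt (fun t : ℝ => (t ^ 2 / 2) • β a a) (t • β a a) t := by
      simpa using ((hasDerivAt_pow 2 t).div_const 2).smul_const (β a a)
    exact h1.add h2
  have hk1 : k 1 = a + (1 / 2 : ℝ) • β a a := by simp [hk]
  constructor
  · rintro ⟨γ, h0, hγ, rfl⟩
    replace hγ (t : ℝ) : HasDerivAt γ (a + β (γ t) a) t := by
      rw [ha, ← h.invariantField_eq]; exact hγ t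
    set p := firstProj m n
    have hz (f : ℝ → Space m n) (hf : ∀ t, HasDerivAt f 0 t) (t : ℝ) : f t = f 0 :=
      is_const_of_deriv_eq_zero (fun t => (hf t).differentiableAt) (fun t => (hf t).deriv) t 0
    have hp (t : ℝ) : p (γ t) = t • p a := by
      have h1 (t : ℝ) : HasDerivAt (fun t => p (γ t) - t • p a) 0 t := by
        have h2 := (p.hasFDerivAt.comp_hasDerivAt t (hγ t)).sub ((hasDerivAt_id t).smul_const (p a))
        refine h2.congr_deriv ?_
        rw [map_add, h.proj]; simp
      have h3 := hz _ h1 t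
      simp only [h0, h.one_eq, map_zero, zero_smul, sub_zero] at h3
      exact sub_eq_zero.1 h3
    have hβ (t : ℝ) : β (γ t) a = t • β a a := by
      have h1 : β (γ t - t • a) a = 0 := h.left _ _ (by rw [map_sub, map_smul, hp, sub_self])
      rw [map_sub, map_smul] at h1
      exact sub_eq_zero.1 h1
    have h4 (t : ℝ) : HasDerivAt (fun t => γ t - k t) 0 t := by
      refine ((hγ t).sub (hkd t)).congr_deriv ?_
      rw [hβ, sub_self]
    have h5 := hz _ h4 1
    rw [h0, h.one_eq] at h5
    simp only [hk, zero_smul, ne_eq, OfNat.ofNat_ne_zero, not_false_eq_true, zero_pow, zero_div,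
      add_zero, sub_zero] at h5
    rw [← hk1]
    exact sub_eq_zero.1 h5
  · rintro rfl
    refine ⟨k, by simp [hk, h.one_eq], fun t => ?_, hk1⟩
    refine (hkd t).congr_deriv (Eq.trans ?_ (h.invariantField_eq w (k t)).symm)
    rw [← ha, hk]
    simp only [map_add, map_smul, add_apply, smul_apply, h.left_left, smul_zero, add_zero]

/-- Left-invariant fields are affine, x ↦ w + β(x, w), so their bracket at the identity is the
antisymmetrization of β. -/
theorem IsStepTwoLaw.lie_eq (h : IsStepTwoLaw β) (v w : LieAlg (Space m n)) :
    toSpace ⁅v, w⁆ = β (toSpace v) (toSpace w) - β (toSpace w) (toSpace v) := by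
  have hf (w : LieAlg (Space m n)) :
      invariantField w = fun x => toSpace w + β.flip (toSpace w) x :=
    funext fun x => h.invariantField_eq w x
  have hd (w : LieAlg (Space m n)) (x : Space m n) :
      fderiv ℝ (invariantField w) x = β.flip (toSpace w) := by
    rw [hf]
    exact ((β.flip (toSpace w)).hasFDerivAt.const_add _).fderiv
  have h0 (w : LieAlg (Space m n)) : invariantField w 1 = toSpace w := by
    rw [h.invariantField_eq, h.one_eq, map_zero]
    exact add_zero _
  have h1 : toSpace ⁅v, w⁆ =
      VectorField.lieBracket ℝ (invariantField v) (invariantField w) 1 := by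
    have h2 := VectorField.mlieBracketWithin_eq_lieBracketWithin (𝕜 := ℝ) (E := Space m n)
      (V := mulInvariantVectorField v) (W := mulInvariantVectorField w) (s := Set.univ)
    rw [VectorField.mlieBracketWithin_univ] at h2
    have h3 : VectorField.lieBracketWithin ℝ (invariantField v) (invariantField w) Set.univ =
      VectorField.lieBracket ℝ (invariantField v) (invariantField w) :=
      VectorField.lieBracketWithin_univ
    exact (congrFun h2 1).trans (congrFun h3 1)
  rw [h1, VectorField.lieBracket_eq]
  simp only [hd, h0]
  rfl

instance finiteDimensional_lieAlg : FiniteDimensional ℝ (LieAlg (Space m n)) :=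
  (toSpaceEquiv (m := m) (n := n)).symm.finiteDimensional

variable [SmoothGroup (Space m n)]

/-- If the dimensions fit, then the center consists of the vectors with vanishing first
component. -/
theorem IsStepTwoLaw.firstProj_eq_zero_of_mem_center (h : IsStepTwoLaw β)
    (hrank : Module.finrank ℝ (LieAlgebra.center ℝ (LieAlg (Space m n))).toSubmodule = n)
    {z : LieAlg (Space m n)} (hz : z ∈ LieAlgebra.center ℝ (LieAlg (Space m n))) :
    firstProj m n (toSpace z) = 0 := by
  set inc : (Fin n → ℝ) →ₗ[ℝ] Space m n :=
    { toFun := fun q => WithLp.toLp 2 (Sum.elim 0 q)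
      map_add' := fun x y => by ext (i | i) <;> simp
      map_smul' := fun r x => by ext (i | i) <;> simp } with hinc
  have hproj (q : Fin n → ℝ) : firstProj m n (inc q) = 0 := by
    ext (i | i)
    · simp [firstProj_inl, hinc]
    · simp [firstProj_inr]
  have hmem (q : Fin n → ℝ) : toSpaceEquiv.symm (inc q) ∈
      (LieAlgebra.center ℝ (LieAlg (Space m n))).toSubmodule := by
    refine (LieModule.mem_maxTrivSubmodule ℝ _ _ _).2 fun w => ?_
    refine toSpaceEquiv.injective (Eq.trans (h.lie_eq w (toSpaceEquiv.symm (inc q))) ?_)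
    have e : toSpace (toSpaceEquiv.symm (inc q)) = inc q := rfl
    rw [e, h.right _ _ (hproj q), h.left _ _ (hproj q), sub_zero, map_zero]
  set F := LinearMap.codRestrict _ (toSpaceEquiv.symm.toLinearMap.comp inc) hmem with hF
  have hinj : Function.Injective F := by
    intro q q' hq
    have h1 : inc q = inc q' := congrArg (fun t => toSpace (Subtype.val t)) hq
    ext k
    exact congrArg (fun x : Space m n => x (Sum.inr k)) h1
  -- The n-dimensional space {x₁ = 0} embeds in the center, and equality of dimensions makes it the
  -- whole center.
  have hsurj : Function.Surjective F :=
    (LinearMap.injective_iff_surjective_of_finrank_eq_finrank (by rw [hrank]; simp)).1 hinj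
  obtain ⟨q, hq⟩ := hsurj ⟨z, hz⟩
  have h1 : inc q = toSpace z := congrArg (fun t => toSpace (Subtype.val t)) hq
  rw [← h1, hproj]

end LeftInvariant

end HType

end

noncomputable section

namespace HType

open Filter Topology

/-! ### Dilated exponential coordinates around a point -/

section Coordinates

variable {L : Type*} [LieRing L] [LieAlgebra ℝ L] {m n : ℕ} {B : LinearMap.BilinForm ℝ L}
  {X : Fin m → L} {Z : Fin n → L}

/-- The linear coordinates given by adapted orthonormal bases. -/
def IsAdaptedONB.equiv (h : IsAdaptedONB B X Z) : Model m n ≃ₗ[ℝ] L where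
  toFun y := ∑ i, y.1 i • X i + ∑ k, y.2 k • Z k
  invFun w := (fun i => B (X i) w, fun k => B (Z k) w)
  map_add' x y := by
    simp only [Prod.fst_add, Prod.snd_add, Pi.add_apply, add_smul, Finset.sum_add_distrib]
    abel
  map_smul' r y := by
    simp only [Prod.smul_fst, Prod.smul_snd, Pi.smul_apply, smul_eq_mul, mul_smul,
      ← Finset.smul_sum, smul_add, RingHom.id_apply]
  left_inv y := by
    ext i
    · simp [h.inner_X, h.inner_XZ]
    · simp [h.inner_Z, h.inner_ZX]
  right_inv w := h.eq_sum w

theorem IsAdaptedONB.equiv_apply (h : IsAdaptedONB B X Z) (y : Model m n) :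
    h.equiv y = ∑ i, y.1 i • X i + ∑ k, y.2 k • Z k := rfl

theorem IsAdaptedONB.horizontal_part_mem (h : IsAdaptedONB B X Z) (p : Fin m → ℝ) :
    ∑ i, p i • X i ∈ horizontal B :=
  (horizontal B).sum_mem fun i _ => (horizontal B).smul_mem _ (h.mem_horizontal i)

theorem IsAdaptedONB.central_part_mem (h : IsAdaptedONB B X Z) (q : Fin n → ℝ) :
    ∑ k, q k • Z k ∈ LieAlgebra.center ℝ L :=
  (LieAlgebra.center ℝ L).toSubmodule.sum_mem fun k _ =>
    (LieAlgebra.center ℝ L).toSubmodule.smul_mem _ (h.mem_center k)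

theorem IsAdaptedONB.gauge_eq (h : IsAdaptedONB B X Z) (y : Model m n) :
    B (∑ i, y.1 i • X i) (∑ i, y.1 i • X i) ^ 2 +
      16 * B (∑ k, y.2 k • Z k) (∑ k, y.2 k • Z k) = Model.gauge y := by
  have h1 : B (∑ i, y.1 i • X i) (∑ i, y.1 i • X i) = ∑ i, y.1 i ^ 2 := by
    simp [h.inner_X, LinearMap.sum_apply, sq]
  have h2 : B (∑ k, y.2 k • Z k) (∑ k, y.2 k • Z k) = ∑ k, y.2 k ^ 2 := by
    simp [h.inner_Z, LinearMap.sum_apply, sq]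
  rw [h1, h2, Model.gauge]

theorem IsAdaptedONB.lie_equiv (h : IsAdaptedONB B X Z) (y : Model m n) (j : Fin m) :
    ⁅h.equiv y, X j⁆ = ∑ i, y.1 i • ⁅X i, X j⁆ := by
  rw [h.equiv_apply, add_lie, lie_eq_zero_of_mem_center_left (h.central_part_mem _), add_zero,
    sum_lie]
  simp only [smul_lie]

theorem IsAdaptedONB.equiv_field (hB : IsHTypeInner B) (h : IsAdaptedONB B X Z) (j : Fin m)
    (y : Model m n) :
    h.equiv (Model.field (structureConstants B X Z) j y) =
      X j + (1 / 2 : ℝ) • ⁅h.equiv y, X j⁆ := by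
  have hmem (i : Fin m) : ⁅X i, X j⁆ ∈ LieAlgebra.center ℝ L := by
    have : ⁅X i, X j⁆ ∈ (LieAlgebra.center ℝ L).toSubmodule :=
      hB.span_bracket ▸ Submodule.subset_span
        ⟨X i, h.mem_horizontal i, X j, h.mem_horizontal j, rfl⟩
    exact this
  have h1 (i : Fin m) := h.eq_sum_Z _ (hmem i)
  rw [h.lie_equiv, h.equiv_apply]
  congr 1
  · simp [Model.field, Pi.single_apply, ite_smul]
  · simp only [Model.field, structureConstants, Finset.smul_sum]
    calc ∑ k, (1 / 2 * ∑ i, y.1 i * B (Z k) ⁅X i, X j⁆) • Z k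
        = ∑ k, ∑ i, ((1 / 2 : ℝ) • y.1 i • B (Z k) ⁅X i, X j⁆ • Z k) := by
          refine Finset.sum_congr rfl fun k _ => ?_
          rw [Finset.mul_sum, Finset.sum_smul]
          refine Finset.sum_congr rfl fun i _ => ?_
          rw [smul_smul, smul_smul, mul_assoc]
      _ = ∑ i, ((1 / 2 : ℝ) • y.1 i • ∑ k, B (Z k) ⁅X i, X j⁆ • Z k) := by
          rw [Finset.sum_comm]
          simp only [Finset.smul_sum]
      _ = _ := by simp only [h1]

end Coordinates

/-! ### The exponential chart: derivative, balls, injectivity and measure. -/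

section Chart

variable {m n : ℕ}

/-- Dilations as continuous linear maps. -/
def dilCLM (R : ℝ) : Model m n →L[ℝ] Model m n :=
  (R • ContinuousLinearMap.id ℝ (Fin m → ℝ)).prodMap (R ^ 2 • ContinuousLinearMap.id ℝ (Fin n → ℝ))

theorem dilCLM_apply (R : ℝ) (y : Model m n) : dilCLM R y = Model.dil R y := rfl

theorem dil_field (c : Fin n → Fin m → Fin m → ℝ) (r : ℝ) (j : Fin m) (y : Model m n) :
    Model.dil r (Model.field c j y) = r • Model.field c j (Model.dil r y) := by
  have h1 := Model.fderiv_dil_field c r j y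
  rw [← h1]
  exact (congrArg (fun A : Model m n →L[ℝ] Model m n => A (Model.field c j y))
    ((dilCLM r).fderiv (x := y))).symm

variable [Group (Space m n)] {β : Space m n →L[ℝ] Space m n →L[ℝ] Space m n}

/-- The map `y ↦ x₀ ∘ Exp(ℓ(δ_R y))`. -/
def chart (β : Space m n →L[ℝ] Space m n →L[ℝ] Space m n) (ℓ : Model m n →L[ℝ] Space m n)
    (x₀ : Space m n) (R : ℝ) (y : Model m n) : Space m n :=
  x₀ * (ℓ (Model.dil R y) + (1 / 2 : ℝ) • β (ℓ (Model.dil R y)) (ℓ (Model.dil R y)))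

theorem IsStepTwoLaw.chart_eq (h : IsStepTwoLaw β) (ℓ : Model m n →L[ℝ] Space m n)
    (x₀ : Space m n) (R : ℝ) (y : Model m n) :
    chart β ℓ x₀ R y = x₀ + (ℓ.comp (dilCLM R)) y +
      (1 / 2 : ℝ) • β ((ℓ.comp (dilCLM R)) y) ((ℓ.comp (dilCLM R)) y) +
      β x₀ ((ℓ.comp (dilCLM R)) y) := by
  rw [chart, h.mul_eq, map_add, map_smul, h.right_right]
  simp only [ContinuousLinearMap.comp_apply, dilCLM_apply, smul_zero, add_zero]
  abel

theorem IsStepTwoLaw.contDiff_chart (h : IsStepTwoLaw β) (ℓ : Model m n →L[ℝ] Space m n)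
    (x₀ : Space m n) (R : ℝ) {k : WithTop ℕ∞} : ContDiff ℝ k (chart β ℓ x₀ R) := by
  have : chart β ℓ x₀ R = fun y => x₀ + (ℓ.comp (dilCLM R)) y +
      (1 / 2 : ℝ) • β ((ℓ.comp (dilCLM R)) y) ((ℓ.comp (dilCLM R)) y) +
      β x₀ ((ℓ.comp (dilCLM R)) y) := funext (h.chart_eq ℓ x₀ R)
  rw [this]
  generalize ℓ.comp (dilCLM R) = K
  have h1 : ContDiff ℝ k fun y => β (K y) (K y) := (β.contDiff.comp K.contDiff).clm_apply K.contDiff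
  have h2 : ContDiff ℝ k fun y => β x₀ (K y) := (β x₀).contDiff.comp K.contDiff
  exact ((contDiff_const.add K.contDiff).add (h1.const_smul (1 / 2 : ℝ))).add h2

theorem IsStepTwoLaw.fderiv_chart (h : IsStepTwoLaw β) (ℓ : Model m n →L[ℝ] Space m n)
    (x₀ : Space m n) (R : ℝ) (y v : Model m n) :
    fderiv ℝ (chart β ℓ x₀ R) y v = ℓ (Model.dil R v) +
      (1 / 2 : ℝ) • (β (ℓ (Model.dil R y)) (ℓ (Model.dil R v)) +
        β (ℓ (Model.dil R v)) (ℓ (Model.dil R y))) + β x₀ (ℓ (Model.dil R v)) := by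
  have h0 : chart β ℓ x₀ R = fun y => x₀ + (ℓ.comp (dilCLM R)) y +
      (1 / 2 : ℝ) • β ((ℓ.comp (dilCLM R)) y) ((ℓ.comp (dilCLM R)) y) +
      β x₀ ((ℓ.comp (dilCLM R)) y) := funext (h.chart_eq ℓ x₀ R)
  set K := ℓ.comp (dilCLM R) with hK
  have h1 : HasFDerivAt (fun y => β (K y) (K y)) _ y :=
    (β.hasFDerivAt.comp y K.hasFDerivAt).clm_apply K.hasFDerivAt
  have h2 := ((K.hasFDerivAt (x := y).const_add x₀).add (h1.const_smul (1 / 2 : ℝ))).add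
    ((β x₀).hasFDerivAt.comp y K.hasFDerivAt)
  rw [h0]
  have h3 := congrArg (fun A => A v) h2.fderiv
  refine Eq.trans h3 ?_
  simp [hK, dilCLM_apply]

variable [SmoothGroup (Space m n)] {B : LinearMap.BilinForm ℝ (LieAlg (Space m n))}
  {X : Fin m → LieAlg (Space m n)} {Z : Fin n → LieAlg (Space m n)}

/-- The linear coordinates as a map to the vector space which carries the group. -/
def IsAdaptedONB.spaceEquiv (h : IsAdaptedONB B X Z) : Model m n ≃L[ℝ] Space m n :=
  (h.equiv.trans toSpaceEquiv).toContinuousLinearEquiv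

theorem IsAdaptedONB.spaceEquiv_apply (h : IsAdaptedONB B X Z) (y : Model m n) :
    h.spaceEquiv y = toSpace (h.equiv y) := rfl

/-- Dilated exponential coordinates around `x₀`. -/
def IsAdaptedONB.chart (h : IsAdaptedONB B X Z)
    (β : Space m n →L[ℝ] Space m n →L[ℝ] Space m n) (x₀ : Space m n) (R : ℝ) :
    Model m n → Space m n :=
  HType.chart β (h.spaceEquiv : Model m n →L[ℝ] Space m n) x₀ R

/-- The model field carries half the bracket, (β(w, x) - β(x, w))/2, and the derivative of β(w, w)/2
adds (β(w, x) + β(x, w))/2. The sum is β(w, x), as the left-invariant field requires. -/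
theorem IsAdaptedONB.fderiv_chart_field (h : IsAdaptedONB B X Z) (hB : IsHTypeInner B)
    (hβ : IsStepTwoLaw β) (x₀ : Space m n) (R : ℝ) (j : Fin m) (y : Model m n) :
    fderiv ℝ (h.chart β x₀ R) y (Model.field (structureConstants B X Z) j y) =
      R • invariantField (X j) (h.chart β x₀ R y) := by
  set w := h.spaceEquiv (Model.dil R y) with hw
  set xj := toSpace (X j) with hxj
  have h1 : h.spaceEquiv (Model.dil R (Model.field (structureConstants B X Z) j y)) =
      R • (xj + (1 / 2 : ℝ) • (β w xj - β xj w)) := by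
    rw [dil_field, map_smul, h.spaceEquiv_apply, h.equiv_field hB, toSpace_add, toSpace_smul,
      hβ.lie_eq]
    rfl
  have h2 : h.chart β x₀ R y = x₀ + w + (1 / 2 : ℝ) • β w w + β x₀ w := hβ.chart_eq _ x₀ R y
  rw [IsAdaptedONB.chart, hβ.fderiv_chart]
  simp only [ContinuousLinearEquiv.coe_coe]
  rw [h1, ← hw, hβ.invariantField_eq]
  change _ = R • (xj + β (h.chart β x₀ R y) xj)
  rw [h2]
  simp only [map_add, map_smul, map_sub, add_apply, smul_apply, sub_apply, hβ.left_left,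
    hβ.right_right]
  module

theorem IsAdaptedONB.gaugeBall_eq (h : IsAdaptedONB B X Z) (hβ : IsStepTwoLaw β)
    (x₀ : Space m n) {R : ℝ} (hR : 0 < R) (s : ℝ) :
    gaugeBall B x₀ (R * s) = h.chart β x₀ R '' {y | Model.gauge y < s ^ 4} := by
  ext x
  constructor
  · rintro ⟨x, ⟨v, hv, z, hz, hexp, hlt⟩, rfl⟩
    rw [hβ.isExp_iff] at hexp
    set y : Model m n := (fun i => B (X i) v, fun k => B (Z k) z) with hy
    have ev : ∑ i, y.1 i • X i = v := h.eq_sum_X v hv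
    have ez : ∑ k, y.2 k • Z k = z := h.eq_sum_Z z hz
    have hyw : h.equiv y = v + z := by rw [h.equiv_apply, ev, ez]
    have hg := h.gauge_eq y
    rw [ev, ez] at hg
    refine ⟨Model.dil R⁻¹ y, ?_, ?_⟩
    · rw [Set.mem_ofPred_eq, Model.gauge_dil, inv_pow, inv_mul_lt_iff₀ (by positivity), ← hg,
        ← mul_pow]
      exact hlt
    · have e : Model.dil R (Model.dil R⁻¹ y) = y := by
        rw [Model.dil_dil, mul_inv_cancel₀ hR.ne', Model.dil_one]
      simp only [IsAdaptedONB.chart, HType.chart, ContinuousLinearEquiv.coe_coe, e,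
        h.spaceEquiv_apply, hyw]
      rw [hexp]
  · rintro ⟨y, hy, rfl⟩
    refine ⟨_, ⟨∑ i, (Model.dil R y).1 i • X i, h.horizontal_part_mem _,
      ∑ k, (Model.dil R y).2 k • Z k, h.central_part_mem _, (hβ.isExp_iff _ _).2 rfl, ?_⟩, rfl⟩
    rw [h.gauge_eq, Model.gauge_dil, mul_pow]
    exact mul_lt_mul_of_pos_left hy (by positivity)

/-- The first projection ignores the quadratic term, so it agrees for both arguments; β depends only
on it, the quadratic terms cancel, and the linear parts coincide. -/
theorem IsAdaptedONB.chart_injective (h : IsAdaptedONB B X Z) (hβ : IsStepTwoLaw β)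
    (x₀ : Space m n) {R : ℝ} (hR : 0 < R) : Function.Injective (h.chart β x₀ R) := by
  intro y y' hyy
  have h1 := mul_left_cancel hyy
  simp only [ContinuousLinearEquiv.coe_coe] at h1
  set w := h.spaceEquiv (Model.dil R y)
  set w' := h.spaceEquiv (Model.dil R y')
  have h2 := congrArg (firstProj m n) h1
  simp only [map_add, map_smul, hβ.proj, smul_zero, add_zero] at h2
  have h3 : firstProj m n (w - w') = 0 := by rw [map_sub, h2, sub_self]
  have h4 : β w w = β w' w' := by
    have e1 := hβ.left (w - w') w h3
    have e2 := hβ.right w' (w - w') h3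
    rw [map_sub, sub_apply] at e1
    rw [map_sub] at e2
    rw [sub_eq_zero.1 e1, sub_eq_zero.1 e2]
  rw [h4] at h1
  have h5 : Model.dil R y = Model.dil R y' := h.spaceEquiv.injective (add_right_cancel h1)
  have h6 := congrArg (Model.dil R⁻¹) h5
  rwa [Model.dil_dil, Model.dil_dil, inv_mul_cancel₀ hR.ne', Model.dil_one, Model.dil_one] at h6

/-- Exponential coordinates transport Lebesgue measure to a multiple of Lebesgue measure. -/
theorem IsAdaptedONB.map_chart (h : IsAdaptedONB B X Z) (hβ : IsStepTwoLaw β)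
    (hcenter : ∀ w : LieAlg (Space m n), w ∈ LieAlgebra.center ℝ (LieAlg (Space m n)) ↔
      firstProj m n (toSpace w) = 0)
    (x₀ : Space m n) {R : ℝ} (hR : 0 < R) :
    ∃ κ : ENNReal, κ ≠ 0 ∧ κ ≠ ⊤ ∧
      Measure.map (h.chart β x₀ R) volume = κ • (volume : Measure (Space m n)) := by
  set ℓ := h.spaceEquiv with hℓ
  set y₀ := ℓ.symm x₀ with hy₀
  set hor : (Fin m → ℝ) →L[ℝ] Space m n :=
    (ℓ : Model m n →L[ℝ] Space m n).comp (ContinuousLinearMap.inl ℝ (Fin m → ℝ) (Fin n → ℝ)) with hhor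
  set G : (Fin m → ℝ) → Space m n := fun p =>
    (1 / 2 : ℝ) • β (hor p) (hor p) + β x₀ (hor p) with hG
  have hGcont : Continuous G := by
    have : Continuous fun p => β (hor p) (hor p) :=
      (β.continuous.comp hor.continuous).clm_apply hor.continuous
    exact (this.const_smul (1 / 2 : ℝ)).add ((β x₀).continuous.comp hor.continuous)
  have hGproj (p : Fin m → ℝ) : firstProj m n (G p) = 0 := by
    simp [hG, hβ.proj]
  -- The quadratic correction is central, so in adapted coordinates it moves only the second
  -- component, by an amount depending on the first.
  have hfst (p : Fin m → ℝ) : (ℓ.symm (G p)).1 = 0 := by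
    have hmem : toSpaceEquiv.symm (G p) ∈ LieAlgebra.center ℝ (LieAlg (Space m n)) :=
      (hcenter _).2 (hGproj p)
    ext i
    have e : (ℓ.symm (G p)).1 i = B (X i) (toSpaceEquiv.symm (G p)) := rfl
    rw [e, ← h.eq_sum_Z _ hmem]
    simp [h.inner_XZ]
  have hvert (y : Model m n) : firstProj m n (ℓ y - hor y.1) = 0 := by
    have e1 : ℓ y - hor y.1 = ℓ (0, y.2) := by
      rw [hhor, ContinuousLinearMap.comp_apply, ContinuousLinearEquiv.coe_coe, ← map_sub]
      congr 1
      ext <;> simp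
    rw [e1]
    refine (hcenter (h.equiv (0, y.2))).1 ?_
    have e2 : h.equiv (0, y.2) = ∑ k, y.2 k • Z k := by simp [h.equiv_apply]
    rw [e2]
    exact h.central_part_mem _
  have hβhor (y : Model m n) (x : Space m n) : β x (ℓ y) = β x (hor y.1) := by
    have := hβ.right x _ (hvert y)
    rw [map_sub] at this
    exact sub_eq_zero.1 this
  have hβhor' (y : Model m n) (x : Space m n) : β (ℓ y) x = β (hor y.1) x := by
    have := hβ.left _ x (hvert y)
    rw [map_sub, sub_apply] at this
    exact sub_eq_zero.1 this
  set sh : Model m n → Model m n := fun y =>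
    (y₀.1 + y.1, (y₀.2 + (ℓ.symm (G y.1)).2) + y.2) with hsh
  have hshmp : MeasurePreserving sh :=
    Model.measurePreserving_shear y₀.1 (g := fun p => y₀.2 + (ℓ.symm (G p)).2)
      (continuous_const.add (continuous_snd.comp (ℓ.symm.continuous.comp hGcont)))
  -- The chart is a dilation, then a translation with vertical shear, then a linear isomorphism;
  -- only the first and the last rescale the measure.
  have hfac : h.chart β x₀ R = ℓ ∘ (sh ∘ Model.dil R) := by
    ext1 y
    have e1 := hβ.chart_eq (ℓ : Model m n →L[ℝ] Space m n) x₀ R y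
    have e2 : sh (Model.dil R y) = y₀ + ℓ.symm (G (Model.dil R y).1) + Model.dil R y := by
      ext1
      · simp [hsh, hfst]
      · simp [hsh]
    refine Eq.trans e1 ?_
    simp only [Function.comp_apply, e2, map_add, ContinuousLinearEquiv.apply_symm_apply, hy₀,
      ContinuousLinearMap.comp_apply, ContinuousLinearEquiv.coe_coe, dilCLM_apply, hG, hβhor,
      hβhor']
    abel
  have hvol : (volume : Measure (Model m n)).IsAddHaarMeasure := by
    rw [Measure.volume_eq_prod]
    exact Measure.prod.instIsAddHaarMeasure _ _
  have hmapℓ : (Measure.map ℓ (volume : Measure (Model m n))).IsAddHaarMeasure :=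
    ℓ.isAddHaarMeasure_map _
  obtain ⟨κ, hκ0, hκt, hκ⟩ : ∃ κ : ENNReal, κ ≠ 0 ∧ κ ≠ ⊤ ∧
      Measure.map ℓ (volume : Measure (Model m n)) = κ • (volume : Measure (Space m n)) :=
    ⟨_, by simpa using (Measure.addHaarScalarFactor_pos_of_isAddHaarMeasure _ _).ne',
      ENNReal.coe_ne_top, Measure.isAddLeftInvariant_eq_smul _ _⟩
  refine ⟨ENNReal.ofReal ((R ^ (m + 2 * n))⁻¹) * κ, mul_ne_zero ?_ hκ0,
    ENNReal.mul_ne_top ENNReal.ofReal_ne_top hκt, ?_⟩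
  · rw [Ne, ENNReal.ofReal_eq_zero, not_le]
    positivity
  · have hdm : Measurable (Model.dil R : Model m n → Model m n) :=
      (Model.continuous_dil R).measurable
    rw [hfac, ← Measure.map_map ℓ.continuous.measurable (hshmp.measurable.comp hdm),
      ← Measure.map_map hshmp.measurable hdm, Model.map_dil hR, Measure.map_smul, hshmp.map_eq,
      Measure.map_smul, hκ, smul_smul]

end Chart

end HType

end

noncomputable section

namespace HType

open Filter Topology

/-! ### Transport of supersolutions to the model -/

section Transport

variable {m n : ℕ} [Group (Space m n)] {β : Space m n →L[ℝ] Space m n →L[ℝ] Space m n}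

theorem IsStepTwoLaw.contDiff_invariantField (h : IsStepTwoLaw β) (w : LieAlg (Space m n))
    {k : WithTop ℕ∞} : ContDiff ℝ k (invariantField w) := by
  have : invariantField w = fun x => toSpace w + β.flip (toSpace w) x :=
    funext fun x => h.invariantField_eq w x
  rw [this]
  exact contDiff_const.add (β.flip (toSpace w)).contDiff

variable [SmoothGroup (Space m n)]
  {B : LinearMap.BilinForm ℝ (LieAlg (Space m n))}
  {X : Fin m → LieAlg (Space m n)} {Z : Fin n → LieAlg (Space m n)}

theorem IsStepTwoLaw.mem_center_of_firstProj_eq_zero (h : IsStepTwoLaw β)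
    {w : LieAlg (Space m n)} (hw : firstProj m n (toSpace w) = 0) :
    w ∈ LieAlgebra.center ℝ (LieAlg (Space m n)) := by
  refine (LieModule.mem_maxTrivSubmodule ℝ _ _ _).2 fun v => ?_
  refine toSpaceEquiv.injective (Eq.trans (h.lie_eq v w) ?_)
  rw [h.right _ _ hw, h.left _ _ hw, sub_zero, map_zero]

theorem IsAdaptedONB.secondOp_comp_chart (h : IsAdaptedONB B X Z) (hB : IsHTypeInner B)
    (hβ : IsStepTwoLaw β) (x₀ : Space m n) (R : ℝ) {V : Set (Space m n)} (hV : IsOpen V)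
    {u : Space m n → ℝ} (hu : ContDiffOn ℝ 2 u V) (A : Space m n → Matrix (Fin m) (Fin m) ℝ)
    {y : Model m n} (hy : h.chart β x₀ R y ∈ V) :
    secondOp (Model.field (structureConstants B X Z)) (A (h.chart β x₀ R y))
      (fun z => u (h.chart β x₀ R z)) y = R ^ 2 * nondivOp X A u (h.chart β x₀ R y) := by
  simp only [secondOp, nondivOp, Finset.mul_sum]
  refine Finset.sum_congr rfl fun i _ => Finset.sum_congr rfl fun j _ => ?_
  rw [fieldDeriv_fieldDeriv_comp (T := h.chart β x₀ R) hV hu (hβ.contDiff_invariantField (X j))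
    (hβ.contDiff_chart _ x₀ R) (h.fderiv_chart_field hB hβ x₀ R i)
    (h.fderiv_chart_field hB hβ x₀ R j) hy]
  rw [mul_left_comm]
  rfl

/-- The critical density property in adapted coordinates. -/
theorem IsAdaptedONB.criticalDensity (h : IsAdaptedONB B X Z) (hB : IsHTypeInner B)
    (hβ : IsStepTwoLaw β)
    (hcenter : ∀ w : LieAlg (Space m n), w ∈ LieAlgebra.center ℝ (LieAlg (Space m n)) ↔
      firstProj m n (toSpace w) = 0) {α ε κ : ℝ}
    (H : ∀ c : Fin n → Fin m → Fin m → ℝ, Model.IsHType c →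
      ∀ U : Set (Model m n), IsOpen U → {y | Model.gauge y < 1} ⊆ U →
      ∀ u : Model m n → ℝ, ContDiffOn ℝ 2 u U → (∀ y ∈ U, 0 ≤ u y) →
      ∀ a : Model m n → Matrix (Fin m) (Fin m) ℝ, (∀ y ∈ U, Model.IsBarrierMatrix n α (a y)) →
      (∀ y ∈ U, secondOp (Model.field c) (a y) u y ≤ 0) →
      ENNReal.ofReal ε * volume {y : Model m n | Model.gauge y < 1} ≤
        volume {y : Model m n | Model.gauge y < 1 ∧ 1 ≤ u y} →
      ∀ h, Model.gauge h < (1 / 2) ^ 4 → κ ≤ u h)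
    {Ω : Set (Space m n)} {A : Space m n → Matrix (Fin m) (Fin m) ℝ}
    (hA : ∀ x ∈ Ω, Model.IsBarrierMatrix n α (A x)) :
    CriticalDensity volume (gaugeBall B) Ω (supersolutions X Ω A) ε κ := by
  rintro x₀ R hR - V u ⟨hV, hVΩ, hu, hu0, hLu⟩ hball hdens x hx
  simp only at hV hVΩ hu hu0 hLu
  set Ψ := h.chart β x₀ R with hΨ
  have hΨC : ContDiff ℝ 2 Ψ := hβ.contDiff_chart _ x₀ R
  have hinj : Function.Injective Ψ := h.chart_injective hβ x₀ hR
  have hemb : MeasurableEmbedding Ψ := hΨC.continuous.measurableEmbedding hinj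
  have hB1 : gaugeBall B x₀ R = Ψ '' {y | Model.gauge y < 1} := by
    have := h.gaugeBall_eq hβ x₀ hR 1
    rwa [mul_one, one_pow] at this
  have hB2 : gaugeBall B x₀ (2 * R) = Ψ '' {y | Model.gauge y < 2 ^ 4} := by
    rw [mul_comm]; exact h.gaugeBall_eq hβ x₀ hR 2
  have hBhalf : gaugeBall B x₀ (R / 2) = Ψ '' {y | Model.gauge y < (1 / 2) ^ 4} := by
    have e : R / 2 = R * (1 / 2) := by ring
    rw [e]; exact h.gaugeBall_eq hβ x₀ hR (1 / 2)
  rw [hBhalf] at hx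
  obtain ⟨y, hy, rfl⟩ := hx
  refine H _ (isHType_structureConstants hB h) (Ψ ⁻¹' V) (hV.preimage hΨC.continuous) ?_
    (fun z => u (Ψ z)) (hu.comp hΨC.contDiffOn fun z hz => hz) (fun z hz => hu0 _ hz)
    (fun z => A (Ψ z)) (fun z hz => hA _ (hVΩ hz)) ?_ ?_ y hy
  · intro z hz
    refine hball ?_
    rw [hB2]
    exact ⟨z, (Set.mem_ofPred_eq.mp hz).trans (by norm_num), rfl⟩
  · intro z hz
    rw [h.secondOp_comp_chart hB hβ x₀ R hV hu A hz]
    exact mul_nonpos_of_nonneg_of_nonpos (by positivity) (hLu _ hz)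
  · obtain ⟨μ, -, hμt, hμ⟩ := h.map_chart hβ hcenter x₀ hR
    -- Both sides of the density hypothesis acquire the same factor μ. As Ψ is a measurable
    -- embedding, this holds for every S.
    have hvol (S : Set (Space m n)) : volume (Ψ ⁻¹' S) = μ * volume S := by
      rw [← hemb.map_apply, hμ]; rfl
    have e1 : {z : Model m n | Model.gauge z < 1} = Ψ ⁻¹' gaugeBall B x₀ R := by
      rw [hB1, Set.preimage_image_eq _ hinj]
    have e2 : {z : Model m n | Model.gauge z < 1 ∧ 1 ≤ u (Ψ z)} =
        Ψ ⁻¹' {x ∈ gaugeBall B x₀ R | 1 ≤ u x} := by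
      ext z
      have : Ψ z ∈ gaugeBall B x₀ R ↔ Model.gauge z < 1 := by
        rw [hB1, hinj.mem_set_image]; rfl
      simp only [Set.mem_preimage, Set.mem_ofPred_eq, this]
    rw [e1, e2, hvol, hvol, mul_left_comm]
    gcongr

/-- The degenerate case of a group with one element. -/
theorem criticalDensity_of_subsingleton [Subsingleton (Space m n)] {Ω : Set (Space m n)}
    {K : Set (Set (Space m n) × (Space m n → ℝ))} :
    CriticalDensity volume (gaugeBall B) Ω K (1 / 2) 1 := by
  intro x₀ R hR _ V u _ _ hdens x hx
  have hxR : x ∈ gaugeBall B x₀ R := by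
    obtain ⟨y, ⟨v, hv, z, hz, he, hlt⟩, hyx⟩ := hx
    refine ⟨y, ⟨v, hv, z, hz, he, hlt.trans ?_⟩, hyx⟩
    exact pow_lt_pow_left₀ (by linarith) (by positivity) (by norm_num)
  have huniv : gaugeBall B x₀ R = Set.univ :=
    Set.eq_univ_of_forall fun y => Subsingleton.elim x y ▸ hxR
  have hpos : 0 < volume {y ∈ gaugeBall B x₀ R | 1 ≤ u y} := by
    refine lt_of_lt_of_le (ENNReal.mul_pos ?_ ?_) hdens
    · simp
    · rw [huniv]
      exact (isOpen_univ.measure_pos _ Set.univ_nonempty).ne'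
  obtain ⟨y, hy⟩ := nonempty_of_measure_ne_zero hpos.ne'
  rw [Subsingleton.elim x y]
  exact hy.2

/-- The instances are spelled out so that the vector space structure is the one underlying the Lie
algebra, as the abstract lemmas on H-type algebras expect. -/
theorem finrank_lieAlg : @Module.finrank ℝ (LieAlg (Space m n)) _
    LieRing.toAddCommGroup.toAddCommMonoid LieAlgebra.toModule = m + n := by
  exact (toSpaceEquiv (m := m) (n := n)).finrank_eq.trans (by simp)

theorem finiteDimensional_lieAlg_lie :
    @FiniteDimensional ℝ (LieAlg (Space m n)) _ LieRing.toAddCommGroup LieAlgebra.toModule := by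
  exact finiteDimensional_lieAlg

theorem exists_isAdaptedONB_lieAlg (hB : IsHTypeInner B) (hX : IsHorizontalONB B X) :
    Module.finrank ℝ (LieAlgebra.center ℝ (LieAlg (Space m n))).toSubmodule = n ∧
      ∃ Z : Fin n → LieAlg (Space m n), IsAdaptedONB B X Z :=
  @exists_isAdaptedONB (LieAlg (Space m n)) _ _ m n finiteDimensional_lieAlg_lie
    finrank_lieAlg B hB X hX

end Transport

end HType

end

/-! ### Conclusion. -/

theorem theorem2p1 {m n : ℕ} [Group (HType.Space m n)]
    [HType.SmoothGroup (HType.Space m n)]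
    (hdil : ∀ r : ℝ, 0 < r → ∀ x y : HType.Space m n,
      HType.dilation r (x * y) = HType.dilation r x * HType.dilation r y)
    (B : LinearMap.BilinForm ℝ (HType.LieAlg (HType.Space m n))) (hB : HType.IsHTypeInner B)
    (lam Lam δ : ℝ) (hlam : 0 < lam) (hLam : lam ≤ Lam) (hδ : 0 < δ) (hδ2 : δ ≤ 2) :
    ∃ ε c : ℝ, 0 < ε ∧ ε < 1 ∧ 0 < c ∧
      ∀ X : Fin m → HType.LieAlg (HType.Space m n), HType.IsHorizontalONB B X →
      ∀ Ω : Set (HType.Space m n), IsOpen Ω →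
      ∀ A : HType.Space m n → Matrix (Fin m) (Fin m) ℝ,
        (∀ x ∈ Ω, HType.IsElliptic lam Lam (A x)) →
        (∀ x ∈ Ω, HType.IsLandis n δ (A x)) →
        HType.CriticalDensity volume (HType.gaugeBall B) Ω (HType.supersolutions X Ω A) ε c := by
  obtain ⟨β, hmul, hleft, hright, hproj⟩ := HType.exists_bilinear_group_law hdil
  have hβ : HType.IsStepTwoLaw β :=
    ⟨HType.one_eq_zero_of_dilation hdil, hmul, hleft, hright, hproj⟩
  -- One basis suffices to find the dimension of the center, hence to identify it with {x₁ = 0}.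
  -- Without any basis the claim is vacuous.
  by_cases hX : ∃ X : Fin m → HType.LieAlg (HType.Space m n), HType.IsHorizontalONB B X
  swap
  · exact ⟨1 / 2, 1, by norm_num, by norm_num, one_pos, fun X hX' => (hX ⟨X, hX'⟩).elim⟩
  obtain ⟨X₀, hX₀⟩ := hX
  obtain ⟨hrank, Z₀, hZ₀⟩ := HType.exists_isAdaptedONB_lieAlg hB hX₀
  have hcenter (w : HType.LieAlg (HType.Space m n)) :
      w ∈ LieAlgebra.center ℝ (HType.LieAlg (HType.Space m n)) ↔
        HType.firstProj m n (HType.toSpace w) = 0 :=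
    ⟨hβ.firstProj_eq_zero_of_mem_center hrank, hβ.mem_center_of_firstProj_eq_zero⟩
  rcases Nat.eq_zero_or_pos m with hm | hm
  · obtain rfl := HType.dim_center_eq_zero_of_dim_horizontal_eq_zero hB hZ₀ hm
    subst hm
    have hsub : Subsingleton (HType.Space 0 0) := ⟨fun x y => by ext (i | i) <;> exact i.elim0⟩
    exact ⟨1 / 2, 1, by norm_num, by norm_num, one_pos, fun _ _ _ _ _ _ _ =>
      HType.criticalDensity_of_subsingleton⟩
  · have hn := HType.dim_center_pos_of_dim_horizontal_pos hB hZ₀ hm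
    have hm1 : (1 : ℝ) ≤ m := by exact_mod_cast hm
    have hn1 : (1 : ℝ) ≤ n := by exact_mod_cast hn
    -- α > 0 because m, n ≥ 1 give m + 2n ≥ 3 > δ, and 4α < Q because δ > 0. The constants are fixed
    -- before X is introduced; X only selects the structure constants to which `H` is applied.
    obtain ⟨ε, κ, hε, hε1, hκ, H⟩ := HType.Model.exists_criticalDensity m n
      (α := (m + 2 * n - δ) / 4) (by linarith) (by linarith)
    refine ⟨ε, κ, hε, hε1, hκ, fun X hX Ω _ A hell hlan => ?_⟩
    obtain ⟨-, Z, hZ⟩ := HType.exists_isAdaptedONB_lieAlg hB hX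
    exact hZ.criticalDensity hB hβ hcenter H fun x hx =>
      HType.isBarrierMatrix_of_landis hm hlam (hell x hx) (hlan x hx)
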